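/- Let $P$ and $X$ be smooth (finite-dimensional, Hausdorff, second countable) manifolds, $\pi\colon P\to X$ a submersion and $\mathcal F\subset\ker T\pi$ (the tangent distribution of) a foliation on $P$, with normal bundle $\nu(\mathcal F)=TP/\mathcal F$. A *Pfaffian distribution* is a smooth distribution (subbundle) $\mathcal C\subset TP$ such that $\mathcal C+\ker T\pi=TP$ and $\mathcal C\cap\ker T\pi$ is an involutive distribution. Let $W=\pi^*TX\to P$, and let $\overline\nabla$ be the restriction to $\mathcal F$ of the canonical flat $\ker T\pi$-connection on $W$, characterized by $\overline\nabla_v\,\pi^*Y=0$ for every vector field $Y$ on (an open subset of) $X$. Let $\Omega^\bullet_W$ be the sheaf of smooth sections of $\wedge^\bullet W^*$ and $\Omega^\bullet_{(W,\overline\nabla)}\subset\Omega^\bullet_W$ the subsheaf of forms $\alpha$ that are flat, $\overline\nabla_v\alpha=0$ for all $v\in\mathcal F$. A *(1-)derivation on $(W,\overline\nabla)$ relative to $\mathcal F$* is an $\mathbb R$-linear map of sheaves $D\colon\Omega^\bullet_{(W,\overline\nabla)}\to\Omega^{\bullet+1}_W$ with $$D(\alpha\wedge\beta)=D\alpha\wedge\beta+(-1)^{|\alpha|}\alpha\wedge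 D\beta .$$ A fibrewise linear map $\sigma\colon W\to\nu(\mathcal F)$ is a *symbol* of $D$ if $\langle Df,w\rangle=\langle df,\sigma(w)\rangle$ for every $w\in W$ and every local smooth function $f$ with $df|_{\mathcal F}=0$. We write $\pi_*D=\pi^*d$ if $D(\pi^*\alpha)=\pi^*(d\alpha)$ for all differential forms $\alpha$ on open subsets of $X$, where $d$ is the de Rham differential. There is a one-to-one correspondence $\mathcal C\leftrightarrow D$ between - Pfaffian distributions $\mathcal C\subset TP$ with $\mathcal C\cap\ker T\pi=\mathcal F$, and - derivations $D$ on $(\pi^*TX,\overline\nabla)$ relative to $\mathcal F$ with $\pi_*D=\pi^*d$. It is given as follows. The derivation $D^{\mathcal C}$ corresponding to $\mathcal C$ is $$(D^{\mathcal C}\alpha)(T\pi\, v_0,\dots,T\pi\, v_k)=d(\alpha\circ T\pi)(v_0,\dots,v_k),\qquad v_0,\dots,v_k\in\mathcal C_p,$$ for $\alpha\in\Omega^k_{(W,\overline\nabla)}$, where $\alpha\circ T\pi$ is $\alpha$ regarded as a differential $k$-form on an open subset of $P$; it has exactly one symbol, and this symbol is the inverse $\pi^*TX\cong\mathcal C/\mathcal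 F\subset\nu(\mathcal F)$ of the isomorphism induced by $T\pi$. Conversely, the distribution corresponding to $D$ is the preimage under $TP\to\nu(\mathcal F)$ of the image of the symbol of $D$. -/

import Mathlib

open Set Filter Topology TopologicalSpace
open scoped Manifold ContDiff

noncomputable section

namespace Pfaffian

/-! ### Exterior product of alternating forms -/

section Wedge

variable {E E' : Type*} [AddCommGroup E] [Module ℝ E] [TopologicalSpace E]
  [AddCommGroup E'] [Module ℝ E'] [TopologicalSpace E']

/-- The exterior product of two alternating forms, with the shuffle normalization
`(a ∧ b)(v) = ∑ sign(σ) a(v_{σ(1)}, …, v_{σ(k)}) b(v_{σ(k+1)}, …, v_{σ(k+l)})`, the sum being over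
all `(k, l)`-shuffles. -/
def wedge {k l : ℕ} (a : E [⋀^Fin k]→L[ℝ] ℝ) (b : E [⋀^Fin l]→L[ℝ] ℝ) :
    E [⋀^Fin (k + l)]→L[ℝ] ℝ :=
  let w : E [⋀^Fin (k + l)]→ₗ[ℝ] ℝ :=
    ((LinearMap.mul' ℝ ℝ).compAlternatingMap
      (AlternatingMap.domCoprod a.toAlternatingMap b.toAlternatingMap)).domDomCongr finSumFinEquiv
  { toMultilinearMap := w.toMultilinearMap
    cont := by
      change Continuous fun v : Fin (k + l) → E =>
        LinearMap.mul' ℝ ℝ ((∑ σ : Equiv.Perm.ModSumCongr (Fin k) (Fin l),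
          AlternatingMap.domCoprod.summand a.toAlternatingMap b.toAlternatingMap σ)
            fun i => v (finSumFinEquiv i))
      simp only [_root_.sum_apply, map_sum]
      refine continuous_finsetSum _ fun σ _ => ?_
      induction σ using Quotient.inductionOn' with | _ σ
      have h : (fun v : Fin (k + l) → E => LinearMap.mul' ℝ ℝ
          (AlternatingMap.domCoprod.summand a.toAlternatingMap b.toAlternatingMap
            (Quotient.mk'' σ) fun i => v (finSumFinEquiv i))) =
          fun v => Equiv.Perm.sign σ • ((a fun i => v (finSumFinEquiv (σ (Sum.inl i)))) *
            (b fun i => v (finSumFinEquiv (σ (Sum.inr i))))) := by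
        funext v
        exact map_zsmul (LinearMap.mul' ℝ ℝ) ((Equiv.Perm.sign σ : ℤˣ) : ℤ)
          ((a fun i => v (finSumFinEquiv (σ (Sum.inl i)))) ⊗ₜ[ℝ]
            (b fun i => v (finSumFinEquiv (σ (Sum.inr i)))))
      rw [h]
      refine Continuous.const_smul (Continuous.mul ?_ ?_) _
      · exact a.cont.comp (by fun_prop)
      · exact b.cont.comp (by fun_prop)
    map_eq_zero_of_eq' := w.map_eq_zero_of_eq' }

theorem wedge_toAlternatingMap {k l : ℕ} (a : E [⋀^Fin k]→L[ℝ] ℝ) (b : E [⋀^Fin l]→L[ℝ] ℝ) :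
    (wedge a b).toAlternatingMap = ((LinearMap.mul' ℝ ℝ).compAlternatingMap
      (AlternatingMap.domCoprod' (a.toAlternatingMap ⊗ₜ[ℝ] b.toAlternatingMap))).domDomCongr
        finSumFinEquiv := rfl

theorem wedge_comp {k l : ℕ} (a : E [⋀^Fin k]→L[ℝ] ℝ) (b : E [⋀^Fin l]→L[ℝ] ℝ)
    (f : E' →L[ℝ] E) :
    (wedge a b).compContinuousLinearMap f =
      wedge (a.compContinuousLinearMap f) (b.compContinuousLinearMap f) := by
  ext v
  change LinearMap.mul' ℝ ℝ ((∑ σ : Equiv.Perm.ModSumCongr (Fin k) (Fin l),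
          AlternatingMap.domCoprod.summand a.toAlternatingMap b.toAlternatingMap σ)
            fun i => f (v (finSumFinEquiv i))) =
      LinearMap.mul' ℝ ℝ ((∑ σ : Equiv.Perm.ModSumCongr (Fin k) (Fin l),
          AlternatingMap.domCoprod.summand (a.compContinuousLinearMap f).toAlternatingMap
            (b.compContinuousLinearMap f).toAlternatingMap σ)
            fun i => v (finSumFinEquiv i))
  simp only [_root_.sum_apply, map_sum]
  refine Finset.sum_congr rfl fun σ _ => ?_
  induction σ using Quotient.inductionOn' with | _ σ
  rfl

/-- The exterior product as a bilinear map. -/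
def wedgeL (E : Type*) [AddCommGroup E] [Module ℝ E] [TopologicalSpace E] (k l : ℕ) :
    (E [⋀^Fin k]→L[ℝ] ℝ) →ₗ[ℝ] (E [⋀^Fin l]→L[ℝ] ℝ) →ₗ[ℝ] (E [⋀^Fin (k + l)]→L[ℝ] ℝ) :=
  LinearMap.mk₂ ℝ wedge
    (fun a a' b => ContinuousAlternatingMap.toAlternatingMap_injective (by
      rw [wedge_toAlternatingMap, ContinuousAlternatingMap.toAlternatingMap_add,
        TensorProduct.add_tmul, map_add]
      ext v; exact map_add (LinearMap.mul' ℝ ℝ) _ _))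
    (fun c a b => ContinuousAlternatingMap.toAlternatingMap_injective (by
      rw [wedge_toAlternatingMap, ContinuousAlternatingMap.toAlternatingMap_smul,
        ← TensorProduct.smul_tmul', map_smul]
      ext v; exact map_smul (LinearMap.mul' ℝ ℝ) c _))
    (fun a b b' => ContinuousAlternatingMap.toAlternatingMap_injective (by
      rw [wedge_toAlternatingMap, ContinuousAlternatingMap.toAlternatingMap_add,
        TensorProduct.tmul_add, map_add]
      ext v; exact map_add (LinearMap.mul' ℝ ℝ) _ _))
    (fun c a b => ContinuousAlternatingMap.toAlternatingMap_injective (by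
      rw [wedge_toAlternatingMap, ContinuousAlternatingMap.toAlternatingMap_smul,
        TensorProduct.tmul_smul, map_smul]
      ext v; exact map_smul (LinearMap.mul' ℝ ℝ) c _))

end Wedge

theorem finiteDimensional_alt (E : Type*) [NormedAddCommGroup E] [NormedSpace ℝ E]
    [FiniteDimensional ℝ E] (k : ℕ) : FiniteDimensional ℝ (E [⋀^Fin k]→L[ℝ] ℝ) :=
  Module.Finite.of_injective
    ((ContinuousMultilinearMap.toMultilinearMapLinear :
      ContinuousMultilinearMap ℝ (fun _ : Fin k => E) ℝ →ₗ[ℝ] _).comp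
      (ContinuousAlternatingMap.toContinuousMultilinearMapLinear (R := ℝ) (A := ℝ) (M := E)
        (N := ℝ) (ι := Fin k)))
    (ContinuousMultilinearMap.toMultilinearMap_injective.comp
      ContinuousAlternatingMap.toContinuousMultilinearMap_injective)

theorem isBoundedBilinearMap_wedge (E : Type*) [NormedAddCommGroup E] [NormedSpace ℝ E]
    [FiniteDimensional ℝ E] (k l : ℕ) :
    IsBoundedBilinearMap ℝ
      (fun x : (E [⋀^Fin k]→L[ℝ] ℝ) × (E [⋀^Fin l]→L[ℝ] ℝ) => wedge x.1 x.2) := by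
  have := finiteDimensional_alt E k
  have := finiteDimensional_alt E l
  exact (LinearMap.toContinuousBilinearMap (wedgeL E k l)).isBoundedBilinearMap

/-! ### Distributions, foliations, submersions -/

section Distributions

variable {EP P : Type*} [NormedAddCommGroup EP] [NormedSpace ℝ EP]
  [TopologicalSpace P] [ChartedSpace EP P]

/-- A smooth distribution on `P`, i.e. a smooth subbundle of `TP`: near every point it is spanned by
a pointwise linearly independent finite family of smooth vector fields. -/
def IsSmoothDistribution [IsManifold 𝓘(ℝ, EP) ∞ P]
    (C : ∀ p : P, Submodule ℝ (TangentSpace 𝓘(ℝ, EP) p)) : Prop :=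
  ∀ p₀ : P, ∃ U : Opens P, p₀ ∈ U ∧ ∃ (r : ℕ) (s : Fin r → ∀ p : P, TangentSpace 𝓘(ℝ, EP) p),
    (∀ i, ContMDiffOn 𝓘(ℝ, EP) 𝓘(ℝ, EP).tangent ∞
      (fun p => (⟨p, s i p⟩ : TangentBundle 𝓘(ℝ, EP) P)) U) ∧
    ∀ p ∈ U, LinearIndependent ℝ (fun i => s i p) ∧
      Submodule.span ℝ (Set.range fun i => s i p) = C p

/-- The local smooth sections of `C` are closed under the Lie bracket. -/
def IsInvolutive [IsManifold 𝓘(ℝ, EP) ∞ P]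
    (C : ∀ p : P, Submodule ℝ (TangentSpace 𝓘(ℝ, EP) p)) : Prop :=
  ∀ (U : Opens P) (V W : ∀ p : P, TangentSpace 𝓘(ℝ, EP) p),
    ContMDiffOn 𝓘(ℝ, EP) 𝓘(ℝ, EP).tangent ∞
      (fun p => (⟨p, V p⟩ : TangentBundle 𝓘(ℝ, EP) P)) U →
    ContMDiffOn 𝓘(ℝ, EP) 𝓘(ℝ, EP).tangent ∞
      (fun p => (⟨p, W p⟩ : TangentBundle 𝓘(ℝ, EP) P)) U →
    (∀ p ∈ U, V p ∈ C p) → (∀ p ∈ U, W p ∈ C p) →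
    ∀ p ∈ U, VectorField.mlieBracket 𝓘(ℝ, EP) V W p ∈ C p

/-- A (regular, smooth) foliation, given by its tangent distribution: `P` is covered by foliated
charts, i.e. smooth charts `φ` in which `F` is a constant linear subspace `S` of the model space, so
that the plaques are the slices of `φ` parallel to `S`. -/
def IsFoliation (F : ∀ p : P, Submodule ℝ (TangentSpace 𝓘(ℝ, EP) p)) : Prop :=
  ∀ p₀ : P, ∃ φ ∈ IsManifold.maximalAtlas 𝓘(ℝ, EP) ∞ P, p₀ ∈ φ.source ∧
    ∃ S : Submodule ℝ EP, ∀ p ∈ φ.source, ∀ v : TangentSpace 𝓘(ℝ, EP) p,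
      v ∈ F p ↔ mfderiv 𝓘(ℝ, EP) 𝓘(ℝ, EP) φ p v ∈ S

variable {EX X : Type*} [NormedAddCommGroup EX] [NormedSpace ℝ EX]
  [TopologicalSpace X] [ChartedSpace EX X]

variable (EP EX) in
/-- A smooth map with surjective differential at every point. -/
structure IsSmoothSubmersion (π : P → X) : Prop where
  contMDiff : ContMDiff 𝓘(ℝ, EP) 𝓘(ℝ, EX) ∞ π
  surjective : ∀ p, Function.Surjective (mfderiv 𝓘(ℝ, EP) 𝓘(ℝ, EX) π p)

variable (EP EX) in
/-- The vertical distribution `ker Tπ`. -/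
def vertical (π : P → X) (p : P) : Submodule ℝ (TangentSpace 𝓘(ℝ, EP) p) :=
  LinearMap.ker (mfderiv 𝓘(ℝ, EP) 𝓘(ℝ, EX) π p).toLinearMap

variable (EX) in
/-- `C` is a Pfaffian distribution for `π`: a smooth distribution that is transverse to the fibres
of `π` and whose intersection with `ker Tπ` is an involutive distribution. -/
structure IsPfaffian [IsManifold 𝓘(ℝ, EP) ∞ P] (π : P → X)
    (C : ∀ p : P, Submodule ℝ (TangentSpace 𝓘(ℝ, EP) p)) : Prop where
  smooth : IsSmoothDistribution C
  transverse : ∀ p, C p ⊔ vertical EP EX π p = ⊤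
  smooth_inf : IsSmoothDistribution fun p => C p ⊓ vertical EP EX π p
  involutive : IsInvolutive fun p => C p ⊓ vertical EP EX π p

end Distributions

/-! ### Forms with values in the exterior powers of the dual of the pullback bundle -/

open Classical in
/-- Extension by zero of a (not necessarily continuous) section over `U`. -/
def zeroExtend {P : Type*} [TopologicalSpace P] {A : P → Type*} [∀ p, Zero (A p)] {U : Opens P}
    (s : ∀ p : U, A p) (p : P) : A p :=
  if h : p ∈ U then s ⟨p, h⟩ else 0

section Forms

variable {EP EX P X : Type*}
  [NormedAddCommGroup EP] [NormedSpace ℝ EP]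
  [NormedAddCommGroup EX] [NormedSpace ℝ EX]
  [TopologicalSpace P] [ChartedSpace EP P]
  [TopologicalSpace X] [ChartedSpace EX X] [IsManifold 𝓘(ℝ, EX) ∞ X]

variable (EX) in
/-- The fibre at `p` of the bundle `⋀ᵏ (π^*TX)^*` over `P`. -/
abbrev Alt (π : P → X) (k : ℕ) (p : P) : Type _ :=
  TangentSpace 𝓘(ℝ, EX) (π p) [⋀^Fin k]→L[ℝ] ℝ

/-- A section of `⋀ᵏ (π^*TX)^*` read in the local trivialization of `π^*TX` that is the pullback of
the trivialization of `TX` around `π p₀` (the one induced by the preferred chart). -/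
def inFrame {π : P → X} {k : ℕ} (p₀ : P) (α : ∀ p, Alt EX π k p) (p : P) : EX [⋀^Fin k]→L[ℝ] ℝ :=
  (α p).compContinuousLinearMap
    ((trivializationAt EX (TangentSpace 𝓘(ℝ, EX)) (π p₀)).symmL ℝ (π p))

variable (EP) in
/-- Smoothness at `p` of a section of `⋀ᵏ (π^*TX)^*`. -/
def SmoothAt {π : P → X} {k : ℕ} (α : ∀ p, Alt EX π k p) (p : P) : Prop :=
  ContMDiffAt 𝓘(ℝ, EP) 𝓘(ℝ, EX [⋀^Fin k]→L[ℝ] ℝ) ∞ (inFrame p α) p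

/-- The canonical flat partial connection of the pullback bundle `π^*TX`, on `⋀ᵏ (π^*TX)^*`, in the
direction of a vector `v ∈ ker T_pπ`: one differentiates the coefficients with respect to a local
frame that is the pullback of a local frame of `TX`, so that pullbacks from `X` are flat.
For vertical `v` the result does not depend on the frame. -/
def nablaBar {π : P → X} {k : ℕ} {p : P} (v : TangentSpace 𝓘(ℝ, EP) p)
    (α : ∀ p, Alt EX π k p) : Alt EX π k p :=
  ContinuousAlternatingMap.compContinuousLinearMap
    (mvfderiv 𝓘(ℝ, EP) (inFrame p α) p v)
    ((trivializationAt EX (TangentSpace 𝓘(ℝ, EX)) (π p)).continuousLinearMapAt ℝ (π p))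

theorem zeroExtend_of_mem {A : P → Type*} [∀ p, Zero (A p)] {U : Opens P}
    (s : ∀ p : U, A p) {p : P} (h : p ∈ U) : zeroExtend s p = s ⟨p, h⟩ := dif_pos h

theorem zeroExtend_zero {A : P → Type*} [∀ p, AddCommGroup (A p)] {U : Opens P} :
    zeroExtend (0 : ∀ p : U, A p) = 0 := by
  funext p; by_cases h : p ∈ U <;> simp [zeroExtend, h]

theorem zeroExtend_add {A : P → Type*} [∀ p, AddCommGroup (A p)] {U : Opens P}
    (s t : ∀ p : U, A p) : zeroExtend (s + t) = zeroExtend s + zeroExtend t := by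
  funext p; by_cases h : p ∈ U <;> simp [zeroExtend, h]

theorem zeroExtend_smul {A : P → Type*} [∀ p, AddCommGroup (A p)] [∀ p, Module ℝ (A p)]
    {U : Opens P} (c : ℝ) (s : ∀ p : U, A p) : zeroExtend (c • s) = c • zeroExtend s := by
  funext p; by_cases h : p ∈ U <;> simp [zeroExtend, h]

theorem zeroExtend_res_eventuallyEq {A : P → Type*} [∀ p, Zero (A p)] {U V : Opens P}
    (h : V ≤ U) (s : ∀ p : U, A p) {p : P} (hp : p ∈ V) :
    ∀ᶠ q in 𝓝 p, zeroExtend (fun q : V => s ⟨q.1, h q.2⟩) q = zeroExtend s q := by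
  filter_upwards [V.isOpen.mem_nhds hp] with q hq
  rw [zeroExtend_of_mem _ (show q ∈ V from hq), zeroExtend_of_mem _ (h hq)]

theorem inFrame_zero {π : P → X} {k : ℕ} (p₀ : P) :
    inFrame p₀ (0 : ∀ p, Alt EX π k p) = 0 := rfl

theorem inFrame_add {π : P → X} {k : ℕ} (p₀ : P) (α β : ∀ p, Alt EX π k p) :
    inFrame p₀ (α + β) = inFrame p₀ α + inFrame p₀ β := rfl

theorem inFrame_smul {π : P → X} {k : ℕ} (p₀ : P) (c : ℝ) (α : ∀ p, Alt EX π k p) :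
    inFrame p₀ (c • α) = c • inFrame p₀ α := rfl

theorem inFrame_congr {π : P → X} {k : ℕ} {p : P} {α β : ∀ p, Alt EX π k p}
    (h : ∀ᶠ q in 𝓝 p, α q = β q) : inFrame p α =ᶠ[𝓝 p] inFrame p β := by
  filter_upwards [h] with q hq
  simp [inFrame, hq]

theorem inFrame_zeroExtend_wedge {π : P → X} {k l : ℕ} (p₀ : P) {U : Opens P}
    (α : ∀ p : U, Alt EX π k p) (β : ∀ p : U, Alt EX π l p) {p : P} (hp : p ∈ U) :
    inFrame p₀ (zeroExtend fun p : U => (wedge (α p) (β p) : Alt EX π (k + l) p)) =ᶠ[𝓝 p]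
      fun q => wedge (inFrame p₀ (zeroExtend α) q) (inFrame p₀ (zeroExtend β) q) := by
  filter_upwards [U.isOpen.mem_nhds hp] with q hq
  have hq' : q ∈ U := hq
  simp only [inFrame, zeroExtend_of_mem _ hq', wedge_comp]

variable (EP EX) in
/-- `Ω^k_W(U)` for `W = π^*TX`: smooth sections of `⋀ᵏ (π^*TX)^*` over the open set `U ⊆ P`.
For `π = id` this is the space of ordinary differential `k`-forms on `U`. -/
def Form (π : P → X) (k : ℕ) (U : Opens P) : Submodule ℝ (∀ p : U, Alt EX π k p) where
  carrier := {α | ∀ p ∈ U, SmoothAt EP (zeroExtend α) p}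
  zero_mem' := fun p _ => by
    rw [zeroExtend_zero, SmoothAt, inFrame_zero]; exact contMDiffAt_const
  add_mem' := fun ha hb p hp => by
    rw [zeroExtend_add, SmoothAt, inFrame_add]; exact (ha p hp).add (hb p hp)
  smul_mem' := fun c a ha p hp => by
    rw [zeroExtend_smul, SmoothAt, inFrame_smul]
    exact (contDiff_const_smul c).contMDiff.contMDiffAt.comp p (ha p hp)

theorem nablaBar_eq_zero_iff {π : P → X} {k : ℕ} {p : P} (v : TangentSpace 𝓘(ℝ, EP) p)
    (α : ∀ p, Alt EX π k p) : nablaBar v α = 0 ↔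
      mvfderiv 𝓘(ℝ, EP) (inFrame p α) p v = 0 := by
  constructor
  · intro h
    have hb : π p ∈ (trivializationAt EX (TangentSpace 𝓘(ℝ, EX)) (π p)).baseSet :=
      FiberBundle.mem_baseSet_trivializationAt' (π p)
    ext w
    have h2 := congrArg (fun a : Alt EX π k p => a fun i =>
      (trivializationAt EX (TangentSpace 𝓘(ℝ, EX)) (π p)).symmL ℝ (π p) (w i)) h
    refine Eq.trans ?_ h2
    refine congrArg (mvfderiv 𝓘(ℝ, EP) (inFrame p α) p v) (funext fun i => ?_)
    exact (Bundle.Trivialization.continuousLinearMapAt_symmL _ hb (w i)).symm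
  · intro h
    rw [nablaBar, h]; rfl

theorem mvfderiv_congr {A : Type*} [NormedAddCommGroup A] [NormedSpace ℝ A] {f g : P → A} {p : P}
    (h : f =ᶠ[𝓝 p] g) (v : TangentSpace 𝓘(ℝ, EP) p) :
    mvfderiv 𝓘(ℝ, EP) f p v = mvfderiv 𝓘(ℝ, EP) g p v := by
  have h' : mvfderiv 𝓘(ℝ, EP) f p = mvfderiv 𝓘(ℝ, EP) g p := h.mfderiv_eq
  rw [h']

theorem mvfderiv_bilin {A B A' : Type*} [NormedAddCommGroup A] [NormedSpace ℝ A]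
    [NormedAddCommGroup B] [NormedSpace ℝ B] [NormedAddCommGroup A'] [NormedSpace ℝ A']
    {b : A × B → A'} (hb : IsBoundedBilinearMap ℝ b) {f : P → A} {g : P → B} {p : P}
    (hf : MDifferentiableAt 𝓘(ℝ, EP) 𝓘(ℝ, A) f p) (hg : MDifferentiableAt 𝓘(ℝ, EP) 𝓘(ℝ, B) g p)
    (v : TangentSpace 𝓘(ℝ, EP) p) :
    mvfderiv 𝓘(ℝ, EP) (fun q => b (f q, g q)) p v =
      b (f p, mvfderiv 𝓘(ℝ, EP) g p v) + b (mvfderiv 𝓘(ℝ, EP) f p v, g p) := by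
  have h : HasMFDerivAt 𝓘(ℝ, EP) 𝓘(ℝ, A') (fun q => b (f q, g q)) p
      ((hb.deriv (f p, g p)).comp
        ((mvfderiv 𝓘(ℝ, EP) f p).prod (mvfderiv 𝓘(ℝ, EP) g p))) := by
    have hc : ContinuousAt (fun q => (f q, g q)) p := hf.continuousAt.prodMk hg.continuousAt
    refine ⟨hb.continuous.continuousAt.comp hc, ?_⟩
    have h1 := hf.hasMFDerivAt.2.prodMk hg.hasMFDerivAt.2
    have hB := hb.hasFDerivAt (f p, g p)
    have e : (f p, g p) = (fun x => ((writtenInExtChartAt 𝓘(ℝ, EP) 𝓘(ℝ, A) p f x),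
        (writtenInExtChartAt 𝓘(ℝ, EP) 𝓘(ℝ, B) p g x))) (extChartAt 𝓘(ℝ, EP) p p) := by
      simp [writtenInExtChartAt, chartAt_self_eq]
    have hB' : HasFDerivAt b (hb.deriv (f p, g p))
        ((fun x => ((writtenInExtChartAt 𝓘(ℝ, EP) 𝓘(ℝ, A) p f x),
        (writtenInExtChartAt 𝓘(ℝ, EP) 𝓘(ℝ, B) p g x))) (extChartAt 𝓘(ℝ, EP) p p)) := e ▸ hB
    exact HasFDerivAt.comp_hasFDerivWithinAt
      (f := fun x => ((writtenInExtChartAt 𝓘(ℝ, EP) 𝓘(ℝ, A) p f x),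
        (writtenInExtChartAt 𝓘(ℝ, EP) 𝓘(ℝ, B) p g x))) (extChartAt 𝓘(ℝ, EP) p p) hB' h1
  have h' : mvfderiv 𝓘(ℝ, EP) (fun q => b (f q, g q)) p = _ := h.mfderiv
  rw [h']
  simp

/-- `Ω^k_{(W, ∇̄)}(U)`: those `k`-forms `α ∈ Ω^k_W(U)` that are flat along `F ⊆ ker Tπ`,
i.e. `∇̄_v α = 0` for all `v ∈ F`. -/
def FlatForm (π : P → X) (F : ∀ p : P, Submodule ℝ (TangentSpace 𝓘(ℝ, EP) p)) (k : ℕ)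
    (U : Opens P) : Submodule ℝ (∀ p : U, Alt EX π k p) where
  carrier := {α | α ∈ Form EP EX π k U ∧ ∀ p ∈ U, ∀ v ∈ F p, nablaBar v (zeroExtend α) = 0}
  zero_mem' := ⟨zero_mem _, fun p _ v _ => by
    rw [zeroExtend_zero, nablaBar_eq_zero_iff, inFrame_zero]
    simp⟩
  add_mem' := fun {a b} ha hb => ⟨add_mem ha.1 hb.1, fun p hp v hv => by
    have h1 := (nablaBar_eq_zero_iff v _).1 (ha.2 p hp v hv)
    have h2 := (nablaBar_eq_zero_iff v _).1 (hb.2 p hp v hv)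
    rw [zeroExtend_add, nablaBar_eq_zero_iff, inFrame_add,
      mvfderiv_add ((ha.1 p hp).mdifferentiableAt (by simp))
        ((hb.1 p hp).mdifferentiableAt (by simp))]
    simp [h1, h2]⟩
  smul_mem' := fun c a ha => ⟨Submodule.smul_mem _ c ha.1, fun p hp v hv => by
    have h1 := (nablaBar_eq_zero_iff v _).1 (ha.2 p hp v hv)
    have h2 : mvfderiv 𝓘(ℝ, EP) (c • inFrame p (zeroExtend a)) p =
        c • mvfderiv 𝓘(ℝ, EP) (inFrame p (zeroExtend a)) p :=
      const_smul_mfderiv ((ha.1 p hp).mdifferentiableAt (by simp)) c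
    rw [zeroExtend_smul, nablaBar_eq_zero_iff, inFrame_smul, h2]
    simp [h1]⟩

theorem FlatForm.le_form (π : P → X) (F : ∀ p : P, Submodule ℝ (TangentSpace 𝓘(ℝ, EP) p)) (k : ℕ)
    (U : Opens P) : FlatForm (EX := EX) π F k U ≤ Form EP EX π k U := fun _ h => h.1

/-- Restriction of forms to a smaller open set. -/
def Form.res {π : P → X} {k : ℕ} {U V : Opens P} (h : V ≤ U) (α : Form EP EX π k U) :
    Form EP EX π k V :=
  ⟨fun p => α.1 ⟨p.1, h p.2⟩, fun p hp =>
    (α.2 p (h hp)).congr_of_eventuallyEq (inFrame_congr (zeroExtend_res_eventuallyEq h α.1 hp))⟩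

/-- Restriction of flat forms to a smaller open set. -/
def FlatForm.res {π : P → X} {F : ∀ p : P, Submodule ℝ (TangentSpace 𝓘(ℝ, EP) p)} {k : ℕ}
    {U V : Opens P} (h : V ≤ U) (α : FlatForm (EX := EX) π F k U) :
    FlatForm (EX := EX) π F k V :=
  ⟨fun p => α.1 ⟨p.1, h p.2⟩, (Form.res h ⟨α.1, α.2.1⟩).2, fun p hp v hv => by
    rw [nablaBar_eq_zero_iff,
      mvfderiv_congr (inFrame_congr (zeroExtend_res_eventuallyEq h α.1 hp))]
    exact (nablaBar_eq_zero_iff v _).1 (α.2.2 p (h hp) v hv)⟩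

/-- The exterior product of two flat forms. -/
def FlatForm.wedge [FiniteDimensional ℝ EX] {π : P → X}
    {F : ∀ p : P, Submodule ℝ (TangentSpace 𝓘(ℝ, EP) p)} {k l : ℕ}
    {U : Opens P} (α : FlatForm (EX := EX) π F k U) (β : FlatForm (EX := EX) π F l U) :
    FlatForm (EX := EX) π F (k + l) U :=
  ⟨fun p => Pfaffian.wedge (α.1 p) (β.1 p), fun p hp =>
    ((isBoundedBilinearMap_wedge EX k l).contDiff.contMDiff.contMDiffAt.comp p
      ((α.2.1 p hp).prodMk_space (β.2.1 p hp))).congr_of_eventuallyEq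
        (inFrame_zeroExtend_wedge p α.1 β.1 hp),
   fun p hp v hv => by
    have h1 := (nablaBar_eq_zero_iff v _).1 (α.2.2 p hp v hv)
    have h2 := (nablaBar_eq_zero_iff v _).1 (β.2.2 p hp v hv)
    have ha := (α.2.1 p hp).mdifferentiableAt (by simp)
    have hb := (β.2.1 p hp).mdifferentiableAt (by simp)
    rw [nablaBar_eq_zero_iff, mvfderiv_congr (inFrame_zeroExtend_wedge p α.1 β.1 hp),
      mvfderiv_bilin (isBoundedBilinearMap_wedge EX k l) ha hb, h1, h2]
    exact (congrArg₂ (· + ·) (map_zero (wedgeL EX k l _)) ((wedgeL EX k l).map_zero₂ _)).trans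
      (add_zero 0)⟩

variable [IsManifold 𝓘(ℝ, EP) ∞ P]

/-- The pullback `π^*α` of a differential form `α` on an open set `V ⊆ X`, as a flat section of
`⋀ᵏ (π^*TX)^*` over `π⁻¹(V)`: `(π^*α)(p) = α(π p)`. -/
def pullback {π : P → X} (hπ : IsSmoothSubmersion EP EX π)
    {F : ∀ p : P, Submodule ℝ (TangentSpace 𝓘(ℝ, EP) p)} (hF : ∀ p, F p ≤ vertical EP EX π p)
    {k : ℕ} {V : Opens X} (α : Form EX EX (id : X → X) k V) :
    FlatForm (EX := EX) π F k (Opens.comap ⟨π, hπ.contMDiff.continuous⟩ V) :=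
  have key : ∀ p, inFrame (π := π) p (zeroExtend
      (U := Opens.comap ⟨π, hπ.contMDiff.continuous⟩ V) fun q => α.1 ⟨π q.1, q.2⟩) =
      inFrame (π := (id : X → X)) (π p) (zeroExtend α.1) ∘ π := fun _ => rfl
  ⟨fun p => α.1 ⟨π p.1, p.2⟩, fun p hp => by
    rw [SmoothAt, key]
    exact (α.2 (π p) hp).comp p hπ.contMDiff.contMDiffAt,
   fun p hp v hv => by
    have h0 : mfderiv 𝓘(ℝ, EP) 𝓘(ℝ, EX) π p v = 0 := hF p hv
    have h1 : mvfderiv 𝓘(ℝ, EP)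
        (inFrame (π := (id : X → X)) (π p) (zeroExtend α.1) ∘ π) p =
        (mvfderiv 𝓘(ℝ, EX) (inFrame (π := (id : X → X)) (π p) (zeroExtend α.1)) (π p)).comp
          (mfderiv 𝓘(ℝ, EP) 𝓘(ℝ, EX) π p) :=
      mfderiv_comp p ((α.2 (π p) hp).mdifferentiableAt (by simp))
        (hπ.contMDiff.contMDiffAt.mdifferentiableAt (by simp))
    rw [nablaBar_eq_zero_iff, key, h1, ContinuousLinearMap.comp_apply, h0, map_zero]⟩

end Forms

/-! ### The de Rham differential -/

section DeRham

variable {E M : Type*} [NormedAddCommGroup E] [NormedSpace ℝ E] [TopologicalSpace M]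
  [ChartedSpace E M]

/-- The exterior derivative at `x` of a differential form on `M`, computed in the preferred chart
`φ` at `x`: `(dη)_x = φ^* (d ((φ⁻¹)^* η))`. -/
def extDerivAt {k : ℕ} (η : ∀ x : M, TangentSpace 𝓘(ℝ, E) x [⋀^Fin k]→L[ℝ] ℝ) (x : M) :
    TangentSpace 𝓘(ℝ, E) x [⋀^Fin (k + 1)]→L[ℝ] ℝ :=
  ContinuousAlternatingMap.compContinuousLinearMap
    (extDeriv (fun y : E => ((η ((extChartAt 𝓘(ℝ, E) x).symm y)).compContinuousLinearMap
      (mfderiv 𝓘(ℝ, E) 𝓘(ℝ, E) (extChartAt 𝓘(ℝ, E) x).symm y) : E [⋀^Fin k]→L[ℝ] ℝ))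
      (extChartAt 𝓘(ℝ, E) x x))
    (mfderiv 𝓘(ℝ, E) 𝓘(ℝ, E) (extChartAt 𝓘(ℝ, E) x) x)

end DeRham

/-! ### Relative derivations -/

section Derivations

variable {EP EX P X : Type*}
  [NormedAddCommGroup EP] [NormedSpace ℝ EP]
  [NormedAddCommGroup EX] [NormedSpace ℝ EX] [FiniteDimensional ℝ EX]
  [TopologicalSpace P] [ChartedSpace EP P] [IsManifold 𝓘(ℝ, EP) ∞ P]
  [TopologicalSpace X] [ChartedSpace EX X] [IsManifold 𝓘(ℝ, EX) ∞ X]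

variable (EX) in
/-- A `1`-derivation relative to `F` on the flat foliated bundle `(W, ∇̄) = (π^*TX, ∇̄)`: a linear
map of sheaves `D : Ω^•_{(W, ∇̄)} → Ω^{•+1}_W` such that
`D (α ∧ β) = D α ∧ β + (-1)^|α| α ∧ D β`. -/
@[ext]
structure RelDerivation (π : P → X) (F : ∀ p : P, Submodule ℝ (TangentSpace 𝓘(ℝ, EP) p)) where
  /-- The underlying map, for every open set and every degree. -/
  toFun : ∀ (U : Opens P) (k : ℕ), FlatForm (EX := EX) π F k U →ₗ[ℝ] Form EP EX π (k + 1) U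
  map_res : ∀ (U V : Opens P) (h : V ≤ U) (k : ℕ) (α : FlatForm (EX := EX) π F k U),
    toFun V k (FlatForm.res h α) = Form.res h (toFun U k α)
  leibniz : ∀ (U : Opens P) (k l : ℕ) (α : FlatForm (EX := EX) π F k U)
    (β : FlatForm (EX := EX) π F l U) (p : U)
    (v : Fin (k + l + 1) → TangentSpace 𝓘(ℝ, EX) (π p)),
    (toFun U (k + l) (FlatForm.wedge α β)).1 p v =
      wedge ((toFun U k α).1 p) (β.1 p) (fun i => v (Fin.cast (Nat.add_right_comm k 1 l) i)) +
        (-1 : ℝ) ^ k * wedge (α.1 p) ((toFun U l β).1 p) v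

/-- `π_* D = π^* d`: on pullbacks of differential forms on open subsets of `X`, the derivation `D`
is the pullback of the de Rham differential. -/
def ExtendsDeRham {π : P → X} (hπ : IsSmoothSubmersion EP EX π)
    {F : ∀ p : P, Submodule ℝ (TangentSpace 𝓘(ℝ, EP) p)} (hF : ∀ p, F p ≤ vertical EP EX π p)
    (D : RelDerivation EX π F) : Prop :=
  ∀ (V : Opens X) (k : ℕ) (α : Form EX EX (id : X → X) k V)
    (p : (Opens.comap ⟨π, hπ.contMDiff.continuous⟩ V : Opens P)),
    (D.toFun _ k (pullback hπ hF α)).1 p = extDerivAt (zeroExtend α.1) (π p)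

/-- `σ : π^*TX → ν(F) = TP / F` is the symbol (anchor) of `D`: `⟨D f, w⟩ = ⟨df, σ(w)⟩` for all local
functions `f` that are constant along `F` (such a `df` vanishes on `F`, so any representative `v` of
`σ(w)` may be used). -/
def IsSymbol {π : P → X} {F : ∀ p : P, Submodule ℝ (TangentSpace 𝓘(ℝ, EP) p)}
    (D : RelDerivation EX π F)
    (σ : ∀ p : P, TangentSpace 𝓘(ℝ, EX) (π p) →ₗ[ℝ] TangentSpace 𝓘(ℝ, EP) p ⧸ F p) : Prop :=
  ∀ (U : Opens P) (f : FlatForm (EX := EX) π F 0 U) (p : U) (w : TangentSpace 𝓘(ℝ, EX) (π p))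
    (v : TangentSpace 𝓘(ℝ, EP) (p : P)), (F p).mkQ v = σ p w →
    (D.toFun U 0 f).1 p (fun _ => w) =
      mvfderiv 𝓘(ℝ, EP) (fun q => zeroExtend f.1 q Fin.elim0) (p : P) v

/-- A form `α` with values in `⋀ᵏ (π^*TX)^*`, regarded as a differential `k`-form `α ∘ Tπ` on `P`. -/
def toFormOnTotal {π : P → X} {k : ℕ} {U : Opens P} (α : ∀ p : U, Alt EX π k p) (q : P) :
    TangentSpace 𝓘(ℝ, EP) q [⋀^Fin k]→L[ℝ] ℝ :=
  (zeroExtend α q).compContinuousLinearMap (mfderiv 𝓘(ℝ, EP) 𝓘(ℝ, EX) π q)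

end Derivations

end Pfaffian

end

open Pfaffian

set_option linter.unusedSectionVars false

/-! Everything is computed in the pullback of a coordinate frame of `TX`. There `α ∘ Tπ` is the
coefficient function of `α` composed with the differential of `g = ψ ∘ π`, with `ψ` a chart of `X`.
Since the second derivative of `g` is symmetric, `d(α ∘ Tπ)` is the alternating sum of the
derivatives of the coefficients alone (`extDerivAt_comp_mfderiv`). Flatness says that these
derivatives vanish along `F`, and `Tπ` kills `F`, so the values of `d(α ∘ Tπ)` on `C` depend only on
the projections of the arguments to `TX`: vectors of `C` with equal projections differ by an element
of `C ∩ ker Tπ = F`. This defines the derivation of `C`. A smooth local lift of the frame into `C`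
makes it smooth, the Leibniz rule is an identity on alternatizations of `L x ∧ b` and `a ∧ M x`, and
on pullbacks naturality gives `π^*d`.

Conversely, a relative derivation `D` is local and obeys the product rule on flat functions. In a
foliated chart a flat function depends on the transverse coordinates only, and Hadamard's lemma
writes it near `p` as `f(p) + ∑ gᵢ ηᵢ`, with `ηᵢ` the transverse coordinates centred at `p`. Hence
`D f` at `p` is the derivative of `f` along `∑ (D ηᵢ) ∂ᵢ` (`apply_eq_mvfderiv_symbolLift`). This
vector, modulo `F`, is the symbol; it is unique because flat functions separate vectors modulo `F`.
If `D` extends the de Rham differential, testing on coordinates of `X` shows that the symbol is a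
section of `Tπ`. The preimage of its image is then transverse, meets `ker Tπ` exactly in `F`, and is
spanned by coordinate fields of `F` together with lifts of a frame of `TX`; involutivity of the
intersection is that of the foliation.

The two constructions are mutually inverse for two reasons. The derivation of `C` sends `f` to `v f`
on `Tπ v` for `v ∈ C`, so its symbol sends `Tπ v` to the class of `v` and `C` is recovered. And a
derivation extending `π^*d` is determined by its values on flat functions (`ext_of_funForm`),
because every flat form is locally a sum of pullbacks from `X` multiplied by flat functions. -/

noncomputable section

namespace Pfaffian

/-! ### The algebraic Leibniz rule -/

section AltSum

variable {E : Type*}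

/-- The alternating sum `∑ σ, sign σ • f (v ∘ σ)` over all permutations of the index type. -/
def altSum {ι : Type*} [Fintype ι] [DecidableEq ι] (f : (ι → E) → ℝ) (v : ι → E) : ℝ :=
  ∑ σ : Equiv.Perm ι, ((Equiv.Perm.sign σ : ℤ) : ℝ) * f (v ∘ σ)

/-- Reindexing by `σ ↦ σ * τ`. It moves each term of an alternatization into a standard position at
the cost of a sign. -/
theorem altSum_perm {ι : Type*} [Fintype ι] [DecidableEq ι] (f : (ι → E) → ℝ) (v : ι → E)
    (τ : Equiv.Perm ι) :
    altSum (fun u => f (u ∘ τ)) v = ((Equiv.Perm.sign τ : ℤ) : ℝ) * altSum f v := by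
  unfold altSum
  rw [← Equiv.sum_comp (Equiv.mulRight τ) (fun σ => ((Equiv.Perm.sign σ : ℤ) : ℝ) * f (v ∘ σ)),
    Finset.mul_sum]
  refine Finset.sum_congr rfl fun σ _ => ?_
  have h : ((Equiv.Perm.sign τ : ℤ) : ℝ) * ((Equiv.Perm.sign τ : ℤ) : ℝ) = 1 := by
    rcases Int.units_eq_one_or (Equiv.Perm.sign τ) with h | h <;> simp [h]
  simp only [Equiv.coe_mulRight, Equiv.Perm.sign_mul, Units.val_mul, Int.cast_mul,
    Equiv.Perm.coe_mul]
  rw [Function.comp_assoc]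
  linear_combination (-((Equiv.Perm.sign σ : ℤ) : ℝ) * f (v ∘ σ ∘ τ)) * h

theorem altSum_equiv {ι κ : Type*} [Fintype ι] [DecidableEq ι] [Fintype κ] [DecidableEq κ]
    (e : ι ≃ κ) (f : (ι → E) → ℝ) (v : κ → E) :
    altSum f (v ∘ e) = altSum (fun u => f (u ∘ e)) v := by
  unfold altSum
  rw [← Equiv.sum_comp (Equiv.permCongr e)]
  refine Finset.sum_congr rfl fun σ _ => ?_
  rw [Equiv.Perm.sign_permCongr]
  congr 2
  funext i
  simp [Equiv.permCongr_apply]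

theorem altSum_sum {ι κ : Type*} [Fintype ι] [DecidableEq ι] (s : Finset κ)
    (f : κ → (ι → E) → ℝ) (v : ι → E) :
    altSum (fun u => ∑ j ∈ s, f j u) v = ∑ j ∈ s, altSum (f j) v := by
  unfold altSum
  simp only [Finset.mul_sum]
  exact Finset.sum_comm

theorem altSum_const_mul {ι : Type*} [Fintype ι] [DecidableEq ι] (c : ℝ)
    (f : (ι → E) → ℝ) (v : ι → E) :
    altSum (fun u => c * f u) v = c * altSum f v := by
  unfold altSum
  simp only [Finset.mul_sum]
  exact Finset.sum_congr rfl fun σ _ => by ring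

/-- Bringing entry `i` to the front is a permutation, and by `sign_cycleRange_symm` its sign is
`(-1)^i`. This translates the signs of the exterior derivative into signs of permutations. -/
theorem cons_removeNth_eq_comp_cycleRange {n : ℕ} (v : Fin (n + 1) → E) (i : Fin (n + 1)) :
    (Fin.cons (v i) (i.removeNth v) : Fin (n + 1) → E) = v ∘ (i.cycleRange).symm := by
  rw [Equiv.eq_comp_symm, ← Fin.insertNth_self_removeNth i v]
  simp only [Fin.removeNth_insertNth, Fin.insertNth_apply_same]
  exact Fin.cons_comp_cycleRange _ _ _

theorem sign_cycleRange_symm {n : ℕ} (i : Fin (n + 1)) :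
    ((Equiv.Perm.sign (i.cycleRange).symm : ℤ) : ℝ) = (-1) ^ (i : ℕ) := by
  rw [Equiv.Perm.sign_symm, Fin.sign_cycleRange]
  simp

/-- Expansion of an alternating sum along the first entry. -/
theorem altSum_succ {n : ℕ} (g : E → (Fin n → E) → ℝ) (v : Fin (n + 1) → E) :
    altSum (fun u : Fin (n + 1) → E => g (u 0) (Fin.tail u)) v =
      ∑ i : Fin (n + 1), (-1) ^ (i : ℕ) * altSum (g (v i)) (i.removeNth v) := by
  -- A permutation of `n + 1` letters amounts to the image `i` of `0` together with a permutation
  -- `τ` of the remaining letters; its sign is `(-1)^i * sign τ`. Bijectivity follows from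
  -- injectivity by counting.
  let B : Fin (n + 1) × Equiv.Perm (Fin n) → Equiv.Perm (Fin (n + 1)) := fun x =>
    (x.1.cycleRange).symm * Equiv.Perm.decomposeFin.symm (0, x.2)
  have hB0 : ∀ x, B x 0 = x.1 := fun x => by simp [B]
  have hBs : ∀ x j, B x (Fin.succ j) = x.1.succAbove (x.2 j) := fun x j => by
    simp [B]
  have hinj : Function.Injective B := by
    intro x y h
    have h0 : x.1 = y.1 := by rw [← hB0 x, ← hB0 y, h]
    refine Prod.ext h0 (Equiv.ext fun j => ?_)
    have := congrArg (fun σ => σ (Fin.succ j)) h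
    simp only [hBs, h0] at this
    exact Fin.succAbove_right_injective this
  have hbij : Function.Bijective B := by
    rw [Fintype.bijective_iff_injective_and_card]
    refine ⟨hinj, ?_⟩
    simp [Fintype.card_perm, Nat.factorial_succ]
  unfold altSum
  rw [← Function.Bijective.sum_comp hbij, Fintype.sum_prod_type]
  refine Finset.sum_congr rfl fun i _ => ?_
  rw [Finset.mul_sum]
  refine Finset.sum_congr rfl fun τ _ => ?_
  have h1 : ((Equiv.Perm.sign (B (i, τ)) : ℤ) : ℝ) =
      (-1) ^ (i : ℕ) * ((Equiv.Perm.sign τ : ℤ) : ℝ) := by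
    simp only [B, Equiv.Perm.sign_mul, Units.val_mul, Int.cast_mul, sign_cycleRange_symm]
    rw [Equiv.Perm.decomposeFin.symm_sign]
    simp
  have h2 : Fin.tail (v ∘ B (i, τ)) = i.removeNth v ∘ τ := by
    funext j
    simp [Fin.tail, hBs, Fin.removeNth]
  beta_reduce
  rw [h1, h2, Function.comp_apply, hB0]
  ring

/-- The `i`-th summand is the standard one precomposed with a permutation of the first block whose
sign cancels `(-1)^i`. The outer alternating sum therefore sees `k + 1` equal terms. -/
theorem altSum_alternatize_left {k l : ℕ} (L : E → (Fin k → E) → ℝ) (b : (Fin l → E) → ℝ)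
    (v : Fin (k + 1 + l) → E) :
    altSum (fun u : Fin (k + 1 + l) → E =>
      (∑ i : Fin (k + 1), (-1) ^ (i : ℕ) *
        L (u (Fin.castAdd l i)) (i.removeNth fun j => u (Fin.castAdd l j))) *
        b (fun i => u (Fin.natAdd (k + 1) i))) v =
      (k + 1) * altSum (fun u : Fin (k + 1 + l) → E =>
        L (u (Fin.castAdd l 0)) (fun j => u (Fin.castAdd l j.succ)) *
          b (fun i => u (Fin.natAdd (k + 1) i))) v := by
  let G : (Fin (k + 1 + l) → E) → ℝ := fun u =>
    L (u (Fin.castAdd l 0)) (fun j => u (Fin.castAdd l j.succ)) *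
          b (fun i => u (Fin.natAdd (k + 1) i))
  let τ : Fin (k + 1) → Equiv.Perm (Fin (k + 1 + l)) := fun i =>
    finSumFinEquiv.permCongr (Equiv.Perm.sumCongr (i.cycleRange).symm 1)
  have hG : ∀ i u, L (u (Fin.castAdd l i)) (i.removeNth fun j => u (Fin.castAdd l j)) *
      b (fun i => u (Fin.natAdd (k + 1) i)) = G (u ∘ τ i) := by
    intro i u
    have h := cons_removeNth_eq_comp_cycleRange (fun j => u (Fin.castAdd l j)) i
    have h0 := congrFun h 0
    have hs : ∀ j : Fin k, _ := fun j => congrFun h j.succ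
    simp only [Fin.cons_zero, Fin.cons_succ, Function.comp_apply] at h0 hs
    simp only [G, τ, Function.comp_apply, Equiv.permCongr_apply,
      finSumFinEquiv_symm_apply_castAdd, finSumFinEquiv_symm_apply_natAdd,
      Equiv.Perm.sumCongr_apply, Sum.map_inl, Sum.map_inr, finSumFinEquiv_apply_left,
      finSumFinEquiv_apply_right, Equiv.Perm.coe_one, id]
    rw [h0]
    congr 2
    funext j
    exact hs j
  have hτ : ∀ i, ((Equiv.Perm.sign (τ i) : ℤ) : ℝ) = (-1) ^ (i : ℕ) := fun i => by
    simp only [τ, Equiv.Perm.sign_permCongr, Equiv.Perm.sign_sumCongr, Equiv.Perm.sign_one,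
      mul_one, sign_cycleRange_symm]
  have e : (fun u : Fin (k + 1 + l) → E =>
      (∑ i : Fin (k + 1), (-1) ^ (i : ℕ) *
        L (u (Fin.castAdd l i)) (i.removeNth fun j => u (Fin.castAdd l j))) *
        b (fun i => u (Fin.natAdd (k + 1) i))) =
      fun u => ∑ i : Fin (k + 1), (-1) ^ (i : ℕ) * G (u ∘ τ i) := by
    funext u
    rw [Finset.sum_mul]
    exact Finset.sum_congr rfl fun i _ => by rw [mul_assoc, hG]
  rw [e, altSum_sum]
  have : ∀ i : Fin (k + 1), altSum (fun u => (-1) ^ (i : ℕ) * G (u ∘ τ i)) v = altSum G v := by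
    intro i
    rw [altSum_const_mul, altSum_perm, hτ, ← mul_assoc, ← mul_pow]
    simp
  rw [Finset.sum_congr rfl fun i _ => this i]
  simp [G]

theorem altSum_alternatize_right {k l : ℕ} (a : (Fin k → E) → ℝ) (M : E → (Fin l → E) → ℝ)
    (v : Fin (k + (l + 1)) → E) :
    altSum (fun u : Fin (k + (l + 1)) → E => a (fun i => u (Fin.castAdd (l + 1) i)) *
      (∑ i : Fin (l + 1), (-1) ^ (i : ℕ) *
        M (u (Fin.natAdd k i)) (i.removeNth fun j => u (Fin.natAdd k j)))) v =
      (l + 1) * altSum (fun u : Fin (k + (l + 1)) → E => a (fun i => u (Fin.castAdd (l + 1) i)) *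
        M (u (Fin.natAdd k 0)) (fun j => u (Fin.natAdd k j.succ))) v := by
  let G : (Fin (k + (l + 1)) → E) → ℝ := fun u => a (fun i => u (Fin.castAdd (l + 1) i)) *
        M (u (Fin.natAdd k 0)) (fun j => u (Fin.natAdd k j.succ))
  let τ : Fin (l + 1) → Equiv.Perm (Fin (k + (l + 1))) := fun i =>
    finSumFinEquiv.permCongr (Equiv.Perm.sumCongr 1 (i.cycleRange).symm)
  have hG : ∀ i u, a (fun i => u (Fin.castAdd (l + 1) i)) *
      M (u (Fin.natAdd k i)) (i.removeNth fun j => u (Fin.natAdd k j)) = G (u ∘ τ i) := by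
    intro i u
    have h := cons_removeNth_eq_comp_cycleRange (fun j => u (Fin.natAdd k j)) i
    have h0 := congrFun h 0
    have hs : ∀ j : Fin l, _ := fun j => congrFun h j.succ
    simp only [Fin.cons_zero, Fin.cons_succ, Function.comp_apply] at h0 hs
    simp only [G, τ, Function.comp_apply, Equiv.permCongr_apply,
      finSumFinEquiv_symm_apply_castAdd, finSumFinEquiv_symm_apply_natAdd,
      Equiv.Perm.sumCongr_apply, Sum.map_inl, Sum.map_inr, finSumFinEquiv_apply_left,
      finSumFinEquiv_apply_right, Equiv.Perm.coe_one, id]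
    rw [h0]
    congr 2
    funext j
    exact hs j
  have hτ : ∀ i, ((Equiv.Perm.sign (τ i) : ℤ) : ℝ) = (-1) ^ (i : ℕ) := fun i => by
    simp only [τ, Equiv.Perm.sign_permCongr, Equiv.Perm.sign_sumCongr, Equiv.Perm.sign_one,
      one_mul, sign_cycleRange_symm]
  have e : (fun u : Fin (k + (l + 1)) → E => a (fun i => u (Fin.castAdd (l + 1) i)) *
      (∑ i : Fin (l + 1), (-1) ^ (i : ℕ) *
        M (u (Fin.natAdd k i)) (i.removeNth fun j => u (Fin.natAdd k j)))) =
      fun u => ∑ i : Fin (l + 1), (-1) ^ (i : ℕ) * G (u ∘ τ i) := by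
    funext u
    rw [Finset.mul_sum]
    exact Finset.sum_congr rfl fun i _ => by rw [← hG]; ring
  rw [e, altSum_sum]
  have : ∀ i : Fin (l + 1), altSum (fun u => (-1) ^ (i : ℕ) * G (u ∘ τ i)) v = altSum G v := by
    intro i
    rw [altSum_const_mul, altSum_perm, hτ, ← mul_assoc, ← mul_pow]
    simp
  rw [Finset.sum_congr rfl fun i _ => this i]
  simp [G]

end AltSum

/-! ### Wedge products as full permutation sums, and alternatization. -/

section Leibniz

variable {E : Type*} [NormedAddCommGroup E] [NormedSpace ℝ E]

/-- Each shuffle represents a coset of `k! l!` permutations, all contributing equally. Clearing this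
factor replaces shuffles by all permutations, so that later identities reduce to reindexing. -/
theorem factorial_mul_wedge_apply {k l : ℕ} (a : E [⋀^Fin k]→L[ℝ] ℝ) (b : E [⋀^Fin l]→L[ℝ] ℝ)
    (v : Fin (k + l) → E) :
    (k.factorial * l.factorial : ℝ) * wedge a b v =
      altSum (fun u : Fin (k + l) → E =>
        a (fun i => u (Fin.castAdd l i)) * b (fun i => u (Fin.natAdd k i))) v := by
  have h := congrArg (fun m => LinearMap.mul' ℝ ℝ (m (v ∘ finSumFinEquiv)))
    (MultilinearMap.domCoprod_alternization_eq a.toAlternatingMap b.toAlternatingMap)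
  simp only [Fintype.card_fin] at h
  have e1 : (fun u : Fin (k + l) → E =>
        a (fun i => u (Fin.castAdd l i)) * b (fun i => u (Fin.natAdd k i))) =
      fun u => (fun w : Fin k ⊕ Fin l → E => a (fun i => w (Sum.inl i)) *
        b (fun i => w (Sum.inr i))) (u ∘ finSumFinEquiv) := by
    funext u; simp
  rw [e1]
  refine Eq.trans ?_ ((h.symm.trans ?_).trans (altSum_equiv finSumFinEquiv
    (fun w => a (fun i => w (Sum.inl i)) * b (fun i => w (Sum.inr i))) v))
  · rw [AlternatingMap.smul_apply, map_nsmul, nsmul_eq_mul]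
    push_cast
    rfl
  · rw [MultilinearMap.alternatization_apply, map_sum]
    refine Finset.sum_congr rfl fun σ _ => ?_
    rw [Units.smul_def, map_zsmul, zsmul_eq_mul]
    rfl

/-- The second block is empty, so by alternation all `k!` permutations contribute the same term. -/
theorem wedge_zero_right_apply {k : ℕ} (a : E [⋀^Fin k]→L[ℝ] ℝ) (f : E [⋀^Fin 0]→L[ℝ] ℝ)
    (v : Fin k → E) : wedge a f v = f Fin.elim0 * a v := by
  have h := factorial_mul_wedge_apply a f v
  have h0 : (k.factorial : ℝ) ≠ 0 := by positivity
  have e : ∀ u : Fin (k + 0) → E, a (fun i => u (Fin.castAdd 0 i)) *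
      f (fun i => u (Fin.natAdd k i)) = f Fin.elim0 * a u := fun u => by
    rw [mul_comm]
    congr 2
    funext i; exact i.elim0
  have e2 : altSum (fun u : Fin (k + 0) → E =>
        a (fun i => u (Fin.castAdd 0 i)) * f (fun i => u (Fin.natAdd k i))) v =
      k.factorial * (f Fin.elim0 * a v) := by
    simp only [e]
    unfold altSum
    have : ∀ σ : Equiv.Perm (Fin k), ((Equiv.Perm.sign σ : ℤ) : ℝ) * (f Fin.elim0 * a (v ∘ σ)) =
        f Fin.elim0 * a v := fun σ => by
      have h1 : a (v ∘ σ) = Equiv.Perm.sign σ • a v := a.toAlternatingMap.map_perm v σ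
      rw [h1, Units.smul_def, zsmul_eq_mul]
      rcases Int.units_eq_one_or (Equiv.Perm.sign σ) with h | h <;> simp [h]
    refine (Finset.sum_congr rfl fun σ _ => this σ).trans ?_
    simp [Fintype.card_perm]
  rw [e2, Nat.factorial_zero, Nat.cast_one, mul_one] at h
  exact mul_left_cancel₀ h0 h

open ContinuousAlternatingMap

/-- Alternatization of `x ↦ L x ∧ b`. -/
theorem sum_wedge_left {k l : ℕ} (L : E →L[ℝ] E [⋀^Fin k]→L[ℝ] ℝ) (b : E [⋀^Fin l]→L[ℝ] ℝ)
    (v : Fin (k + l + 1) → E) :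
    ∑ i : Fin (k + l + 1), (-1) ^ (i : ℕ) * wedge (L (v i)) b (i.removeNth v) =
      wedge (alternatizeUncurryFin L) b
        (fun i => v (Fin.cast (Nat.add_right_comm k 1 l) i)) := by
  have hk : (k.factorial * l.factorial : ℝ) ≠ 0 := by positivity
  -- The right side needs the factor `(k + 1)! l!` to become a full permutation sum, the left side
  -- only `k! l!`. The extra `k + 1` is the number of equal summands in `altSum_alternatize_left`.
  refine mul_left_cancel₀ hk (mul_left_cancel₀ (show ((k : ℝ) + 1) ≠ 0 by positivity) ?_)
  have h1 := altSum_succ (fun x (u : Fin (k + l) → E) =>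
    L x (fun i => u (Fin.castAdd l i)) * b (fun i => u (Fin.natAdd k i))) v
  simp only [← factorial_mul_wedge_apply] at h1
  have h2 := factorial_mul_wedge_apply (alternatizeUncurryFin L) b
    (fun i => v (Fin.cast (Nat.add_right_comm k 1 l) i))
  simp only [alternatizeUncurryFin_apply, zsmul_eq_mul, Int.cast_pow, Int.cast_neg,
    Int.cast_one] at h2
  rw [altSum_alternatize_left (fun x u => L x u) (fun u => b u)] at h2
  have h3 := altSum_equiv (finCongr (Nat.add_right_comm k 1 l)) (fun u : Fin (k + 1 + l) → E =>
        L (u (Fin.castAdd l 0)) (fun j => u (Fin.castAdd l j.succ)) *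
          b (fun i => u (Fin.natAdd (k + 1) i))) v
  have h4 : altSum (fun u : Fin (k + 1 + l) → E =>
        L (u (Fin.castAdd l 0)) (fun j => u (Fin.castAdd l j.succ)) *
          b (fun i => u (Fin.natAdd (k + 1) i)))
          (fun i => v (Fin.cast (Nat.add_right_comm k 1 l) i)) =
      altSum (fun u : Fin (k + l + 1) → E => L (u 0) (fun i => Fin.tail u (Fin.castAdd l i)) *
        b (fun i => Fin.tail u (Fin.natAdd k i))) v := by
    refine Eq.trans h3 ?_
    congr 1
    funext u
    simp only [Function.comp_apply, Fin.tail, finCongr_apply]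
    congr 2
    funext i
    congr 1
    ext
    simp
    omega
  rw [h4, h1] at h2
  calc _ = ((k : ℝ) + 1) * ∑ i : Fin (k + l + 1), (-1) ^ (i : ℕ) *
        ((k.factorial * l.factorial : ℝ) * wedge (L (v i)) b (i.removeNth v)) := by
        rw [Finset.mul_sum]; congr 1; exact Finset.sum_congr rfl fun i _ => by ring
    _ = _ := by
        rw [← h2, Nat.factorial_succ]; push_cast; ring

/-- Alternatization of `x ↦ a ∧ M x`. -/
theorem sum_wedge_right {k l : ℕ} (a : E [⋀^Fin k]→L[ℝ] ℝ) (M : E →L[ℝ] E [⋀^Fin l]→L[ℝ] ℝ)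
    (v : Fin (k + l + 1) → E) :
    ∑ i : Fin (k + l + 1), (-1) ^ (i : ℕ) * wedge a (M (v i)) (i.removeNth v) =
      (-1) ^ k * wedge a (alternatizeUncurryFin M) v := by
  have hk : (k.factorial * l.factorial : ℝ) ≠ 0 := by positivity
  refine mul_left_cancel₀ hk (mul_left_cancel₀ (show ((l : ℝ) + 1) ≠ 0 by positivity) ?_)
  have h1 := altSum_succ (fun x (u : Fin (k + l) → E) =>
    a (fun i => u (Fin.castAdd l i)) * M x (fun i => u (Fin.natAdd k i))) v
  simp only [← factorial_mul_wedge_apply] at h1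
  have h2 := factorial_mul_wedge_apply a (alternatizeUncurryFin M) v
  simp only [alternatizeUncurryFin_apply, zsmul_eq_mul, Int.cast_pow, Int.cast_neg,
    Int.cast_one] at h2
  rw [altSum_alternatize_right (fun u => a u) (fun x u => M x u)] at h2
  -- The differentiated slot has to travel past the `k` slots of `a`. The cycle bringing entry `k`
  -- to the front has sign `(-1)^k`, which is the sign of the Leibniz rule.
  let c : Fin (k + l + 1) := ⟨k, by omega⟩
  have h3 := altSum_perm (fun u : Fin (k + l + 1) → E =>
    a (fun i => Fin.tail u (Fin.castAdd l i)) * M (u 0) (fun i => Fin.tail u (Fin.natAdd k i)))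
    v (c.cycleRange).symm
  rw [sign_cycleRange_symm] at h3
  have h4 : altSum (fun u : Fin (k + (l + 1)) → E => a (fun i => u (Fin.castAdd (l + 1) i)) *
        M (u (Fin.natAdd k 0)) (fun j => u (Fin.natAdd k j.succ))) v =
      (-1) ^ k * altSum (fun u : Fin (k + l + 1) → E =>
        a (fun i => Fin.tail u (Fin.castAdd l i)) *
          M (u 0) (fun i => Fin.tail u (Fin.natAdd k i))) v := by
    refine Eq.trans ?_ h3
    congr 1
    funext u
    rw [← cons_removeNth_eq_comp_cycleRange]
    simp only [Fin.tail_cons, Fin.cons_zero]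
    congr 2
    · funext i
      simp only [Fin.removeNth]
      congr 1
      rw [Fin.succAbove_of_castSucc_lt _ _ (by simp [c, Fin.lt_def])]
      rfl
    · funext i
      simp only [Fin.removeNth]
      congr 1
      rw [Fin.succAbove_of_le_castSucc _ _ (by simp [c, Fin.le_def])]
      rfl
  rw [h4, h1] at h2
  have hs : ((-1 : ℝ) ^ k) * (-1) ^ k = 1 := by rw [← mul_pow]; simp
  calc _ = ((l : ℝ) + 1) * ∑ i : Fin (k + l + 1), (-1) ^ (i : ℕ) *
        ((k.factorial * l.factorial : ℝ) * wedge a (M (v i)) (i.removeNth v)) := by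
        rw [Finset.mul_sum]; congr 1; exact Finset.sum_congr rfl fun i _ => by ring
    _ = (-1) ^ k * ((l + 1) * ((-1) ^ k * ∑ i : Fin (k + l + 1), (-1) ^ (i : ℕ) *
        ((k.factorial * l.factorial : ℝ) * wedge a (M (v i)) (i.removeNth v)))) := by
        linear_combination (-((l : ℝ) + 1) * ∑ i : Fin (k + l + 1), (-1) ^ (i : ℕ) *
        ((k.factorial * l.factorial : ℝ) * wedge a (M (v i)) (i.removeNth v))) * hs
    _ = _ := by
        rw [← h2, Nat.factorial_succ]; push_cast; ring

end Leibniz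


/-! ### Smoothness of alternating forms -/

section AltSmooth

variable {E : Type*} [NormedAddCommGroup E] [NormedSpace ℝ E] [FiniteDimensional ℝ E]

theorem finiteDimensional_multilinear (k : ℕ) :
    FiniteDimensional ℝ (ContinuousMultilinearMap ℝ (fun _ : Fin k => E) ℝ) :=
  Module.Finite.of_injective
    (ContinuousMultilinearMap.toMultilinearMapLinear :
      ContinuousMultilinearMap ℝ (fun _ : Fin k => E) ℝ →ₗ[ℝ] _)
    ContinuousMultilinearMap.toMultilinearMap_injective

/-- For multilinear maps the pullback is linear in the form and multilinear in the linear maps,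
hence jointly smooth. A left inverse of the inclusion of alternating into multilinear maps,
continuous by finite dimensionality, carries this over. -/
theorem contDiff_compContinuousLinearMap (k : ℕ) {n : WithTop ℕ∞} :
    ContDiff ℝ n (fun x : (E [⋀^Fin k]→L[ℝ] ℝ) × (E →L[ℝ] E) =>
      x.1.compContinuousLinearMap x.2) := by
  have := finiteDimensional_multilinear (E := E) k
  have := finiteDimensional_alt E k
  let T : (E [⋀^Fin k]→L[ℝ] ℝ) →L[ℝ] ContinuousMultilinearMap ℝ (fun _ : Fin k => E) ℝ :=
    ContinuousAlternatingMap.toContinuousMultilinearMapCLM ℝ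
  obtain ⟨R, hR⟩ := LinearMap.exists_leftInverse_of_injective T.toLinearMap
    (LinearMap.ker_eq_bot.2 ContinuousAlternatingMap.toContinuousMultilinearMap_injective)
  have h1 : ContDiff ℝ n (fun x : (E [⋀^Fin k]→L[ℝ] ℝ) × (E →L[ℝ] E) =>
      ContinuousMultilinearMap.compContinuousLinearMapContinuousMultilinear ℝ
        (fun _ : Fin k => E) (fun _ : Fin k => E) ℝ (fun _ => x.2) (T x.1)) :=
    ((ContinuousMultilinearMap.contDiff _).comp
      (contDiff_pi.2 fun _ => contDiff_snd)).clm_apply (T.contDiff.comp contDiff_fst)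
  have h2 := (LinearMap.toContinuousLinearMap R).contDiff (n := n).comp h1
  have h3 : (fun x : (E [⋀^Fin k]→L[ℝ] ℝ) × (E →L[ℝ] E) => x.1.compContinuousLinearMap x.2) =
      LinearMap.toContinuousLinearMap R ∘ fun x =>
        ContinuousMultilinearMap.compContinuousLinearMapContinuousMultilinear ℝ
          (fun _ : Fin k => E) (fun _ : Fin k => E) ℝ (fun _ => x.2) (T x.1) :=
    funext fun x => (LinearMap.congr_fun hR (x.1.compContinuousLinearMap x.2)).symm
  rw [h3]
  exact h2

theorem ContMDiffAt.compContinuousLinearMap_alt {EM M : Type*} [NormedAddCommGroup EM] [NormedSpace ℝ EM]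
    [TopologicalSpace M] [ChartedSpace EM M] {k : ℕ} {n : WithTop ℕ∞}
    {f : M → E [⋀^Fin k]→L[ℝ] ℝ} {p : M} {c : M → E →L[ℝ] E}
    (hf : ContMDiffAt 𝓘(ℝ, EM) 𝓘(ℝ, E [⋀^Fin k]→L[ℝ] ℝ) n f p)
    (hc : ContMDiffAt 𝓘(ℝ, EM) 𝓘(ℝ, E →L[ℝ] E) n c p) :
    ContMDiffAt 𝓘(ℝ, EM) 𝓘(ℝ, E [⋀^Fin k]→L[ℝ] ℝ) n
      (fun q => (f q).compContinuousLinearMap (c q)) p :=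
  (contDiff_compContinuousLinearMap k).contMDiff.contMDiffAt.comp p (hf.prodMk_space hc)

end AltSmooth

/-! ### Change of frame -/

section Frames

variable {EP EX P X : Type*}
  [NormedAddCommGroup EP] [NormedSpace ℝ EP]
  [NormedAddCommGroup EX] [NormedSpace ℝ EX]
  [TopologicalSpace P] [ChartedSpace EP P]
  [TopologicalSpace X] [ChartedSpace EX X] [IsManifold 𝓘(ℝ, EX) ∞ X]

theorem mvfderiv_comp_vec_apply {EM M A : Type*} [NormedAddCommGroup EM] [NormedSpace ℝ EM]
    [TopologicalSpace M] [ChartedSpace EM M] [NormedAddCommGroup A] [NormedSpace ℝ A]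
    {f : P → M} {g : M → A} {p : P}
    (hg : MDifferentiableAt 𝓘(ℝ, EM) 𝓘(ℝ, A) g (f p))
    (hf : MDifferentiableAt 𝓘(ℝ, EP) 𝓘(ℝ, EM) f p) (v : TangentSpace 𝓘(ℝ, EP) p) :
    mvfderiv 𝓘(ℝ, EP) (g ∘ f) p v =
      mvfderiv 𝓘(ℝ, EM) g (f p) (mfderiv 𝓘(ℝ, EP) 𝓘(ℝ, EM) f p v) := by
  have h := mfderiv_comp p hg hf
  exact congrArg (fun L : TangentSpace 𝓘(ℝ, EP) p →L[ℝ] A => L v) h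

/-- The trivialization of `TX` around `x`. -/
abbrev triv (EX : Type*) {X : Type*} [NormedAddCommGroup EX] [NormedSpace ℝ EX]
    [TopologicalSpace X] [ChartedSpace EX X] [IsManifold 𝓘(ℝ, EX) ∞ X] (x : X) :
    Bundle.Trivialization EX
      (Bundle.TotalSpace.proj : TangentBundle 𝓘(ℝ, EX) X → X) :=
  trivializationAt EX (TangentSpace 𝓘(ℝ, EX)) x

theorem inFrame_change {π : P → X} {k : ℕ} {p₀ p₁ p : P} (α : ∀ p, Alt EX π k p)
    (h₀ : π p ∈ (triv EX (π p₀)).baseSet) (h₁ : π p ∈ (triv EX (π p₁)).baseSet) :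
    inFrame p₀ α p = (inFrame p₁ α p).compContinuousLinearMap
      ((triv EX (π p₀)).coordChangeL ℝ (triv EX (π p₁)) (π p) : EX →L[ℝ] EX) := by
  ext w
  refine congrArg (α p) (funext fun i => ?_)
  change _ = (triv EX (π p₁)).symmL ℝ (π p)
    ((triv EX (π p₀)).coordChangeL ℝ (triv EX (π p₁)) (π p) (w i))
  rw [Bundle.Trivialization.coordChangeL_apply _ _ ⟨h₀, h₁⟩]
  have := Bundle.Trivialization.symmL_continuousLinearMapAt (R := ℝ) (triv EX (π p₁)) h₁
    ((triv EX (π p₀)).symm (π p) (w i))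
  rw [Bundle.Trivialization.continuousLinearMapAt_apply,
    Bundle.Trivialization.linearMapAt_apply, if_pos h₁] at this
  exact (Bundle.Trivialization.symmL_apply _ h₀ _).trans this.symm

theorem inFrame_change_eventuallyEq {π : P → X} {k : ℕ} {p₀ p₁ p : P} (α : ∀ p, Alt EX π k p)
    (hπ : ContinuousAt π p)
    (h₀ : π p ∈ (triv EX (π p₀)).baseSet) (h₁ : π p ∈ (triv EX (π p₁)).baseSet) :
    inFrame p₀ α =ᶠ[𝓝 p] fun q => (inFrame p₁ α q).compContinuousLinearMap
      ((triv EX (π p₀)).coordChangeL ℝ (triv EX (π p₁)) (π q) : EX →L[ℝ] EX) := by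
  filter_upwards [hπ.preimage_mem_nhds ((triv EX (π p₀)).open_baseSet.mem_nhds h₀),
    hπ.preimage_mem_nhds ((triv EX (π p₁)).open_baseSet.mem_nhds h₁)] with q hq₀ hq₁
  exact inFrame_change α hq₀ hq₁

variable [FiniteDimensional ℝ EX]

theorem contMDiffAt_inFrame {π : P → X} {k : ℕ} {p₀ p₁ p : P} {α : ∀ p, Alt EX π k p}
    (hπ : ContMDiffAt 𝓘(ℝ, EP) 𝓘(ℝ, EX) ∞ π p)
    (h₀ : π p ∈ (triv EX (π p₀)).baseSet) (h₁ : π p ∈ (triv EX (π p₁)).baseSet)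
    (h : ContMDiffAt 𝓘(ℝ, EP) 𝓘(ℝ, EX [⋀^Fin k]→L[ℝ] ℝ) ∞ (inFrame p₁ α) p) :
    ContMDiffAt 𝓘(ℝ, EP) 𝓘(ℝ, EX [⋀^Fin k]→L[ℝ] ℝ) ∞ (inFrame p₀ α) p := by
  refine ContMDiffAt.congr_of_eventuallyEq ?_
    (inFrame_change_eventuallyEq α hπ.continuousAt h₀ h₁)
  refine ContMDiffAt.compContinuousLinearMap_alt h ?_
  have hc : ContMDiffAt 𝓘(ℝ, EX) 𝓘(ℝ, EX →L[ℝ] EX) ∞ (fun x =>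
      ((triv EX (π p₀)).coordChangeL ℝ (triv EX (π p₁)) x : EX →L[ℝ] EX)) (π p) :=
    contMDiffAt_coordChangeL h₀ h₁
  exact hc.comp p hπ

/-- The transition between two pulled-back frames is a function of `π q`, so it has zero derivative
along vertical vectors. Flatness may thus be tested in any pulled-back frame, not only in the one
centred at the point. -/
theorem mvfderiv_inFrame_eq_zero {π : P → X} {k : ℕ} {p₀ p₁ p : P} {α : ∀ p, Alt EX π k p}
    (hπ : ContMDiffAt 𝓘(ℝ, EP) 𝓘(ℝ, EX) ∞ π p)
    (h₀ : π p ∈ (triv EX (π p₀)).baseSet) (h₁ : π p ∈ (triv EX (π p₁)).baseSet)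
    (h : ContMDiffAt 𝓘(ℝ, EP) 𝓘(ℝ, EX [⋀^Fin k]→L[ℝ] ℝ) ∞ (inFrame p₁ α) p)
    {v : TangentSpace 𝓘(ℝ, EP) p} (hv : mfderiv 𝓘(ℝ, EP) 𝓘(ℝ, EX) π p v = 0)
    (hα : mvfderiv 𝓘(ℝ, EP) (inFrame p₁ α) p v = 0) :
    mvfderiv 𝓘(ℝ, EP) (inFrame p₀ α) p v = 0 := by
  rw [mvfderiv_congr (inFrame_change_eventuallyEq α hπ.continuousAt h₀ h₁)]
  have hc : ContMDiffAt 𝓘(ℝ, EX) 𝓘(ℝ, EX →L[ℝ] EX) ∞ (fun x =>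
      ((triv EX (π p₀)).coordChangeL ℝ (triv EX (π p₁)) x : EX →L[ℝ] EX)) (π p) :=
    contMDiffAt_coordChangeL h₀ h₁
  have hc' := hc.comp p hπ
  have h2 : mvfderiv 𝓘(ℝ, EP) ((fun x =>
      ((triv EX (π p₀)).coordChangeL ℝ (triv EX (π p₁)) x : EX →L[ℝ] EX)) ∘ π) p v = 0 := by
    rw [mvfderiv_comp_vec_apply (hc.mdifferentiableAt (by simp)) (hπ.mdifferentiableAt (by simp)),
      hv, map_zero]
  have hpair : mvfderiv 𝓘(ℝ, EP) (fun q => (inFrame p₁ α q, ((fun x =>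
      ((triv EX (π p₀)).coordChangeL ℝ (triv EX (π p₁)) x : EX →L[ℝ] EX)) ∘ π) q)) p v = 0 := by
    have h3 := h.mdifferentiableAt (by simp)
    have h4 := hc'.mdifferentiableAt (by simp)
    have h5 := h3.hasMFDerivAt.2.prodMk h4.hasMFDerivAt.2
    have h6 : HasMFDerivAt 𝓘(ℝ, EP) 𝓘(ℝ, (EX [⋀^Fin k]→L[ℝ] ℝ) × (EX →L[ℝ] EX))
      (fun q => (inFrame p₁ α q, ((fun x =>
      ((triv EX (π p₀)).coordChangeL ℝ (triv EX (π p₁)) x : EX →L[ℝ] EX)) ∘ π) q)) p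
        ((mvfderiv 𝓘(ℝ, EP) (inFrame p₁ α) p).prod (mvfderiv 𝓘(ℝ, EP) ((fun x =>
      ((triv EX (π p₀)).coordChangeL ℝ (triv EX (π p₁)) x : EX →L[ℝ] EX)) ∘ π) p)) :=
      ⟨h3.continuousAt.prodMk h4.continuousAt, h5⟩
    have h7 := congrArg (fun L : TangentSpace 𝓘(ℝ, EP) p →L[ℝ] _ => L v) h6.mfderiv
    exact h7.trans (Prod.ext hα h2)
  have hG := (contDiff_compContinuousLinearMap (E := EX) k (n := ∞)).contMDiff.contMDiffAt
    (x := (inFrame p₁ α p, ((fun x =>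
      ((triv EX (π p₀)).coordChangeL ℝ (triv EX (π p₁)) x : EX →L[ℝ] EX)) ∘ π) p))
  have := mvfderiv_comp_vec_apply (f := fun q => (inFrame p₁ α q, ((fun x =>
      ((triv EX (π p₀)).coordChangeL ℝ (triv EX (π p₁)) x : EX →L[ℝ] EX)) ∘ π) q))
    (hG.mdifferentiableAt (by simp)) ((h.prodMk_space hc').mdifferentiableAt (by simp)) v
  refine this.trans ?_
  refine (congrArg _ hpair).trans (map_zero _)

end Frames


/-! ### The exterior derivative in a pulled-back frame -/

section KeyFormula

open ContinuousAlternatingMap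

theorem two_le_infty : (2 : WithTop ℕ∞) ≤ ∞ :=
  (WithTop.coe_le_coe.2 le_top : ((2 : ℕ∞) : WithTop ℕ∞) ≤ ((⊤ : ℕ∞) : WithTop ℕ∞))

/-- The product rule also yields a term with the second derivative of `g`. It is symmetric and
disappears under alternatization, so only the coefficients `A` are differentiated. -/
theorem extDeriv_comp_fderiv {E E' : Type*} [NormedAddCommGroup E] [NormedSpace ℝ E]
    [NormedAddCommGroup E'] [NormedSpace ℝ E'] {k : ℕ}
    {A : E → E' [⋀^Fin k]→L[ℝ] ℝ} {g : E → E'} {y : E} (hA : DifferentiableAt ℝ A y)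
    (hg : ContDiffAt ℝ ∞ g y) (v : Fin (k + 1) → E) :
    extDeriv (fun z => (A z).compContinuousLinearMap (fderiv ℝ g z)) y v =
      ∑ i : Fin (k + 1), (-1) ^ (i : ℕ) *
        fderiv ℝ A y (v i) (i.removeNth fun j => fderiv ℝ g y (v j)) := by
  have hd : DifferentiableAt ℝ (fderiv ℝ g) y :=
    (hg.fderiv_right (m := 1) (by rw [one_add_one_eq_two]; exact two_le_infty)).differentiableAt (by simp)
  rw [extDeriv, fderiv_continuousAlternatingMapCompContinuousLinearMap hA hd,
    alternatizeUncurryFin_add, alternatizeUncurryFin_fderivCompContinuousLinearMap_eq_zero,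
    add_zero, alternatizeUncurryFin_apply]
  · refine Finset.sum_congr rfl fun i _ => ?_
    rw [zsmul_eq_mul]
    push_cast
    rfl
  · exact fun x z => (hg.isSymmSndFDerivAt (by simpa using two_le_infty)) x z

variable {EP EX P X : Type*}
  [NormedAddCommGroup EP] [NormedSpace ℝ EP]
  [NormedAddCommGroup EX] [NormedSpace ℝ EX]
  [TopologicalSpace P] [ChartedSpace EP P] [IsManifold 𝓘(ℝ, EP) ∞ P]
  [TopologicalSpace X] [ChartedSpace EX X] [IsManifold 𝓘(ℝ, EX) ∞ X]

theorem comp_continuousLinearMapAt_inFrame {π : P → X} {k : ℕ} {p₀ p : P}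
    (β : ∀ p, Alt EX π k p) (h₀ : π p ∈ (triv EX (π p₀)).baseSet) :
    (inFrame p₀ β p).compContinuousLinearMap ((triv EX (π p₀)).continuousLinearMapAt ℝ (π p)) =
      β p := by
  ext w
  exact congrArg (β p) (funext fun i =>
    Bundle.Trivialization.symmL_continuousLinearMapAt (triv EX (π p₀)) h₀ (w i))

/-- The trivialization of `TX` attached to a chart is the differential of that chart, so the
components of `Tπ v` are derivatives of the functions `ψ ∘ π`. This is what makes the frame
holonomic and `extDeriv_comp_fderiv` applicable. -/
theorem continuousLinearMapAt_comp_mfderiv {π : P → X} {x₀ : X} {p : P}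
    (hπ : MDifferentiableAt 𝓘(ℝ, EP) 𝓘(ℝ, EX) π p)
    (h₀ : π p ∈ (triv EX x₀).baseSet) (v : TangentSpace 𝓘(ℝ, EP) p) :
    (triv EX x₀).continuousLinearMapAt ℝ (π p) (mfderiv 𝓘(ℝ, EP) 𝓘(ℝ, EX) π p v) =
      mvfderiv 𝓘(ℝ, EP) (extChartAt 𝓘(ℝ, EX) x₀ ∘ π) p v := by
  have h₀' : π p ∈ (chartAt EX x₀).source := h₀
  have : IsManifold 𝓘(ℝ, EX) 1 X := .of_le (n := ∞) (by simp)
  rw [mvfderiv_comp_vec_apply (mdifferentiableAt_extChartAt h₀') hπ]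
  exact congrArg (fun L : TangentSpace 𝓘(ℝ, EX) (π p) →L[ℝ] EX =>
    L (mfderiv 𝓘(ℝ, EP) 𝓘(ℝ, EX) π p v))
    (TangentBundle.continuousLinearMapAt_trivializationAt h₀')

/-- The exterior derivative of `β ∘ Tπ` in terms of the coefficients of `β` in the pullback of a
coordinate frame of `TX`. -/
theorem extDerivAt_comp_mfderiv {π : P → X} {k : ℕ} {p₀ p : P} (β : ∀ p, Alt EX π k p)
    (hπ : ContMDiff 𝓘(ℝ, EP) 𝓘(ℝ, EX) ∞ π)
    (h₀ : π p ∈ (triv EX (π p₀)).baseSet)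
    (hβ : MDifferentiableAt 𝓘(ℝ, EP) 𝓘(ℝ, EX [⋀^Fin k]→L[ℝ] ℝ) (inFrame p₀ β) p)
    (v : Fin (k + 1) → TangentSpace 𝓘(ℝ, EP) p) :
    extDerivAt (fun q => (β q).compContinuousLinearMap (mfderiv 𝓘(ℝ, EP) 𝓘(ℝ, EX) π q)) p v =
      ∑ i : Fin (k + 1), (-1) ^ (i : ℕ) * mvfderiv 𝓘(ℝ, EP) (inFrame p₀ β) p (v i)
        (i.removeNth fun j => (triv EX (π p₀)).continuousLinearMapAt ℝ (π p)
          (mfderiv 𝓘(ℝ, EP) 𝓘(ℝ, EX) π p (v j))) := by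
  have : IsManifold 𝓘(ℝ, EX) 1 X := .of_le (n := ∞) (by simp)
  have : IsManifold 𝓘(ℝ, EP) 1 P := .of_le (n := ∞) (by simp)
  let χ := extChartAt 𝓘(ℝ, EP) p
  let ψ := extChartAt 𝓘(ℝ, EX) (π p₀)
  let A : EP → EX [⋀^Fin k]→L[ℝ] ℝ := inFrame p₀ β ∘ χ.symm
  let g : EP → EX := (ψ ∘ π) ∘ χ.symm
  have hp : p ∈ (chartAt EP p).source := mem_chart_source EP p
  have hχp : χ.symm (χ p) = p := extChartAt_to_inv p
  have hψ : ∀ q, π q ∈ (triv EX (π p₀)).baseSet →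
      ContMDiffAt 𝓘(ℝ, EP) 𝓘(ℝ, EX) ∞ (ψ ∘ π) q := fun q hq =>
    (contMDiffAt_extChartAt' (n := ∞) (I := 𝓘(ℝ, EX)) hq).comp q hπ.contMDiffAt
  have htar : χ.target ∈ 𝓝 (χ p) := extChartAt_target_mem_nhds p
  have hsymm : ∀ y ∈ χ.target, ContMDiffAt 𝓘(ℝ, EP) 𝓘(ℝ, EP) ∞ χ.symm y := fun y hy =>
    (contMDiffOn_extChartAt_symm (I := 𝓘(ℝ, EP)) (n := ∞) p).contMDiffAt
      ((isOpen_extChartAt_target p).mem_nhds hy)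
  have hsymm0 := hsymm (χ p) (mem_of_mem_nhds htar)
  have hbase : ∀ᶠ y in 𝓝 (χ p), π (χ.symm y) ∈ (triv EX (π p₀)).baseSet := by
    have hc : ContinuousAt (π ∘ χ.symm) (χ p) :=
      hπ.continuous.continuousAt.comp hsymm0.continuousAt
    refine hc.preimage_mem_nhds ((triv EX (π p₀)).open_baseSet.mem_nhds ?_)
    simpa [hχp] using h₀
  have hgm : ContMDiffAt 𝓘(ℝ, EP) 𝓘(ℝ, EX) ∞ g (χ p) :=
    ContMDiffAt.comp (χ p) (by rw [hχp]; exact hψ p h₀) hsymm0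
  have hAm : MDifferentiableAt 𝓘(ℝ, EP) 𝓘(ℝ, EX [⋀^Fin k]→L[ℝ] ℝ) A (χ p) :=
    MDifferentiableAt.comp (χ p) (by rw [hχp]; exact hβ) (hsymm0.mdifferentiableAt (by simp))
  -- Read in the chart `χ`, the form `β ∘ Tπ` is the coefficient function `A` pulled back along the
  -- derivative of `g`. This holds near `χ p`, which suffices for `extDeriv`.
  have hform : (fun y : EP => (((β (χ.symm y)).compContinuousLinearMap
      (mfderiv 𝓘(ℝ, EP) 𝓘(ℝ, EX) π (χ.symm y))).compContinuousLinearMap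
      (mfderiv 𝓘(ℝ, EP) 𝓘(ℝ, EP) χ.symm y) : EP [⋀^Fin k]→L[ℝ] ℝ)) =ᶠ[𝓝 (χ p)]
      fun y => (A y).compContinuousLinearMap (fderiv ℝ g y) := by
    filter_upwards [hbase, htar] with y hy hyt
    ext w
    have e1 : ∀ u : TangentSpace 𝓘(ℝ, EP) y, fderiv ℝ g y u =
        (triv EX (π p₀)).continuousLinearMapAt ℝ (π (χ.symm y))
          (mfderiv 𝓘(ℝ, EP) 𝓘(ℝ, EX) π (χ.symm y) (mfderiv 𝓘(ℝ, EP) 𝓘(ℝ, EP) χ.symm y u)) := by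
      intro u
      rw [continuousLinearMapAt_comp_mfderiv (hπ.mdifferentiable (by simp) _) hy,
        ← mvfderiv_comp_vec_apply ((hψ _ hy).mdifferentiableAt (by simp))
          ((hsymm y hyt).mdifferentiableAt (by simp))]
      exact congrArg (fun L : EP →L[ℝ] EX => L u) mfderiv_eq_fderiv.symm
    change β (χ.symm y) (fun i => mfderiv 𝓘(ℝ, EP) 𝓘(ℝ, EX) π (χ.symm y)
      (mfderiv 𝓘(ℝ, EP) 𝓘(ℝ, EP) χ.symm y (w i))) =
      inFrame p₀ β (χ.symm y) (fun i => fderiv ℝ g y (w i))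
    rw [← comp_continuousLinearMapAt_inFrame β hy]
    exact congrArg (inFrame p₀ β (χ.symm y)) (funext fun i => (e1 (w i)).symm)
  have hA' : DifferentiableAt ℝ A (χ p) := mdifferentiableAt_iff_differentiableAt.1 hAm
  have hg' : ContDiffAt ℝ ∞ g (χ p) := contMDiffAt_iff_contDiffAt.1 hgm
  have hχd : MDifferentiableAt 𝓘(ℝ, EP) 𝓘(ℝ, EP) χ p := mdifferentiableAt_extChartAt hp
  have hinv : ∀ᶠ q in 𝓝 p, χ.symm (χ q) = q := by
    filter_upwards [(chartAt EP p).open_source.mem_nhds hp] with q hq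
    exact χ.left_inv (by simpa [χ] using hq)
  -- The differential of `χ` in the definition of `extDerivAt` undoes the `χ.symm` contained in `A`,
  -- and likewise in `g` below.
  have hA2 : ∀ u : TangentSpace 𝓘(ℝ, EP) p,
      fderiv ℝ A (χ p) (mfderiv 𝓘(ℝ, EP) 𝓘(ℝ, EP) χ p u) =
        mvfderiv 𝓘(ℝ, EP) (inFrame p₀ β) p u := by
    intro u
    have e : A ∘ χ =ᶠ[𝓝 p] inFrame p₀ β := by
      filter_upwards [hinv] with q hq
      simp [A, hq]
    rw [← mvfderiv_congr e, mvfderiv_comp_vec_apply hAm hχd]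
    exact congrArg (fun L : EP →L[ℝ] _ => L (mfderiv 𝓘(ℝ, EP) 𝓘(ℝ, EP) χ p u))
      mfderiv_eq_fderiv.symm
  have hg2 : ∀ u : TangentSpace 𝓘(ℝ, EP) p,
      fderiv ℝ g (χ p) (mfderiv 𝓘(ℝ, EP) 𝓘(ℝ, EP) χ p u) =
        (triv EX (π p₀)).continuousLinearMapAt ℝ (π p)
          (mfderiv 𝓘(ℝ, EP) 𝓘(ℝ, EX) π p u) := by
    intro u
    have e : g ∘ χ =ᶠ[𝓝 p] ψ ∘ π := by
      filter_upwards [hinv] with q hq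
      simp [g, hq]
    rw [continuousLinearMapAt_comp_mfderiv (hπ.mdifferentiable (by simp) _) h₀,
      ← mvfderiv_congr e, mvfderiv_comp_vec_apply (hgm.mdifferentiableAt (by simp)) hχd]
    exact congrArg (fun L : EP →L[ℝ] _ => L (mfderiv 𝓘(ℝ, EP) 𝓘(ℝ, EP) χ p u))
      mfderiv_eq_fderiv.symm
  have hmain := extDeriv_comp_fderiv hA' hg' (fun i => mfderiv 𝓘(ℝ, EP) 𝓘(ℝ, EP) χ p (v i))
  rw [← hform.extDeriv_eq] at hmain
  refine hmain.trans (Finset.sum_congr rfl fun i _ => ?_)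
  simp only [hA2, hg2]

end KeyFormula


/-! ### Smooth vector fields -/

section VectorFields

variable {EP P : Type*} [NormedAddCommGroup EP] [NormedSpace ℝ EP]
  [TopologicalSpace P] [ChartedSpace EP P]

theorem contMDiffAt_clm_of_apply {E A : Type*} [NormedAddCommGroup E] [NormedSpace ℝ E]
    [FiniteDimensional ℝ E] [NormedAddCommGroup A] [NormedSpace ℝ A] {n : WithTop ℕ∞}
    {f : P → E →L[ℝ] A} {p : P}
    (h : ∀ w, ContMDiffAt 𝓘(ℝ, EP) 𝓘(ℝ, A) n (fun q => f q w) p) :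
    ContMDiffAt 𝓘(ℝ, EP) 𝓘(ℝ, E →L[ℝ] A) n f p := by
  let b := Module.finBasis ℝ E
  let c : ∀ _ : Fin (Module.finrank ℝ E), E →L[ℝ] ℝ := fun i =>
    LinearMap.toContinuousLinearMap (b.coord i)
  have e : f = fun q => ∑ i, ContinuousLinearMap.smulRightL ℝ E A (c i) (f q (b i)) := by
    funext q
    ext w
    conv_lhs => rw [← b.sum_repr w, map_sum]
    simp [c]
  rw [e]
  exact contMDiffAt_finsetSum fun i _ =>
    ((ContinuousLinearMap.smulRightL ℝ E A (c i)).contDiff.contMDiff.contMDiffAt).comp p (h (b i))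

variable [IsManifold 𝓘(ℝ, EP) ∞ P]

/-- Smoothness at `p` of a vector field on `P`. -/
abbrev SmoothFieldAt (V : ∀ p : P, TangentSpace 𝓘(ℝ, EP) p) (p : P) : Prop :=
  ContMDiffAt 𝓘(ℝ, EP) 𝓘(ℝ, EP).tangent ∞ (fun q => (⟨q, V q⟩ : TangentBundle 𝓘(ℝ, EP) P)) p

theorem contMDiffAt_mvfderiv_apply {A : Type*} [NormedAddCommGroup A] [NormedSpace ℝ A]
    {f : P → A} {V : ∀ p : P, TangentSpace 𝓘(ℝ, EP) p} {p : P}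
    (hf : ContMDiffAt 𝓘(ℝ, EP) 𝓘(ℝ, A) ∞ f p) (hV : SmoothFieldAt V p) :
    ContMDiffAt 𝓘(ℝ, EP) 𝓘(ℝ, A) ∞ (fun q => mvfderiv 𝓘(ℝ, EP) f q (V q)) p := by
  have : IsManifold 𝓘(ℝ, EP) 1 P := .of_le (n := ∞) (by simp)
  have h1 : ContMDiffAt 𝓘(ℝ, EP) 𝓘(ℝ, EP →L[ℝ] A) ∞
      (inTangentCoordinates 𝓘(ℝ, EP) 𝓘(ℝ, A) id f
        (mfderiv 𝓘(ℝ, EP) 𝓘(ℝ, A) f) p) p := hf.mfderiv_const (m := ∞) (by simp)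
  have h2 := ContMDiffAt.clm_apply_of_inCoordinates (F₁ := EP) (F₂ := A)
    (E₁ := TangentSpace 𝓘(ℝ, EP)) (E₂ := TangentSpace 𝓘(ℝ, A)) (b₁ := id) (b₂ := f)
    (IB₁ := 𝓘(ℝ, EP)) (IB₂ := 𝓘(ℝ, A)) (v := V)
    (ϕ := fun q => mfderiv 𝓘(ℝ, EP) 𝓘(ℝ, A) f q) h1 hV hf
  exact ((contMDiff_snd_tangentBundle_modelSpace A 𝓘(ℝ, A)).contMDiffAt
    (x := ⟨f p, mfderiv 𝓘(ℝ, EP) 𝓘(ℝ, A) f p (V p)⟩)).comp p h2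

end VectorFields

/-! ### Horizontal lifts -/

section Lift

variable {EP EX P X : Type*}
  [NormedAddCommGroup EP] [NormedSpace ℝ EP]
  [NormedAddCommGroup EX] [NormedSpace ℝ EX] [FiniteDimensional ℝ EX]
  [TopologicalSpace P] [ChartedSpace EP P]
  [TopologicalSpace X] [ChartedSpace EX X]

theorem exists_mem_mfderiv_eq {π : P → X}
    {C : ∀ p : P, Submodule ℝ (TangentSpace 𝓘(ℝ, EP) p)} {p : P}
    (hπ : Function.Surjective (mfderiv 𝓘(ℝ, EP) 𝓘(ℝ, EX) π p))
    (hC : C p ⊔ vertical EP EX π p = ⊤) (w : TangentSpace 𝓘(ℝ, EX) (π p)) :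
    ∃ v ∈ C p, mfderiv 𝓘(ℝ, EP) 𝓘(ℝ, EX) π p v = w := by
  obtain ⟨u, rfl⟩ := hπ w
  obtain ⟨c, hc, z, hz, rfl⟩ := Submodule.mem_sup.1 (hC ▸ Submodule.mem_top : u ∈ _)
  refine ⟨c, hc, ?_⟩
  have hz' : mfderiv 𝓘(ℝ, EP) 𝓘(ℝ, EX) π p z = 0 := hz
  rw [map_add, hz', add_zero]

theorem exists_lift {π : P → X}
    {C : ∀ p : P, Submodule ℝ (TangentSpace 𝓘(ℝ, EP) p)} {p : P}
    (hπ : Function.Surjective (mfderiv 𝓘(ℝ, EP) 𝓘(ℝ, EX) π p))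
    (hC : C p ⊔ vertical EP EX π p = ⊤) :
    ∃ s : TangentSpace 𝓘(ℝ, EX) (π p) →L[ℝ] TangentSpace 𝓘(ℝ, EP) p,
      (∀ w, s w ∈ C p) ∧ ∀ w, mfderiv 𝓘(ℝ, EP) 𝓘(ℝ, EX) π p (s w) = w := by
  have : FiniteDimensional ℝ (TangentSpace 𝓘(ℝ, EX) (π p)) :=
    inferInstanceAs (FiniteDimensional ℝ EX)
  have : T2Space (TangentSpace 𝓘(ℝ, EX) (π p)) := inferInstanceAs (T2Space EX)
  let f : C p →ₗ[ℝ] TangentSpace 𝓘(ℝ, EX) (π p) :=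
    (mfderiv 𝓘(ℝ, EP) 𝓘(ℝ, EX) π p).toLinearMap.comp (C p).subtype
  obtain ⟨g, hg⟩ := LinearMap.exists_rightInverse_of_surjective f (by
    rw [LinearMap.range_eq_top]
    intro w
    obtain ⟨v, hv, rfl⟩ := exists_mem_mfderiv_eq hπ hC w
    exact ⟨⟨v, hv⟩, rfl⟩)
  refine ⟨LinearMap.toContinuousLinearMap ((C p).subtype.comp g), fun w => (g w).2, fun w => ?_⟩
  exact LinearMap.congr_fun hg w

variable [IsManifold 𝓘(ℝ, EP) ∞ P] [IsManifold 𝓘(ℝ, EX) ∞ X]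

/-- Near every point, a smooth distribution transverse to the fibres of `π` admits a smooth
horizontal lift of the coordinate frame of `TX`. -/
theorem exists_smooth_lift {π : P → X} (hπ : IsSmoothSubmersion EP EX π)
    {C : ∀ p : P, Submodule ℝ (TangentSpace 𝓘(ℝ, EP) p)} (hC : IsSmoothDistribution C)
    (hCπ : ∀ p, C p ⊔ vertical EP EX π p = ⊤) (p₀ : P) :
    ∃ S : ∀ p : P, EX →L[ℝ] TangentSpace 𝓘(ℝ, EP) p,
      (∀ w, SmoothFieldAt (fun p => S p w) p₀) ∧
      ∀ᶠ p in 𝓝 p₀, ∀ w, S p w ∈ C p ∧ (triv EX (π p₀)).continuousLinearMapAt ℝ (π p)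
        (mfderiv 𝓘(ℝ, EP) 𝓘(ℝ, EX) π p (S p w)) = w := by
  have : CompleteSpace EX := FiniteDimensional.complete ℝ EX
  obtain ⟨U, hU, r, s, hs, hsC⟩ := hC p₀
  have hs₀ : ∀ i, SmoothFieldAt (s i) p₀ := fun i =>
    (hs i).contMDiffAt (U.isOpen.mem_nhds hU)
  have hb₀ : π p₀ ∈ (triv EX (π p₀)).baseSet := FiberBundle.mem_baseSet_trivializationAt' (π p₀)
  let ψ : P → EX := extChartAt 𝓘(ℝ, EX) (π p₀) ∘ π
  have hψ : ContMDiffAt 𝓘(ℝ, EP) 𝓘(ℝ, EX) ∞ ψ p₀ :=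
    (contMDiffAt_extChartAt' (n := ∞) (I := 𝓘(ℝ, EX)) hb₀).comp p₀ hπ.contMDiff.contMDiffAt
  let T : ∀ p : P, TangentSpace 𝓘(ℝ, EP) p →L[ℝ] EX := fun p => mvfderiv 𝓘(ℝ, EP) ψ p
  have hT : ∀ p, π p ∈ (triv EX (π p₀)).baseSet → ∀ v : TangentSpace 𝓘(ℝ, EP) p,
      (triv EX (π p₀)).continuousLinearMapAt ℝ (π p) (mfderiv 𝓘(ℝ, EP) 𝓘(ℝ, EX) π p v) =
        T p v := fun p hp v =>
    continuousLinearMapAt_comp_mfderiv (hπ.contMDiff.mdifferentiable (by simp) _) hp v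
  let B : ∀ p : P, (Fin r → ℝ) →L[ℝ] TangentSpace 𝓘(ℝ, EP) p := fun p =>
    ∑ i, (ContinuousLinearMap.proj (R := ℝ) (φ := fun _ : Fin r => ℝ) i).smulRight (s i p)
  have hB : ∀ p c, B p c = ∑ i, c i • s i p := fun p c => by
    simp [B]
  -- `M p` takes coefficients in the local frame of `C` to components of `Tπ` in the frame of `TX`.
  -- Transversality makes it onto at `p₀`.
  let M : P → (Fin r → ℝ) →L[ℝ] EX := fun p => (T p).comp (B p)
  have hM : ContMDiffAt 𝓘(ℝ, EP) 𝓘(ℝ, (Fin r → ℝ) →L[ℝ] EX) ∞ M p₀ := by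
    refine contMDiffAt_clm_of_apply fun c => ?_
    have e : (fun q => M q c) = fun q => ∑ i, c i • T q (s i q) := by
      funext q
      simp [M, hB, map_sum]
    rw [e]
    refine contMDiffAt_finsetSum fun i _ => ?_
    exact (contDiff_const_smul (c i)).contMDiff.contMDiffAt.comp p₀
      (contMDiffAt_mvfderiv_apply hψ (hs₀ i))
  have hsurj : Function.Surjective (M p₀) := by
    intro x
    obtain ⟨v, hv, hvx⟩ := exists_mem_mfderiv_eq (hπ.surjective p₀) (hCπ p₀)
      ((triv EX (π p₀)).symmL ℝ (π p₀) x)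
    rw [← (hsC p₀ hU).2, Submodule.mem_span_range_iff_exists_fun] at hv
    obtain ⟨c, rfl⟩ := hv
    refine ⟨c, ?_⟩
    change T p₀ (B p₀ c) = x
    rw [hB, ← hT p₀ hb₀, hvx, Bundle.Trivialization.continuousLinearMapAt_symmL _ hb₀]
  -- A right inverse is chosen at `p₀` only. `N = M ∘ R₀` is the identity there, hence invertible
  -- nearby with smooth inverse `J`, and `B ∘ R₀ ∘ J` is the required lift. Where `N` is not
  -- invertible `J` takes a default value, which is harmless since only the germ at `p₀` counts.
  obtain ⟨R, hR⟩ := LinearMap.exists_rightInverse_of_surjective (M p₀).toLinearMap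
    (LinearMap.range_eq_top.2 hsurj)
  let R₀ : EX →L[ℝ] (Fin r → ℝ) := LinearMap.toContinuousLinearMap R
  let N : P → EX →L[ℝ] EX := fun p => (M p).comp R₀
  have hN : ContMDiffAt 𝓘(ℝ, EP) 𝓘(ℝ, EX →L[ℝ] EX) ∞ N p₀ := hM.clm_comp contMDiffAt_const
  have hN₀ : N p₀ = (ContinuousLinearEquiv.refl ℝ EX : EX →L[ℝ] EX) := by
    ext x
    exact LinearMap.congr_fun hR x
  let J : P → EX →L[ℝ] EX := fun p => (N p).inverse
  have hJ : ContMDiffAt 𝓘(ℝ, EP) 𝓘(ℝ, EX →L[ℝ] EX) ∞ J p₀ := by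
    have h1 : ContDiffAt ℝ ∞ (ContinuousLinearMap.inverse : (EX →L[ℝ] EX) → EX →L[ℝ] EX)
        (N p₀) := by
      rw [hN₀]; exact contDiffAt_map_inverse _
    exact h1.contMDiffAt.comp p₀ hN
  have hNinv : ∀ᶠ p in 𝓝 p₀, ∀ x, N p (J p x) = x := by
    have h1 := (ContinuousLinearEquiv.nhds (ContinuousLinearEquiv.refl ℝ EX))
    rw [← hN₀] at h1
    filter_upwards [hN.continuousAt.preimage_mem_nhds h1] with p hp x
    obtain ⟨e, he⟩ := hp
    simp only [J, ← he, ContinuousLinearMap.inverse_equiv]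
    exact e.apply_symm_apply x
  refine ⟨fun p => (B p).comp (R₀.comp (J p)), fun w => ?_, ?_⟩
  · have e : (fun p => (B p).comp (R₀.comp (J p)) w) =
        fun p => ∑ i, ((fun q => R₀ (J q w) i) • s i) p := by
      funext p
      exact hB p _
    have h1 : ∀ i, ContMDiffAt 𝓘(ℝ, EP) 𝓘(ℝ, ℝ) ∞ (fun q => R₀ (J q w) i) p₀ := fun i =>
      contMDiffAt_pi_space.1 ((R₀.contDiff.contMDiff.contMDiffAt).comp p₀
        (hJ.clm_apply contMDiffAt_const)) i
    have h2 := ContMDiffAt.sum_section (s := Finset.univ) (fun i _ => (h1 i).smul_section (hs₀ i))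
    have e' : ∀ p, (B p).comp (R₀.comp (J p)) w = ∑ i, ((fun q => R₀ (J q w) i) • s i) p :=
      fun p => congrFun e p
    unfold SmoothFieldAt
    simp only [e']
    exact h2
  · have hbase : ∀ᶠ p in 𝓝 p₀, π p ∈ (triv EX (π p₀)).baseSet :=
      hπ.contMDiff.continuous.continuousAt.preimage_mem_nhds
        ((triv EX (π p₀)).open_baseSet.mem_nhds hb₀)
    filter_upwards [hNinv, hbase, U.isOpen.mem_nhds hU] with p hp hpb hpU w
    refine ⟨?_, ?_⟩
    · rw [← (hsC p hpU).2, Submodule.mem_span_range_iff_exists_fun]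
      exact ⟨_, (hB p _).symm⟩
    · rw [hT p hpb]
      exact hp w

end Lift


/-! ### The derivation of a transverse distribution -/

section DerivationOf

open ContinuousAlternatingMap

variable {EP EX P X : Type*}
  [NormedAddCommGroup EP] [NormedSpace ℝ EP]
  [NormedAddCommGroup EX] [NormedSpace ℝ EX] [FiniteDimensional ℝ EX]
  [TopologicalSpace P] [ChartedSpace EP P] [IsManifold 𝓘(ℝ, EP) ∞ P]
  [TopologicalSpace X] [ChartedSpace EX X] [IsManifold 𝓘(ℝ, EX) ∞ X]
  {π : P → X} {F C : ∀ p : P, Submodule ℝ (TangentSpace 𝓘(ℝ, EP) p)}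

theorem mem_baseSet_triv (x : X) : x ∈ (triv EX x).baseSet :=
  FiberBundle.mem_baseSet_trivializationAt' x

theorem FlatForm.contMDiffAt_inFrame (hπ : IsSmoothSubmersion EP EX π) {k : ℕ} {U : Opens P}
    (α : FlatForm (EX := EX) π F k U) {p₀ p : P} (hp : p ∈ U)
    (h₀ : π p ∈ (triv EX (π p₀)).baseSet) :
    ContMDiffAt 𝓘(ℝ, EP) 𝓘(ℝ, EX [⋀^Fin k]→L[ℝ] ℝ) ∞ (inFrame p₀ (zeroExtend α.1)) p :=
  Pfaffian.contMDiffAt_inFrame hπ.contMDiff.contMDiffAt h₀ (mem_baseSet_triv (π p)) (α.2.1 p hp)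

theorem FlatForm.mvfderiv_inFrame (hπ : IsSmoothSubmersion EP EX π)
    (hF : ∀ p, F p ≤ vertical EP EX π p) {k : ℕ} {U : Opens P}
    (α : FlatForm (EX := EX) π F k U) {p₀ p : P} (hp : p ∈ U)
    (h₀ : π p ∈ (triv EX (π p₀)).baseSet) {v : TangentSpace 𝓘(ℝ, EP) p} (hv : v ∈ F p) :
    mvfderiv 𝓘(ℝ, EP) (inFrame p₀ (zeroExtend α.1)) p v = 0 :=
  mvfderiv_inFrame_eq_zero hπ.contMDiff.contMDiffAt h₀ (mem_baseSet_triv (π p)) (α.2.1 p hp)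
    (hF p hv) ((nablaBar_eq_zero_iff v _).1 (α.2.2 p hp v hv))

theorem extDerivAt_toFormOnTotal (hπ : IsSmoothSubmersion EP EX π) {k : ℕ} {U : Opens P}
    (α : FlatForm (EX := EX) π F k U) {p₀ p : P} (hp : p ∈ U)
    (h₀ : π p ∈ (triv EX (π p₀)).baseSet) (v : Fin (k + 1) → TangentSpace 𝓘(ℝ, EP) p) :
    extDerivAt (toFormOnTotal α.1) p v =
      ∑ i : Fin (k + 1), (-1) ^ (i : ℕ) * mvfderiv 𝓘(ℝ, EP) (inFrame p₀ (zeroExtend α.1)) p (v i)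
        (i.removeNth fun j => (triv EX (π p₀)).continuousLinearMapAt ℝ (π p)
          (mfderiv 𝓘(ℝ, EP) 𝓘(ℝ, EX) π p (v j))) :=
  extDerivAt_comp_mfderiv (zeroExtend α.1) hπ.contMDiff h₀
    ((FlatForm.contMDiffAt_inFrame hπ α hp h₀).mdifferentiableAt (by simp)) v

/-- `d(α ∘ Tπ)` only depends on its arguments modulo `F`. -/
theorem extDerivAt_toFormOnTotal_congr (hπ : IsSmoothSubmersion EP EX π)
    (hF : ∀ p, F p ≤ vertical EP EX π p) {k : ℕ} {U : Opens P}
    (α : FlatForm (EX := EX) π F k U) {p : P} (hp : p ∈ U)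
    {v v' : Fin (k + 1) → TangentSpace 𝓘(ℝ, EP) p} (h : ∀ i, v i - v' i ∈ F p) :
    extDerivAt (toFormOnTotal α.1) p v = extDerivAt (toFormOnTotal α.1) p v' := by
  have hb := mem_baseSet_triv (EX := EX) (π p)
  have h1 : ∀ i, mfderiv 𝓘(ℝ, EP) 𝓘(ℝ, EX) π p (v i) = mfderiv 𝓘(ℝ, EP) 𝓘(ℝ, EX) π p (v' i) :=
    fun i => by
      have h2 : mfderiv 𝓘(ℝ, EP) 𝓘(ℝ, EX) π p (v i - v' i) = 0 := hF p (h i)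
      rwa [map_sub, sub_eq_zero] at h2
  have h3 : ∀ i, mvfderiv 𝓘(ℝ, EP) (inFrame p (zeroExtend α.1)) p (v i) =
      mvfderiv 𝓘(ℝ, EP) (inFrame p (zeroExtend α.1)) p (v' i) := fun i => by
    have h2 := FlatForm.mvfderiv_inFrame hπ hF α hp hb (h i)
    rwa [map_sub, sub_eq_zero] at h2
  rw [extDerivAt_toFormOnTotal hπ α hp hb, extDerivAt_toFormOnTotal hπ α hp hb]
  simp only [h1, h3]

/-- A right inverse of `T_pπ` with values in `C_p`. -/
def liftAt (hπ : IsSmoothSubmersion EP EX π) (hC : ∀ p, C p ⊔ vertical EP EX π p = ⊤) (p : P) :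
    TangentSpace 𝓘(ℝ, EX) (π p) →L[ℝ] TangentSpace 𝓘(ℝ, EP) p :=
  (exists_lift (hπ.surjective p) (hC p)).choose

theorem liftAt_mem (hπ : IsSmoothSubmersion EP EX π) (hC : ∀ p, C p ⊔ vertical EP EX π p = ⊤)
    (p : P) (w : TangentSpace 𝓘(ℝ, EX) (π p)) : liftAt hπ hC p w ∈ C p :=
  (exists_lift (hπ.surjective p) (hC p)).choose_spec.1 w

theorem mfderiv_liftAt (hπ : IsSmoothSubmersion EP EX π) (hC : ∀ p, C p ⊔ vertical EP EX π p = ⊤)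
    (p : P) (w : TangentSpace 𝓘(ℝ, EX) (π p)) :
    mfderiv 𝓘(ℝ, EP) 𝓘(ℝ, EX) π p (liftAt hπ hC p w) = w :=
  (exists_lift (hπ.surjective p) (hC p)).choose_spec.2 w

/-- The value `d(α ∘ Tπ)|_C` of the derivation associated with `C`. -/
def derivAt (hπ : IsSmoothSubmersion EP EX π) (hC : ∀ p, C p ⊔ vertical EP EX π p = ⊤) {k : ℕ}
    {U : Opens P} (α : FlatForm (EX := EX) π F k U) (p : U) : Alt EX π (k + 1) p :=
  (extDerivAt (toFormOnTotal (EP := EP) α.1) (p : P)).compContinuousLinearMap (liftAt hπ hC p)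

/-- The chosen lift of `Tπ (v i)` and `v i` itself lie in `C` and have the same projection. They
differ by an element of `C ∩ ker Tπ = F`, which `d(α ∘ Tπ)` ignores. -/
theorem derivAt_mfderiv (hπ : IsSmoothSubmersion EP EX π)
    (hC : ∀ p, C p ⊔ vertical EP EX π p = ⊤) (hCF : ∀ p, C p ⊓ vertical EP EX π p = F p)
    {k : ℕ} {U : Opens P} (α : FlatForm (EX := EX) π F k U) (p : U)
    {v : Fin (k + 1) → TangentSpace 𝓘(ℝ, EP) (p : P)} (hv : ∀ i, v i ∈ C p) :
    derivAt hπ hC α p (fun i => mfderiv 𝓘(ℝ, EP) 𝓘(ℝ, EX) π p (v i)) =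
      extDerivAt (toFormOnTotal α.1) (p : P) v := by
  refine extDerivAt_toFormOnTotal_congr hπ (fun q => hCF q ▸ inf_le_right) α p.2 fun i => ?_
  rw [← hCF]
  refine ⟨Submodule.sub_mem _ (liftAt_mem hπ hC _ _) (hv i), ?_⟩
  change mfderiv 𝓘(ℝ, EP) 𝓘(ℝ, EX) π p (liftAt hπ hC p _ - v i) = 0
  rw [map_sub, mfderiv_liftAt, sub_self]

/-- Coefficients of the derivation of `C` in a pulled-back frame. -/
theorem inFrame_derivAt (hπ : IsSmoothSubmersion EP EX π)
    (hC : ∀ p, C p ⊔ vertical EP EX π p = ⊤) (hCF : ∀ p, C p ⊓ vertical EP EX π p = F p)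
    {k : ℕ} {U : Opens P} (α : FlatForm (EX := EX) π F k U) {p₀ p : P} (hp : p ∈ U)
    (h₀ : π p ∈ (triv EX (π p₀)).baseSet) (S : EX →L[ℝ] TangentSpace 𝓘(ℝ, EP) p)
    (hS : ∀ w, S w ∈ C p) (hS' : ∀ w, (triv EX (π p₀)).continuousLinearMapAt ℝ (π p)
        (mfderiv 𝓘(ℝ, EP) 𝓘(ℝ, EX) π p (S w)) = w) :
    inFrame p₀ (zeroExtend (derivAt hπ hC α)) p = alternatizeUncurryFin
      ((mvfderiv 𝓘(ℝ, EP) (inFrame p₀ (zeroExtend α.1)) p).comp S) := by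
  ext w
  have e : ∀ x : EX, (triv EX (π p₀)).symmL ℝ (π p) x =
      mfderiv 𝓘(ℝ, EP) 𝓘(ℝ, EX) π p (S x) := fun x => by
    rw [← Bundle.Trivialization.symmL_continuousLinearMapAt (R := ℝ) (triv EX (π p₀)) h₀
      (mfderiv 𝓘(ℝ, EP) 𝓘(ℝ, EX) π p (S x)), hS']
  rw [inFrame, zeroExtend_of_mem _ hp]
  refine (congrArg (derivAt hπ hC α ⟨p, hp⟩) (funext fun i => e (w i))).trans ?_
  rw [derivAt_mfderiv hπ hC hCF α ⟨p, hp⟩ (v := fun i => S (w i)) (fun i => hS (w i)),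
    extDerivAt_toFormOnTotal hπ α hp h₀, alternatizeUncurryFin_apply]
  refine Finset.sum_congr rfl fun i _ => ?_
  rw [zsmul_eq_mul]
  push_cast
  simp only [hS']
  rfl

theorem inFrame_derivAt_self (hπ : IsSmoothSubmersion EP EX π)
    (hC : ∀ p, C p ⊔ vertical EP EX π p = ⊤) (hCF : ∀ p, C p ⊓ vertical EP EX π p = F p)
    {k : ℕ} {U : Opens P} (α : FlatForm (EX := EX) π F k U) {p : P} (hp : p ∈ U) :
    inFrame p (zeroExtend (derivAt hπ hC α)) p = alternatizeUncurryFin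
      ((mvfderiv 𝓘(ℝ, EP) (inFrame p (zeroExtend α.1)) p).comp
        ((liftAt hπ hC p).comp ((triv EX (π p)).symmL ℝ (π p)))) :=
  inFrame_derivAt hπ hC hCF α hp (mem_baseSet_triv (π p)) _ (fun _ => liftAt_mem hπ hC _ _)
    fun w => by
      rw [ContinuousLinearMap.comp_apply, mfderiv_liftAt,
        Bundle.Trivialization.continuousLinearMapAt_symmL _ (mem_baseSet_triv (π p))]

/-- The pointwise choice `liftAt` carries no smoothness in `p`. As the value does not depend on the
lift, a smooth lift may be substituted near each point. -/
theorem derivAt_smoothAt (hπ : IsSmoothSubmersion EP EX π) (hCs : IsSmoothDistribution C)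
    (hC : ∀ p, C p ⊔ vertical EP EX π p = ⊤) (hCF : ∀ p, C p ⊓ vertical EP EX π p = F p)
    {k : ℕ} {U : Opens P} (α : FlatForm (EX := EX) π F k U) {p : P} (hp : p ∈ U) :
    SmoothAt EP (zeroExtend (derivAt hπ hC α)) p := by
  obtain ⟨S, hS, hS'⟩ := exists_smooth_lift hπ hCs hC p
  have hbase : ∀ᶠ q in 𝓝 p, π q ∈ (triv EX (π p)).baseSet :=
    hπ.contMDiff.continuous.continuousAt.preimage_mem_nhds
      ((triv EX (π p)).open_baseSet.mem_nhds (mem_baseSet_triv (π p)))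
  have e : inFrame p (zeroExtend (derivAt hπ hC α)) =ᶠ[𝓝 p] fun q =>
      alternatizeUncurryFinCLM ℝ EX ℝ
        ((mvfderiv 𝓘(ℝ, EP) (inFrame p (zeroExtend α.1)) q).comp (S q)) := by
    filter_upwards [hS', hbase, U.isOpen.mem_nhds hp] with q hq hqb hqU
    exact inFrame_derivAt hπ hC hCF α hqU hqb (S q) (fun w => (hq w).1) (fun w => (hq w).2)
  refine ContMDiffAt.congr_of_eventuallyEq ?_ e
  have hL : ContDiff ℝ ∞ (alternatizeUncurryFinCLM ℝ EX ℝ (n := k)) :=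
    ContinuousLinearMap.contDiff (𝕜 := ℝ) (E := EX →L[ℝ] EX [⋀^Fin k]→L[ℝ] ℝ)
      (F := EX [⋀^Fin (k + 1)]→L[ℝ] ℝ) _
  refine hL.contMDiff.contMDiffAt.comp p ?_
  refine contMDiffAt_clm_of_apply fun w => ?_
  exact contMDiffAt_mvfderiv_apply (α.2.1 p hp) (hS w)

theorem ext_inFrame {k : ℕ} {p : P} {a b : ∀ p, Alt EX π k p}
    (h : inFrame p a p = inFrame p b p) : a p = b p := by
  rw [← comp_continuousLinearMapAt_inFrame (P := P) a (mem_baseSet_triv (π p)), h,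
    comp_continuousLinearMapAt_inFrame b (mem_baseSet_triv (π p))]

theorem derivAt_add (hπ : IsSmoothSubmersion EP EX π)
    (hC : ∀ p, C p ⊔ vertical EP EX π p = ⊤) (hCF : ∀ p, C p ⊓ vertical EP EX π p = F p)
    {k : ℕ} {U : Opens P} (α β : FlatForm (EX := EX) π F k U) :
    derivAt hπ hC (α + β) = derivAt hπ hC α + derivAt hπ hC β := by
  funext p
  have h : zeroExtend (derivAt hπ hC (α + β)) (p : P) =
      (zeroExtend (derivAt hπ hC α) + zeroExtend (derivAt hπ hC β)) (p : P) := by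
    refine ext_inFrame ?_
    rw [inFrame_add, Pi.add_apply, inFrame_derivAt_self hπ hC hCF _ p.2,
      inFrame_derivAt_self hπ hC hCF _ p.2, inFrame_derivAt_self hπ hC hCF _ p.2,
      ← alternatizeUncurryFin_add, Submodule.coe_add, zeroExtend_add, inFrame_add,
      mvfderiv_add ((α.2.1 p p.2).mdifferentiableAt (by simp))
        ((β.2.1 p p.2).mdifferentiableAt (by simp))]
    rfl
  simpa only [Pi.add_apply, zeroExtend_of_mem _ p.2] using h

theorem derivAt_smul (hπ : IsSmoothSubmersion EP EX π)
    (hC : ∀ p, C p ⊔ vertical EP EX π p = ⊤) (hCF : ∀ p, C p ⊓ vertical EP EX π p = F p)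
    {k : ℕ} {U : Opens P} (c : ℝ) (α : FlatForm (EX := EX) π F k U) :
    derivAt hπ hC (c • α) = c • derivAt hπ hC α := by
  funext p
  have h : zeroExtend (derivAt hπ hC (c • α)) (p : P) =
      (c • zeroExtend (derivAt hπ hC α)) (p : P) := by
    refine ext_inFrame ?_
    have h2 : mvfderiv 𝓘(ℝ, EP) (c • inFrame (p : P) (zeroExtend α.1)) p =
        c • mvfderiv 𝓘(ℝ, EP) (inFrame (p : P) (zeroExtend α.1)) p :=
      const_smul_mfderiv ((α.2.1 p p.2).mdifferentiableAt (by simp)) c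
    rw [inFrame_smul, Pi.smul_apply, inFrame_derivAt_self hπ hC hCF _ p.2,
      inFrame_derivAt_self hπ hC hCF _ p.2, ← alternatizeUncurryFin_smul, Submodule.coe_smul,
      zeroExtend_smul, inFrame_smul, h2]
    rfl
  simpa only [Pi.smul_apply, zeroExtend_of_mem _ p.2] using h

theorem derivAt_res (hπ : IsSmoothSubmersion EP EX π)
    (hC : ∀ p, C p ⊔ vertical EP EX π p = ⊤) (hCF : ∀ p, C p ⊓ vertical EP EX π p = F p)
    {k : ℕ} {U V : Opens P} (h : V ≤ U) (α : FlatForm (EX := EX) π F k U) (p : V) :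
    derivAt hπ hC (FlatForm.res h α) p = derivAt hπ hC α ⟨p.1, h p.2⟩ := by
  have h1 : zeroExtend (derivAt hπ hC (FlatForm.res h α)) (p : P) =
      zeroExtend (derivAt hπ hC α) (p : P) := by
    refine ext_inFrame ?_
    rw [inFrame_derivAt_self hπ hC hCF _ p.2, inFrame_derivAt_self hπ hC hCF _ (h p.2)]
    congr 2
    ext1 v
    exact mvfderiv_congr (inFrame_congr (zeroExtend_res_eventuallyEq h α.1 p.2)) v
  simpa only [zeroExtend_of_mem _ p.2, zeroExtend_of_mem _ (h p.2)] using h1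

/-- In the frame at `p` the derivation is the alternatization of the derivative of the coefficients.
The product rule splits that derivative into `a ∧ M x + L x ∧ b`, and the two alternatizations are
`sum_wedge_right` and `sum_wedge_left`. -/
theorem derivAt_wedge (hπ : IsSmoothSubmersion EP EX π)
    (hC : ∀ p, C p ⊔ vertical EP EX π p = ⊤) (hCF : ∀ p, C p ⊓ vertical EP EX π p = F p)
    {k l : ℕ} {U : Opens P} (α : FlatForm (EX := EX) π F k U) (β : FlatForm (EX := EX) π F l U)
    (p : U) (v : Fin (k + l + 1) → TangentSpace 𝓘(ℝ, EX) (π p)) :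
    derivAt hπ hC (FlatForm.wedge α β) p v =
      wedge (derivAt hπ hC α p) (β.1 p) (fun i => v (Fin.cast (Nat.add_right_comm k 1 l) i)) +
        (-1 : ℝ) ^ k * wedge (α.1 p) (derivAt hπ hC β p) v := by
  obtain ⟨p, hp⟩ := p
  have hb := mem_baseSet_triv (EX := EX) (π p)
  have key : ∀ {m : ℕ} (γ : ∀ q : U, Alt EX π m q), γ ⟨p, hp⟩ =
      (inFrame p (zeroExtend γ) p).compContinuousLinearMap
        ((triv EX (π p)).continuousLinearMapAt ℝ (π p)) := fun γ => by
    rw [comp_continuousLinearMapAt_inFrame _ hb, zeroExtend_of_mem _ hp]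
  let w : Fin (k + l + 1) → EX := fun i => (triv EX (π p)).continuousLinearMapAt ℝ (π p) (v i)
  let S : EX →L[ℝ] TangentSpace 𝓘(ℝ, EP) p :=
    (liftAt hπ hC p).comp ((triv EX (π p)).symmL ℝ (π p))
  let a := inFrame p (zeroExtend α.1)
  let b := inFrame p (zeroExtend β.1)
  have ha := (α.2.1 p hp).mdifferentiableAt (by simp)
  have hb' := (β.2.1 p hp).mdifferentiableAt (by simp)
  have hd : ∀ u : TangentSpace 𝓘(ℝ, EP) p,
      mvfderiv 𝓘(ℝ, EP) (inFrame p (zeroExtend (FlatForm.wedge α β).1)) p u =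
        wedge (a p) (mvfderiv 𝓘(ℝ, EP) b p u) + wedge (mvfderiv 𝓘(ℝ, EP) a p u) (b p) := by
    intro u
    refine (mvfderiv_congr (inFrame_zeroExtend_wedge p α.1 β.1 hp) u).trans ?_
    exact mvfderiv_bilin (isBoundedBilinearMap_wedge EX k l) ha hb' u
  have e1 : derivAt hπ hC (FlatForm.wedge α β) ⟨p, hp⟩ v =
      alternatizeUncurryFin ((mvfderiv 𝓘(ℝ, EP)
        (inFrame p (zeroExtend (FlatForm.wedge α β).1)) p).comp S) w := by
    rw [key (derivAt hπ hC (FlatForm.wedge α β)), inFrame_derivAt_self hπ hC hCF _ hp]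
    rfl
  have e2 : wedge (derivAt hπ hC α ⟨p, hp⟩) (β.1 ⟨p, hp⟩)
      (fun i => v (Fin.cast (Nat.add_right_comm k 1 l) i)) =
      wedge (alternatizeUncurryFin ((mvfderiv 𝓘(ℝ, EP) a p).comp S)) (b p)
        (fun i => w (Fin.cast (Nat.add_right_comm k 1 l) i)) := by
    rw [key (derivAt hπ hC α), key β.1, ← wedge_comp, inFrame_derivAt_self hπ hC hCF _ hp]
    rfl
  have e3 : wedge (α.1 ⟨p, hp⟩) (derivAt hπ hC β ⟨p, hp⟩) v =
      wedge (a p) (alternatizeUncurryFin ((mvfderiv 𝓘(ℝ, EP) b p).comp S)) w := by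
    rw [key (derivAt hπ hC β), key α.1, ← wedge_comp, inFrame_derivAt_self hπ hC hCF _ hp]
    rfl
  rw [e1, e2, e3, ← sum_wedge_left, ← sum_wedge_right, ← Finset.sum_add_distrib,
    alternatizeUncurryFin_apply]
  refine Finset.sum_congr rfl fun i _ => ?_
  rw [ContinuousLinearMap.comp_apply, hd, zsmul_eq_mul, ContinuousAlternatingMap.add_apply]
  push_cast
  rw [mul_add, add_comm]
  rfl

/-- The relative derivation `α ↦ d(α ∘ Tπ)|_C` of a smooth transverse distribution `C`. -/
def derivationOf (hπ : IsSmoothSubmersion EP EX π) (hCs : IsSmoothDistribution C)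
    (hC : ∀ p, C p ⊔ vertical EP EX π p = ⊤) (hCF : ∀ p, C p ⊓ vertical EP EX π p = F p) :
    RelDerivation EX π F where
  toFun _ _ :=
    { toFun := fun α => ⟨derivAt hπ hC α, fun _ hp => derivAt_smoothAt hπ hCs hC hCF α hp⟩
      map_add' := fun α β => Subtype.ext (derivAt_add hπ hC hCF α β)
      map_smul' := fun c α => Subtype.ext (derivAt_smul hπ hC hCF c α) }
  map_res _ _ h _ α := Subtype.ext (funext fun p => derivAt_res hπ hC hCF h α p)
  leibniz _ _ _ α β p v := derivAt_wedge hπ hC hCF α β p v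

/-- The pullback of forms commutes with the de Rham differential. -/
theorem extDerivAt_toFormOnTotal_pullback (hπ : IsSmoothSubmersion EP EX π)
    (hF : ∀ p, F p ≤ vertical EP EX π p) {V : Opens X} {k : ℕ} (α : Form EX EX (id : X → X) k V)
    {p : P} (hp : π p ∈ V) (v : Fin (k + 1) → TangentSpace 𝓘(ℝ, EP) p) :
    extDerivAt (toFormOnTotal (pullback hπ hF α).1) p v =
      extDerivAt (zeroExtend α.1) (π p) (fun i => mfderiv 𝓘(ℝ, EP) 𝓘(ℝ, EX) π p (v i)) := by
  have hb := mem_baseSet_triv (EX := EX) (π p)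
  have hα : MDifferentiableAt 𝓘(ℝ, EX) 𝓘(ℝ, EX [⋀^Fin k]→L[ℝ] ℝ)
      (inFrame (π := (id : X → X)) (π p) (zeroExtend α.1)) (π p) :=
    (α.2 (π p) hp).mdifferentiableAt (by simp)
  have e1 : (fun q : X => ((zeroExtend α.1 q : Alt EX (id : X → X) k q).compContinuousLinearMap
      (mfderiv 𝓘(ℝ, EX) 𝓘(ℝ, EX) (id : X → X) q) : Alt EX (id : X → X) k q)) =
      zeroExtend α.1 := by
    funext q
    rw [mfderiv_id]
    rfl
  -- The frame formula is applied on `X` as well, to the identity map, so that both sides become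
  -- alternating sums of the same shape.
  have h1 := extDerivAt_comp_mfderiv (π := (id : X → X)) (p₀ := π p) (p := π p)
    (zeroExtend α.1) contMDiff_id hb hα (fun i => mfderiv 𝓘(ℝ, EP) 𝓘(ℝ, EX) π p (v i))
  have e2 := congrArg (fun η => extDerivAt (E := EX) (M := X) η (π p)
    (fun i => mfderiv 𝓘(ℝ, EP) 𝓘(ℝ, EX) π p (v i))) e1
  refine Eq.trans ?_ (h1.symm.trans e2)
  rw [extDerivAt_toFormOnTotal hπ (pullback hπ hF α) hp hb]
  refine Finset.sum_congr rfl fun i _ => ?_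
  have e3 : mvfderiv 𝓘(ℝ, EP) (inFrame p (zeroExtend (pullback hπ hF α).1)) p (v i) =
      mvfderiv 𝓘(ℝ, EX) (inFrame (π := (id : X → X)) (π p) (zeroExtend α.1)) (π p)
        (mfderiv 𝓘(ℝ, EP) 𝓘(ℝ, EX) π p (v i)) :=
    mvfderiv_comp_vec_apply (f := π) hα
      (hπ.contMDiff.contMDiffAt.mdifferentiableAt (by simp)) (v i)
  rw [e3]
  simp only [mfderiv_id]
  rfl

theorem derivationOf_extendsDeRham (hπ : IsSmoothSubmersion EP EX π)
    (hF : ∀ p, F p ≤ vertical EP EX π p) (hCs : IsSmoothDistribution C)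
    (hC : ∀ p, C p ⊔ vertical EP EX π p = ⊤) (hCF : ∀ p, C p ⊓ vertical EP EX π p = F p) :
    ExtendsDeRham hπ hF (derivationOf hπ hCs hC hCF) := by
  rintro V k α ⟨p, hp⟩
  ext w
  refine (extDerivAt_toFormOnTotal_pullback hπ hF α hp fun i => liftAt hπ hC p (w i)).trans ?_
  simp only [mfderiv_liftAt]

end DerivationOf


/-! ### Hadamard's lemma -/

section Hadamard

universe u

variable {E : Type u} [NormedAddCommGroup E] [NormedSpace ℝ E] [FiniteDimensional ℝ E]

/-- Differentiation under the integral sign; since `t` lies in `[0, 1]`, a bound for the derivative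
of `G` on the closed ball of radius `‖z₀‖ + 1` dominates for `z` in the unit ball around `z₀`. The
weight `t ^ j` makes the family stable under differentiation, as each derivative produces one factor
`t`. -/
theorem hasFDerivAt_integral_pow_smul_comp_smul {A : Type u} [NormedAddCommGroup A]
    [NormedSpace ℝ A] {G : E → A} (hG : ContDiff ℝ ∞ G) (j : ℕ) (z₀ : E) :
    HasFDerivAt (fun z => ∫ t in (0 : ℝ)..1, t ^ j • G (t • z))
      (∫ t in (0 : ℝ)..1, t ^ (j + 1) • fderiv ℝ G (t • z₀)) z₀ := by
  have hcont : Continuous (fderiv ℝ G) := hG.continuous_fderiv (by simp)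
  obtain ⟨M, hM⟩ := (isCompact_closedBall (0 : E) (‖z₀‖ + 1)).exists_bound_of_continuousOn
    hcont.continuousOn
  refine intervalIntegral.hasFDerivAt_integral_of_dominated_of_fderiv_le
    (F := fun z t => t ^ j • G (t • z)) (F' := fun z t => t ^ (j + 1) • fderiv ℝ G (t • z))
    (s := Metric.ball z₀ 1) (bound := fun _ => M) (Metric.ball_mem_nhds z₀ one_pos) ?_ ?_ ?_ ?_ ?_ ?_
  · have hc := hG.continuous
    exact Eventually.of_forall fun z =>
      (by fun_prop : Continuous fun t : ℝ => t ^ j • G (t • z)).aestronglyMeasurable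
  · have hc := hG.continuous
    exact (by fun_prop : Continuous fun t : ℝ => t ^ j • G (t • z₀)).intervalIntegrable _ _
  · exact (by fun_prop :
      Continuous fun t : ℝ => t ^ (j + 1) • fderiv ℝ G (t • z₀)).aestronglyMeasurable
  · refine Eventually.of_forall fun t ht z hz => ?_
    rw [uIoc_of_le zero_le_one] at ht
    have h1 : t • z ∈ Metric.closedBall (0 : E) (‖z₀‖ + 1) := by
      rw [mem_closedBall_zero_iff, norm_smul, Real.norm_of_nonneg ht.1.le]
      have h2 : ‖z‖ ≤ ‖z₀‖ + 1 := by
        have h3 : ‖z - z₀‖ < 1 := by rwa [← dist_eq_norm]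
        have h4 := norm_add_le z₀ (z - z₀)
        rw [add_sub_cancel] at h4
        linarith
      calc t * ‖z‖ ≤ 1 * ‖z‖ := mul_le_mul_of_nonneg_right ht.2 (norm_nonneg z)
        _ ≤ _ := by rw [one_mul]; exact h2
    rw [norm_smul]
    have h2 : ‖t ^ (j + 1)‖ ≤ 1 := by
      rw [Real.norm_of_nonneg (pow_nonneg ht.1.le _)]
      exact pow_le_one₀ ht.1.le ht.2
    calc ‖t ^ (j + 1)‖ * ‖fderiv ℝ G (t • z)‖ ≤ 1 * ‖fderiv ℝ G (t • z)‖ :=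
          mul_le_mul_of_nonneg_right h2 (norm_nonneg _)
      _ ≤ M := by rw [one_mul]; exact hM _ h1
  · exact intervalIntegrable_const
  · refine Eventually.of_forall fun t _ z _ => ?_
    have h1 : HasFDerivAt (fun z : E => t • z) (t • ContinuousLinearMap.id ℝ E) z :=
      (hasFDerivAt_id z).const_smul t
    have h2 := ((hG.differentiable (by simp) (t • z)).hasFDerivAt.comp z h1).const_smul (t ^ j)
    refine h2.congr_fderiv ?_
    ext x
    simp [pow_succ, smul_smul]

/-- Induction on `n` over all targets and exponents at once: the derivative is an integral of the
same kind with values in `E →L[ℝ] A` and exponent `j + 1`. For this `A` has to live in the universe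
of `E`. -/
theorem contDiff_integral_pow_smul_comp_smul (n : ℕ) : ∀ {A : Type u} [NormedAddCommGroup A]
    [NormedSpace ℝ A] {G : E → A} (_ : ContDiff ℝ ∞ G) (j : ℕ),
    ContDiff ℝ n (fun z => ∫ t in (0 : ℝ)..1, t ^ j • G (t • z)) := by
  induction n with
  | zero =>
    intro A _ _ G hG j
    refine contDiff_zero.2 ?_
    have hc := hG.continuous
    exact intervalIntegral.continuous_parametric_intervalIntegral_of_continuous'
      (by fun_prop) _ _
  | succ n ih =>
    intro A _ _ G hG j
    have h : ContDiff ℝ ((n : WithTop ℕ∞) + 1)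
        (fun z => ∫ t in (0 : ℝ)..1, t ^ j • G (t • z)) := by
      rw [contDiff_succ_iff_fderiv]
      refine ⟨fun z => (hasFDerivAt_integral_pow_smul_comp_smul hG j z).differentiableAt,
        fun h => by simp at h, ?_⟩
      have e : fderiv ℝ (fun z => ∫ t in (0 : ℝ)..1, t ^ j • G (t • z)) = fun z =>
          ∫ t in (0 : ℝ)..1, t ^ (j + 1) • fderiv ℝ G (t • z) :=
        funext fun z => (hasFDerivAt_integral_pow_smul_comp_smul hG j z).fderiv
      rw [e]
      exact ih (hG.fderiv_right (by simp)) (j + 1)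
    exact_mod_cast h

/-- Hadamard's lemma. -/
theorem exists_smooth_sub_eq_apply {h : E → ℝ} (hh : ContDiff ℝ ∞ h) :
    ∃ g : E → E →L[ℝ] ℝ, ContDiff ℝ ∞ g ∧ g 0 = fderiv ℝ h 0 ∧ ∀ z, h z - h 0 = g z z := by
  have hc : Continuous (fderiv ℝ h) := hh.continuous_fderiv (by simp)
  refine ⟨fun z => ∫ t in (0 : ℝ)..1, fderiv ℝ h (t • z), ?_, by simp, fun z => ?_⟩
  · rw [contDiff_infty]
    intro n
    have hf : ContDiff ℝ ∞ (fderiv ℝ h) := hh.fderiv_right (by simp)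
    simpa using contDiff_integral_pow_smul_comp_smul n hf 0
  · have h1 : ∀ t : ℝ, HasDerivAt (fun t : ℝ => h (t • z)) (fderiv ℝ h (t • z) z) t := fun t => by
      have h2 : HasDerivAt (fun t : ℝ => t • z) z t := by
        simpa using (hasDerivAt_id t).smul_const z
      exact (hh.differentiable (by simp) (t • z)).hasFDerivAt.comp_hasDerivAt t h2
    have h3 := intervalIntegral.integral_eq_sub_of_hasDerivAt (a := 0) (b := 1)
      (fun t _ => h1 t) ((by fun_prop :
        Continuous fun t : ℝ => fderiv ℝ h (t • z) z).intervalIntegrable _ _)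
    rw [ContinuousLinearMap.intervalIntegral_apply ((by fun_prop :
        Continuous fun t : ℝ => fderiv ℝ h (t • z)).intervalIntegrable _ _), h3]
    simp

end Hadamard


/-! ### Flat functions -/

section FlatFunctions

variable {EP EX P X : Type*}
  [NormedAddCommGroup EP] [NormedSpace ℝ EP]
  [NormedAddCommGroup EX] [NormedSpace ℝ EX] [FiniteDimensional ℝ EX]
  [TopologicalSpace P] [ChartedSpace EP P] [IsManifold 𝓘(ℝ, EP) ∞ P]
  [TopologicalSpace X] [ChartedSpace EX X] [IsManifold 𝓘(ℝ, EX) ∞ X]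
  {π : P → X} {F C : ∀ p : P, Submodule ℝ (TangentSpace 𝓘(ℝ, EP) p)}

/-- `f` is smooth on `U` and constant along `F`. -/
def IsFlatFun (F : ∀ p : P, Submodule ℝ (TangentSpace 𝓘(ℝ, EP) p)) (U : Opens P) (f : P → ℝ) :
    Prop :=
  ∀ p ∈ U, ContMDiffAt 𝓘(ℝ, EP) 𝓘(ℝ, ℝ) ∞ f p ∧ ∀ v ∈ F p, mvfderiv 𝓘(ℝ, EP) f p v = 0

theorem isFlatFun_const (U : Opens P) (c : ℝ) : IsFlatFun F U fun _ => c :=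
  fun p _ => ⟨contMDiffAt_const, fun v _ => by rw [mvfderiv_const]; rfl⟩

theorem IsFlatFun.mul {U : Opens P} {f g : P → ℝ} (hf : IsFlatFun F U f) (hg : IsFlatFun F U g) :
    IsFlatFun F U fun q => f q * g q := fun p hp => by
  refine ⟨(hf p hp).1.mul (hg p hp).1, fun v hv => ?_⟩
  have h := mvfderiv_bilin (b := fun x : ℝ × ℝ => x.1 * x.2) isBoundedBilinearMap_mul
    ((hf p hp).1.mdifferentiableAt (by simp)) ((hg p hp).1.mdifferentiableAt (by simp)) v
  rw [(hf p hp).2 v hv, (hg p hp).2 v hv] at h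
  simpa using h

theorem inFrame_constOfIsEmpty {U : Opens P} (f : P → ℝ) {p : P} (hp : p ∈ U) :
    inFrame p (zeroExtend (U := U) fun q => (ContinuousAlternatingMap.constOfIsEmpty ℝ
      (TangentSpace 𝓘(ℝ, EX) (π q)) (Fin 0) (f q) : Alt EX π 0 q)) =ᶠ[𝓝 p]
      fun q => ContinuousAlternatingMap.constOfIsEmptyLIE ℝ EX ℝ (Fin 0) (f q) := by
  filter_upwards [U.isOpen.mem_nhds hp] with q hq
  rw [inFrame, zeroExtend_of_mem _ (show q ∈ U from hq)]
  rfl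

/-- A flat function as a flat `0`-form. -/
def funForm (π : P → X) {U : Opens P} {f : P → ℝ} (h : IsFlatFun F U f) :
    FlatForm (EX := EX) π F 0 U :=
  ⟨fun q => (ContinuousAlternatingMap.constOfIsEmpty ℝ
      (TangentSpace 𝓘(ℝ, EX) (π q)) (Fin 0) (f q) : Alt EX π 0 q), fun p hp => by
    refine ContMDiffAt.congr_of_eventuallyEq ?_ (inFrame_constOfIsEmpty f hp)
    exact ((ContinuousAlternatingMap.constOfIsEmptyLIE ℝ EX ℝ (Fin 0)).contDiff.contMDiff.contMDiffAt
      ).comp p (h p hp).1, fun p hp v hv => by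
    rw [nablaBar_eq_zero_iff, mvfderiv_congr (inFrame_constOfIsEmpty f hp)]
    have h1 := mvfderiv_comp_vec_apply (f := f)
      (g := ContinuousAlternatingMap.constOfIsEmptyLIE ℝ EX ℝ (Fin 0)) (p := p)
      ((ContinuousAlternatingMap.constOfIsEmptyLIE ℝ EX ℝ
        (Fin 0)).contDiff.contMDiff.contMDiffAt.mdifferentiableAt (n := ∞) (by simp))
      ((h p hp).1.mdifferentiableAt (by simp)) v
    refine h1.trans ?_
    have h2 : mfderiv 𝓘(ℝ, EP) 𝓘(ℝ, ℝ) f p v = 0 := (h p hp).2 v hv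
    rw [h2, map_zero]⟩

/-- The function underlying a `0`-form. -/
def formFun {U : Opens P} (f : FlatForm (EX := EX) π F 0 U) (q : P) : ℝ :=
  zeroExtend f.1 q Fin.elim0

theorem mvfderiv_inFrame_apply {k : ℕ} {p₀ p : P} {β : ∀ p, Alt EX π k p}
    (h : MDifferentiableAt 𝓘(ℝ, EP) 𝓘(ℝ, EX [⋀^Fin k]→L[ℝ] ℝ) (inFrame p₀ β) p)
    (v : TangentSpace 𝓘(ℝ, EP) p) (u : Fin k → EX) :
    mvfderiv 𝓘(ℝ, EP) (inFrame p₀ β) p v u =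
      mvfderiv 𝓘(ℝ, EP) (fun q => inFrame p₀ β q u) p v := by
  have hL : ContDiff ℝ ∞ (ContinuousAlternatingMap.apply ℝ EX ℝ u) :=
    ContinuousLinearMap.contDiff (𝕜 := ℝ) (E := EX [⋀^Fin k]→L[ℝ] ℝ) (F := ℝ) _
  have h1 := mvfderiv_comp_vec_apply (f := inFrame p₀ β)
    (g := ContinuousAlternatingMap.apply ℝ EX ℝ u) (p := p)
    (hL.contMDiff.contMDiffAt.mdifferentiableAt (by simp)) h v
  refine Eq.trans ?_ h1.symm
  have h2 : mvfderiv 𝓘(ℝ, EX [⋀^Fin k]→L[ℝ] ℝ) (ContinuousAlternatingMap.apply ℝ EX ℝ u)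
      (inFrame p₀ β p) = ContinuousAlternatingMap.apply ℝ EX ℝ u :=
    mfderiv_eq_fderiv.trans (ContinuousLinearMap.fderiv (𝕜 := ℝ) (E := EX [⋀^Fin k]→L[ℝ] ℝ)
      (F := ℝ) _)
  rw [h2]
  rfl

theorem formFun_eq {U : Opens P} (f : FlatForm (EX := EX) π F 0 U) (p₀ : P) (u : Fin 0 → EX) :
    (fun q => inFrame p₀ (zeroExtend f.1) q u) = formFun f := by
  funext q
  exact congrArg (zeroExtend f.1 q) (funext fun i => i.elim0)

theorem isFlatFun_formFun {U : Opens P} (f : FlatForm (EX := EX) π F 0 U) :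
    IsFlatFun F U (formFun f) := by
  intro p hp
  have h : ContMDiffAt 𝓘(ℝ, EP) 𝓘(ℝ, EX [⋀^Fin 0]→L[ℝ] ℝ) ∞ (inFrame p (zeroExtend f.1)) p :=
    f.2.1 p hp
  rw [← formFun_eq f p Fin.elim0]
  have hL : ContDiff ℝ ∞ (ContinuousAlternatingMap.apply ℝ EX ℝ (Fin.elim0 : Fin 0 → EX)) :=
    ContinuousLinearMap.contDiff (𝕜 := ℝ) (E := EX [⋀^Fin 0]→L[ℝ] ℝ) (F := ℝ) _
  refine ⟨hL.contMDiff.contMDiffAt.comp p h, fun v hv => ?_⟩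
  rw [← mvfderiv_inFrame_apply (h.mdifferentiableAt (by simp)),
    (nablaBar_eq_zero_iff v _).1 (f.2.2 p hp v hv)]
  rfl

theorem funForm_formFun {U : Opens P} (f : FlatForm (EX := EX) π F 0 U) :
    funForm π (isFlatFun_formFun f) = f := by
  refine Subtype.ext (funext fun q => ?_)
  ext u
  change formFun f q = f.1 q u
  rw [formFun, zeroExtend_of_mem _ q.2]
  exact congrArg (f.1 q) (funext fun i => i.elim0)

/-- Only the germs on `U` agree, because `formFun` vanishes outside `U` whereas `f` is arbitrary
there. -/
theorem formFun_funForm {U : Opens P} {f : P → ℝ} (h : IsFlatFun F U f) {p : P} (hp : p ∈ U) :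
    formFun (funForm (EX := EX) π h) =ᶠ[𝓝 p] f := by
  filter_upwards [U.isOpen.mem_nhds hp] with q hq
  rw [formFun, zeroExtend_of_mem _ (show q ∈ U from hq)]
  rfl

theorem extDerivAt_toFormOnTotal_zero (hπ : IsSmoothSubmersion EP EX π) {U : Opens P}
    (f : FlatForm (EX := EX) π F 0 U) {p : P} (hp : p ∈ U) (v : TangentSpace 𝓘(ℝ, EP) p) :
    extDerivAt (toFormOnTotal f.1) p (fun _ => v) = mvfderiv 𝓘(ℝ, EP) (formFun f) p v := by
  rw [extDerivAt_toFormOnTotal hπ f hp (mem_baseSet_triv (π p)), Fin.sum_univ_succ]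
  rw [mvfderiv_inFrame_apply ((f.2.1 p hp).mdifferentiableAt (by simp)), formFun_eq]
  simp

/-! ### Locality -/

/-- Compatibility with restrictions makes `D` local: both forms have the same restriction to a
neighbourhood of `p`. Hence functions may be modified away from `p`, and defined on different open
sets. -/
theorem RelDerivation.toFun_congr (D : RelDerivation EX π F) {k : ℕ} {U U' : Opens P}
    {f : FlatForm (EX := EX) π F k U} {f' : FlatForm (EX := EX) π F k U'} {p : P}
    (hp : p ∈ U) (hp' : p ∈ U') (h : ∀ᶠ q in 𝓝 p, zeroExtend f.1 q = zeroExtend f'.1 q) :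
    (D.toFun U k f).1 ⟨p, hp⟩ = (D.toFun U' k f').1 ⟨p, hp'⟩ := by
  obtain ⟨s, hs, hso, hps⟩ := eventually_nhds_iff.1 h
  let W : Opens P := ⟨s, hso⟩ ⊓ (U ⊓ U')
  have hpW : p ∈ W := ⟨hps, hp, hp'⟩
  have hWU : W ≤ U := fun q hq => hq.2.1
  have hWU' : W ≤ U' := fun q hq => hq.2.2
  have e : FlatForm.res hWU f = FlatForm.res hWU' f' := by
    refine Subtype.ext (funext fun q => ?_)
    have := hs q q.2.1
    rwa [zeroExtend_of_mem _ (hWU q.2), zeroExtend_of_mem _ (hWU' q.2)] at this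
  have h1 := congrArg (fun β : Form EP EX π (k + 1) W => β.1 ⟨p, hpW⟩) (D.map_res U W hWU k f)
  have h2 := congrArg (fun β : Form EP EX π (k + 1) W => β.1 ⟨p, hpW⟩) (D.map_res U' W hWU' k f')
  rw [e] at h1
  exact h1.symm.trans h2

theorem RelDerivation.funForm_congr (D : RelDerivation EX π F) {U U' : Opens P}
    {f f' : P → ℝ} (h : IsFlatFun F U f) (h' : IsFlatFun F U' f') {p : P}
    (hp : p ∈ U) (hp' : p ∈ U') (hff' : f =ᶠ[𝓝 p] f') :
    (D.toFun U 0 (funForm π h)).1 ⟨p, hp⟩ = (D.toFun U' 0 (funForm π h')).1 ⟨p, hp'⟩ := by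
  refine D.toFun_congr hp hp' ?_
  filter_upwards [hff', U.isOpen.mem_nhds hp, U'.isOpen.mem_nhds hp'] with q hq hqU hqU'
  rw [zeroExtend_of_mem _ (show q ∈ U from hqU), zeroExtend_of_mem _ (show q ∈ U' from hqU')]
  ext u
  exact hq

theorem wedge_zero_left_apply {E : Type*} [NormedAddCommGroup E] [NormedSpace ℝ E]
    (f : E [⋀^Fin 0]→L[ℝ] ℝ) (a : E [⋀^Fin 1]→L[ℝ] ℝ) (w : E) :
    wedge f a (fun _ => w) = f Fin.elim0 * a (fun _ => w) := by
  have h := factorial_mul_wedge_apply f a (fun _ => w)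
  have : Subsingleton (Fin (0 + 1)) := inferInstanceAs (Subsingleton (Fin 1))
  rw [altSum, Fintype.sum_subsingleton _ (1 : Equiv.Perm (Fin (0 + 1)))] at h
  simp only [Nat.factorial_zero, Nat.cast_one, Nat.factorial_one, one_mul,
    Equiv.Perm.sign_one, Units.val_one, Int.cast_one] at h
  rw [h]
  congr 2
  funext i; exact i.elim0

/-- The product rule for a relative derivation on flat functions. -/
theorem RelDerivation.funForm_mul (D : RelDerivation EX π F) {U : Opens P}
    {f g : P → ℝ} (hf : IsFlatFun F U f) (hg : IsFlatFun F U g) (p : U)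
    (w : TangentSpace 𝓘(ℝ, EX) (π p)) :
    (D.toFun U 0 (funForm π (hf.mul hg))).1 p (fun _ => w) =
      g p * (D.toFun U 0 (funForm π hf)).1 p (fun _ => w) +
        f p * (D.toFun U 0 (funForm π hg)).1 p (fun _ => w) := by
  have h := D.leibniz U 0 0 (funForm π hf) (funForm π hg) p (fun _ => w)
  have e : (FlatForm.wedge (funForm (EX := EX) π hf) (funForm (EX := EX) π hg) :
      FlatForm (EX := EX) π F 0 U) = funForm π (hf.mul hg) := by
    refine Subtype.ext (funext fun q => ?_)
    ext u
    refine (wedge_zero_right_apply (E := EX) ((funForm (EX := EX) π hf).1 q)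
      ((funForm (EX := EX) π hg).1 q) u).trans ?_
    exact mul_comm (g q) (f q)
  have h1 := wedge_zero_right_apply (E := EX) ((D.toFun U 0 (funForm π hf)).1 p)
    ((funForm (EX := EX) π hg).1 p) (fun _ => w)
  have h2 := wedge_zero_left_apply (E := EX) ((funForm (EX := EX) π hf).1 p)
    ((D.toFun U 0 (funForm π hg)).1 p) w
  rw [← e]
  refine h.trans ?_
  rw [pow_zero, one_mul]
  exact congrArg₂ (· + ·) h1 h2

/-- From `1 * 1 = 1` the product rule gives `D 1 = 2 D 1`, hence `D 1 = 0`; linearity does the rest.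
-/
theorem RelDerivation.funForm_const (D : RelDerivation EX π F) {U : Opens P} (c : ℝ) (p : U)
    (w : TangentSpace 𝓘(ℝ, EX) (π p)) :
    (D.toFun U 0 (funForm π (isFlatFun_const U c))).1 p (fun _ => w) = 0 := by
  have h1 := D.funForm_mul (isFlatFun_const U 1) (isFlatFun_const U 1) p w
  have e1 : funForm (EX := EX) (F := F) π ((isFlatFun_const U 1).mul (isFlatFun_const U 1)) =
      funForm π (isFlatFun_const U 1) := by
    refine Subtype.ext (funext fun q => ?_)
    ext u
    exact mul_one (1 : ℝ)
  rw [e1] at h1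
  have e2 : funForm (EX := EX) (F := F) π (isFlatFun_const U c) =
      c • funForm π (isFlatFun_const U 1) := by
    refine Subtype.ext (funext fun q => ?_)
    ext u
    exact (mul_one c).symm
  rw [e2, map_smul]
  change c * (D.toFun U 0 (funForm π (isFlatFun_const U 1))).1 p (fun _ => w) = 0
  linear_combination -c * h1

end FlatFunctions


/-! ### A relative derivation is determined by its values on functions -/

section Uniqueness

variable {EP EX P X : Type*}
  [NormedAddCommGroup EP] [NormedSpace ℝ EP]
  [NormedAddCommGroup EX] [NormedSpace ℝ EX] [FiniteDimensional ℝ EX]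
  [TopologicalSpace P] [ChartedSpace EP P] [IsManifold 𝓘(ℝ, EP) ∞ P]
  [TopologicalSpace X] [ChartedSpace EX X] [IsManifold 𝓘(ℝ, EX) ∞ X]
  {π : P → X} {F : ∀ p : P, Submodule ℝ (TangentSpace 𝓘(ℝ, EP) p)}

/-- The domain of the trivialization of `TX` around `x₀`. -/
def frameDomain (EX : Type*) {X : Type*} [NormedAddCommGroup EX] [NormedSpace ℝ EX]
    [TopologicalSpace X] [ChartedSpace EX X] [IsManifold 𝓘(ℝ, EX) ∞ X] (x₀ : X) : Opens X :=
  ⟨(triv EX x₀).baseSet, (triv EX x₀).open_baseSet⟩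

/-- The differential form with constant coefficients in the frame around `x₀`. -/
def frameForm {k : ℕ} (x₀ : X) (a : EX [⋀^Fin k]→L[ℝ] ℝ) :
    Form EX EX (id : X → X) k (frameDomain EX x₀) :=
  ⟨fun x => (a.compContinuousLinearMap ((triv EX x₀).continuousLinearMapAt ℝ (x : X)) :
    Alt EX (id : X → X) k (x : X)), fun x hx => by
    have hx' : x ∈ (triv EX x₀).baseSet := hx
    refine contMDiffAt_inFrame (p₁ := x₀) contMDiffAt_id (mem_baseSet_triv x) hx' ?_
    refine ContMDiffAt.congr_of_eventuallyEq (contMDiffAt_const (c := a)) ?_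
    filter_upwards [(triv EX x₀).open_baseSet.mem_nhds hx'] with y hy
    rw [inFrame, zeroExtend_of_mem _ (show y ∈ frameDomain EX x₀ from hy)]
    ext w
    exact congrArg a (funext fun i =>
      Bundle.Trivialization.continuousLinearMapAt_symmL _ hy (w i))⟩

/-- Because the frame is pulled back from `X`, the coefficients of a flat form in it are flat
functions. They serve as the coefficients in `res_eq_sum_wedge_funForm`. -/
theorem isFlatFun_clm_inFrame (hπ : IsSmoothSubmersion EP EX π)
    (hF : ∀ p, F p ≤ vertical EP EX π p) {k : ℕ} {U : Opens P}
    (α : FlatForm (EX := EX) π F k U) (p₀ : P) (L : (EX [⋀^Fin k]→L[ℝ] ℝ) →L[ℝ] ℝ) :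
    IsFlatFun F (U ⊓ Opens.comap ⟨π, hπ.contMDiff.continuous⟩ (frameDomain EX (π p₀)))
      (fun q => L (inFrame p₀ (zeroExtend α.1) q)) := by
  intro p hp
  have h := FlatForm.contMDiffAt_inFrame hπ α (p₀ := p₀) hp.1 hp.2
  have hL : ContMDiffAt 𝓘(ℝ, EX [⋀^Fin k]→L[ℝ] ℝ) 𝓘(ℝ, ℝ) ∞ L
    (inFrame p₀ (zeroExtend α.1) p) := L.contDiff.contMDiff.contMDiffAt
  refine ⟨hL.comp p h, fun v hv => ?_⟩
  refine (mvfderiv_comp_vec_apply (hL.mdifferentiableAt (by simp))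
    (h.mdifferentiableAt (by simp)) v).trans ?_
  have h2 : mfderiv 𝓘(ℝ, EP) 𝓘(ℝ, EX [⋀^Fin k]→L[ℝ] ℝ) (inFrame p₀ (zeroExtend α.1)) p v = 0 :=
    FlatForm.mvfderiv_inFrame hπ hF α hp.1 hp.2 hv
  rw [h2, map_zero]

/-- Locally, flat forms are combinations of pullbacks from `X` with flat coefficients. -/
theorem res_eq_sum_wedge_funForm (hπ : IsSmoothSubmersion EP EX π)
    (hF : ∀ p, F p ≤ vertical EP EX π p) {k : ℕ} {U : Opens P}
    (α : FlatForm (EX := EX) π F k U) (p₀ : P) {ι : Type*} [Fintype ι]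
    (b : ι → EX [⋀^Fin k]→L[ℝ] ℝ) (c : ι → (EX [⋀^Fin k]→L[ℝ] ℝ) →L[ℝ] ℝ)
    (hbc : ∀ a, ∑ i, c i a • b i = a) :
    FlatForm.res inf_le_left α = ∑ i, (FlatForm.wedge
      (FlatForm.res inf_le_right (pullback hπ hF (frameForm (π p₀) (b i))))
      (funForm π (isFlatFun_clm_inFrame hπ hF α p₀ (c i))) : FlatForm (EX := EX) π F k _) := by
  refine Subtype.ext (funext fun q => ?_)
  rw [AddSubmonoidClass.coe_finsetSum, Finset.sum_apply]
  ext w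
  rw [ContinuousAlternatingMap.sum_apply]
  have hq : π q ∈ (triv EX (π p₀)).baseSet := q.2.2
  have h1 : ∀ i, ((FlatForm.wedge
      (FlatForm.res inf_le_right (pullback hπ hF (frameForm (π p₀) (b i))))
      (funForm π (isFlatFun_clm_inFrame hπ hF α p₀ (c i))) : FlatForm (EX := EX) π F k _).1 q) w =
      c i (inFrame p₀ (zeroExtend α.1) q) *
        b i (fun j => (triv EX (π p₀)).continuousLinearMapAt ℝ (π q) (w j)) := fun i =>
    wedge_zero_right_apply (E := EX) _ _ w
  rw [Finset.sum_congr rfl fun i _ => h1 i]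
  have h2 := congrArg (fun a : EX [⋀^Fin k]→L[ℝ] ℝ => a fun j =>
    (triv EX (π p₀)).continuousLinearMapAt ℝ (π q) (w j)) (hbc (inFrame p₀ (zeroExtend α.1) q))
  simp only [ContinuousAlternatingMap.sum_apply, ContinuousAlternatingMap.smul_apply,
    smul_eq_mul] at h2
  rw [h2]
  have h3 := congrArg (fun a : Alt EX π k q => a w)
    (comp_continuousLinearMapAt_inFrame (zeroExtend α.1) (p := (q : P)) hq)
  refine Eq.trans ?_ h3.symm
  rw [zeroExtend_of_mem _ q.2.1]
  rfl

/-- Locally a flat form is a sum of `π^*βᵢ ∧ fᵢ`. In the Leibniz rule, `D (π^*βᵢ)` is prescribed by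
the de Rham differential and `D fᵢ` by the hypothesis on functions. -/
theorem RelDerivation.ext_of_funForm (hπ : IsSmoothSubmersion EP EX π)
    (hF : ∀ p, F p ≤ vertical EP EX π p) {D D' : RelDerivation EX π F}
    (hD : ExtendsDeRham hπ hF D) (hD' : ExtendsDeRham hπ hF D')
    (h : ∀ (U : Opens P) (f : P → ℝ) (hf : IsFlatFun F U f) (p : U),
      (D.toFun U 0 (funForm π hf)).1 p = (D'.toFun U 0 (funForm π hf)).1 p) : D = D' := by
  refine RelDerivation.ext (funext fun U => funext fun k => LinearMap.ext fun α =>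
    Subtype.ext (funext fun p₀ => ?_))
  obtain ⟨p₀, hp₀⟩ := p₀
  have := finiteDimensional_alt EX k
  let b := Module.finBasis ℝ (EX [⋀^Fin k]→L[ℝ] ℝ)
  let c : ∀ _ : Fin (Module.finrank ℝ (EX [⋀^Fin k]→L[ℝ] ℝ)), (EX [⋀^Fin k]→L[ℝ] ℝ) →L[ℝ] ℝ :=
    fun i => LinearMap.toContinuousLinearMap (b.coord i)
  let W := U ⊓ Opens.comap ⟨π, hπ.contMDiff.continuous⟩ (frameDomain EX (π p₀))
  have hpW : p₀ ∈ W := ⟨hp₀, mem_baseSet_triv (π p₀)⟩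
  have hres : ∀ D : RelDerivation EX π F, (D.toFun U k α).1 ⟨p₀, hp₀⟩ =
      (D.toFun W k (FlatForm.res inf_le_left α)).1 ⟨p₀, hpW⟩ := fun D => by
    rw [D.map_res]; rfl
  rw [hres, hres, res_eq_sum_wedge_funForm hπ hF α p₀ b c (fun a => b.sum_repr a), map_sum, map_sum,
    AddSubmonoidClass.coe_finsetSum, AddSubmonoidClass.coe_finsetSum, Finset.sum_apply,
    Finset.sum_apply]
  refine Finset.sum_congr rfl fun i _ => ?_
  ext w
  have h1 : ∀ {D : RelDerivation EX π F}, ExtendsDeRham hπ hF D →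
      (D.toFun W k (FlatForm.res inf_le_right (pullback hπ hF (frameForm (π p₀) (b i))))).1
        ⟨p₀, hpW⟩ = extDerivAt (zeroExtend (frameForm (π p₀) (b i)).1) (π p₀) := fun {D} hD => by
    rw [D.map_res]
    exact hD _ k (frameForm (π p₀) (b i)) ⟨p₀, hpW.2⟩
  refine (D.leibniz W k 0 _ _ ⟨p₀, hpW⟩ w).trans (Eq.trans ?_ (D'.leibniz W k 0 _ _ ⟨p₀, hpW⟩ w).symm)
  rw [h1 hD, h1 hD', h]

end Uniqueness


/-! ### Functions constant along a linear subspace -/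

section Calculus

universe u

variable {E : Type u} [NormedAddCommGroup E] [NormedSpace ℝ E] [FiniteDimensional ℝ E]

/-- A function that is smooth on an open set agrees near a point with a globally smooth one. -/
theorem exists_contDiff_eventuallyEq {f : E → ℝ} {W : Set E} (hW : IsOpen W)
    (hf : ContDiffOn ℝ ∞ f W) {y₀ : E} (hy₀ : y₀ ∈ W) :
    ∃ g : E → ℝ, ContDiff ℝ ∞ g ∧ g =ᶠ[𝓝 y₀] f := by
  obtain ⟨r, hr, hrW⟩ := Metric.nhds_basis_closedBall.mem_iff.1 (hW.mem_nhds hy₀)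
  let χ : ContDiffBump y₀ := ⟨r / 2, r, by positivity, by linarith⟩
  refine ⟨fun y => χ y * f y, contDiff_iff_contDiffAt.2 fun y => ?_, ?_⟩
  · by_cases hy : y ∈ W
    · exact χ.contDiffAt.mul (hf.contDiffAt (hW.mem_nhds hy))
    · have hy' : y ∉ tsupport χ := fun h => hy (hrW (by rwa [χ.tsupport_eq] at h))
      refine (contDiffAt_const (c := (0 : ℝ))).congr_of_eventuallyEq ?_
      filter_upwards [(isClosed_tsupport χ).isOpen_compl.mem_nhds hy'] with z hz
      rw [image_eq_zero_of_notMem_tsupport hz, zero_mul]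
  · filter_upwards [χ.eventuallyEq_one] with y hy
    rw [hy, Pi.one_apply, one_mul]

/-- A function whose derivative vanishes along `S` is constant on the slices parallel to `S`. -/
theorem eq_of_fderiv_eq_zero_of_sub_mem {f : E → ℝ} {B : Set E} (hB : Convex ℝ B)
    (hBo : IsOpen B) (hf : DifferentiableOn ℝ f B) {S : Submodule ℝ E}
    (hS : ∀ y ∈ B, ∀ s ∈ S, fderiv ℝ f y s = 0) {a c : E} (ha : a ∈ B) (hc : c ∈ B)
    (hac : c - a ∈ S) : f c = f a := by
  have hmem : ∀ t ∈ Icc (0 : ℝ) 1, a + t • (c - a) ∈ B := fun t ht =>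
    hB.add_smul_sub_mem ha hc ht
  have hd : ∀ t ∈ Icc (0 : ℝ) 1, HasDerivAt (fun t : ℝ => f (a + t • (c - a))) 0 t := fun t ht => by
    have h1 : HasDerivAt (fun t : ℝ => a + t • (c - a)) (c - a) t := by
      simpa using ((hasDerivAt_id t).smul_const (c - a)).const_add a
    have h2 := ((hf.differentiableAt (hBo.mem_nhds (hmem t ht))).hasFDerivAt).comp_hasDerivAt t h1
    rwa [hS _ (hmem t ht) _ hac] at h2
  have h := constant_of_has_deriv_right_zero (a := 0) (b := 1)
    (fun t ht => (hd t ht).continuousAt.continuousWithinAt)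
    (fun t ht => (hd t ⟨ht.1, ht.2.le⟩).hasDerivWithinAt) 1 ⟨zero_le_one, le_rfl⟩
  simpa using h

/-- Hadamard's lemma for functions constant along `S`. -/
theorem exists_smooth_eq_add_apply_proj {f : E → ℝ} {W : Set E} (hW : IsOpen W)
    (hf : ContDiffOn ℝ ∞ f W) {S : Submodule ℝ E} (hS : ∀ y ∈ W, ∀ s ∈ S, fderiv ℝ f y s = 0)
    {pr : E →L[ℝ] E} (hpr : ∀ y, y - pr y ∈ S) {y₀ : E} (hy₀ : y₀ ∈ W) :
    ∃ g : E → E →L[ℝ] ℝ, ContDiff ℝ ∞ g ∧ g 0 = fderiv ℝ f y₀ ∧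
      ∀ᶠ y in 𝓝 y₀, f y = f y₀ + g (pr (y - y₀)) (pr (y - y₀)) := by
  -- Hadamard's lemma is applied to a globally smooth function, so `f` is first replaced by one with
  -- the same germ at `y₀`.
  obtain ⟨F, hF, hFf⟩ := exists_contDiff_eventuallyEq hW hf hy₀
  obtain ⟨g, hg, hg0, hgz⟩ := exists_smooth_sub_eq_apply (h := fun z => F (y₀ + z))
    (hF.comp (contDiff_const.add contDiff_id))
  refine ⟨g, hg, ?_, ?_⟩
  · rw [hg0, fderiv_comp_add_left, add_zero, hFf.fderiv_eq]
  obtain ⟨r, hr, hrW⟩ := Metric.nhds_basis_ball.mem_iff.1 (hW.mem_nhds hy₀)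
  have hc : ContinuousAt (fun y => y₀ + pr (y - y₀)) y₀ := by fun_prop
  have hc' : Tendsto (fun y => y₀ + pr (y - y₀)) (𝓝 y₀) (𝓝 y₀) := by
    simpa [ContinuousAt] using hc
  filter_upwards [Metric.ball_mem_nhds y₀ hr, hc'.eventually (Metric.ball_mem_nhds y₀ hr),
    hc'.eventually hFf] with y hy hy' hyF
  -- The points `y` and `y₀ + pr (y - y₀)` differ by an element of `S` and lie in a common ball,
  -- where `f` is constant along `S`. So `f` depends only on `pr (y - y₀)`.
  have h1 : f y = f (y₀ + pr (y - y₀)) := by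
    refine eq_of_fderiv_eq_zero_of_sub_mem (convex_ball y₀ r) Metric.isOpen_ball
      ((hf.differentiableOn (by simp)).mono hrW) (fun z hz => hS z (hrW hz)) hy' hy ?_
    have := hpr (y - y₀)
    rwa [sub_add_eq_sub_sub]
  rw [h1, ← hyF, ← hgz, add_zero, hFf.eq_of_nhds]
  ring

/-- A linear projection with kernel `S`. -/
theorem exists_proj (S : Submodule ℝ E) :
    ∃ pr : E →L[ℝ] E, (∀ s ∈ S, pr s = 0) ∧ ∀ y, y - pr y ∈ S := by
  obtain ⟨q, hq⟩ := LinearMap.exists_leftInverse_of_injective S.subtype (Submodule.ker_subtype S)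
  refine ⟨LinearMap.toContinuousLinearMap (LinearMap.id - S.subtype.comp q), fun s hs => ?_,
    fun y => ?_⟩
  · have : q s = ⟨s, hs⟩ := LinearMap.congr_fun hq ⟨s, hs⟩
    simp [this]
  · simp

/-- The derivative of an `S`-valued map is `S`-valued. -/
theorem fderiv_apply_mem {V : E → E} {y : E} (hV : DifferentiableAt ℝ V y) {S : Submodule ℝ E}
    (hVS : ∀ᶠ z in 𝓝 y, V z ∈ S) (u : E) : fderiv ℝ V y u ∈ S := by
  obtain ⟨pr, h0, h1⟩ := exists_proj S
  have h2 : (fun z => pr (V z)) =ᶠ[𝓝 y] fun _ => (0 : E) := hVS.mono fun z hz => h0 _ hz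
  have h3 : pr (fderiv ℝ V y u) = 0 := by
    have h4 := (pr.hasFDerivAt.comp y hV.hasFDerivAt).fderiv
    have h5 := h2.fderiv_eq (𝕜 := ℝ)
    rw [fderiv_fun_const] at h5
    exact (congrArg (fun L : E →L[ℝ] E => L u) (h4.symm.trans h5))
  simpa [h3] using h1 (fderiv ℝ V y u)

end Calculus


/-! ### Foliated charts -/

section FoliatedCharts

variable {EP P : Type*}
  [NormedAddCommGroup EP] [NormedSpace ℝ EP] [FiniteDimensional ℝ EP]
  [TopologicalSpace P] [ChartedSpace EP P] [IsManifold 𝓘(ℝ, EP) ∞ P]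
  {F : ∀ p : P, Submodule ℝ (TangentSpace 𝓘(ℝ, EP) p)}
  {φ : OpenPartialHomeomorph P EP} {S : Submodule ℝ EP}

/-- A smooth chart in which `F` is the constant subspace `S`. -/
structure IsFoliatedChart (F : ∀ p : P, Submodule ℝ (TangentSpace 𝓘(ℝ, EP) p))
    (φ : OpenPartialHomeomorph P EP) (S : Submodule ℝ EP) : Prop where
  mem_maximalAtlas : φ ∈ IsManifold.maximalAtlas 𝓘(ℝ, EP) ∞ P
  mem_iff : ∀ p ∈ φ.source, ∀ v : TangentSpace 𝓘(ℝ, EP) p,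
    v ∈ F p ↔ mfderiv 𝓘(ℝ, EP) 𝓘(ℝ, EP) φ p v ∈ S

theorem mdifferentiable_of_mem_maximalAtlas (hφ : φ ∈ IsManifold.maximalAtlas 𝓘(ℝ, EP) ∞ P) :
    φ.MDifferentiable 𝓘(ℝ, EP) 𝓘(ℝ, EP) :=
  ⟨(contMDiffOn_of_mem_maximalAtlas hφ).mdifferentiableOn (by simp),
    (contMDiffOn_symm_of_mem_maximalAtlas hφ).mdifferentiableOn (by simp)⟩

theorem isInvertible_mfderiv (hφ : φ ∈ IsManifold.maximalAtlas 𝓘(ℝ, EP) ∞ P) {p : P}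
    (hp : p ∈ φ.source) : (mfderiv 𝓘(ℝ, EP) 𝓘(ℝ, EP) φ p).IsInvertible :=
  ⟨(mdifferentiable_of_mem_maximalAtlas hφ).mfderiv hp, rfl⟩

/-- The coordinate vector field of the chart `φ` in the direction `u`. -/
def chartField (φ : OpenPartialHomeomorph P EP) (u : EP) (p : P) : TangentSpace 𝓘(ℝ, EP) p :=
  VectorField.mpullback 𝓘(ℝ, EP) 𝓘(ℝ, EP) φ (fun _ => u) p

theorem mfderiv_chartField (hφ : φ ∈ IsManifold.maximalAtlas 𝓘(ℝ, EP) ∞ P) {p : P}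
    (hp : p ∈ φ.source) (u : EP) :
    mfderiv 𝓘(ℝ, EP) 𝓘(ℝ, EP) φ p (chartField φ u p) = u :=
  (isInvertible_mfderiv hφ hp).self_apply_inverse u

theorem smoothFieldAt_chartField (hφ : φ ∈ IsManifold.maximalAtlas 𝓘(ℝ, EP) ∞ P) {p : P}
    (hp : p ∈ φ.source) (u : EP) : SmoothFieldAt (chartField φ u) p := by
  have : CompleteSpace EP := FiniteDimensional.complete ℝ EP
  have : IsManifold 𝓘(ℝ, EP) 1 P := .of_le (n := ∞) (by simp)
  refine ContMDiffAt.mpullback_vectorField_preimage (n := ∞) (m := ∞) (V := fun _ : EP => u) ?_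
    (contMDiffAt_of_mem_maximalAtlas hφ hp) (isInvertible_mfderiv hφ hp) (by simp)
  exact (contMDiffAt_vectorSpace_iff_contDiffAt (V := fun _ : EP => u)).2 contDiffAt_const

theorem mvfderiv_comp_chart {A : Type*} [NormedAddCommGroup A] [NormedSpace ℝ A]
    (hφ : φ ∈ IsManifold.maximalAtlas 𝓘(ℝ, EP) ∞ P) {G : EP → A} {p : P} (hp : p ∈ φ.source)
    (hG : DifferentiableAt ℝ G (φ p)) (v : TangentSpace 𝓘(ℝ, EP) p) :
    mvfderiv 𝓘(ℝ, EP) (fun q => G (φ q)) p v =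
      fderiv ℝ G (φ p) (mfderiv 𝓘(ℝ, EP) 𝓘(ℝ, EP) φ p v) := by
  refine (mvfderiv_comp_vec_apply (g := G) (f := φ) hG.mdifferentiableAt
    ((mdifferentiable_of_mem_maximalAtlas hφ).mdifferentiableAt hp) v).trans ?_
  have : mvfderiv 𝓘(ℝ, EP) G (φ p) = fderiv ℝ G (φ p) := mfderiv_eq_fderiv
  rw [this]
  rfl

/-- The domain of a chart. -/
def chartDomain (φ : OpenPartialHomeomorph P EP) : Opens P := ⟨φ.source, φ.open_source⟩

theorem IsFoliatedChart.isFlatFun (h : IsFoliatedChart F φ S) {G : EP → ℝ} (hG : ContDiff ℝ ∞ G)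
    (hGS : ∀ y, ∀ s ∈ S, fderiv ℝ G y s = 0) :
    IsFlatFun F (chartDomain φ) (fun q => G (φ q)) := fun p hp => by
  refine ⟨hG.contMDiff.contMDiffAt.comp p
    (contMDiffAt_of_mem_maximalAtlas h.mem_maximalAtlas hp), fun v hv => ?_⟩
  rw [mvfderiv_comp_chart h.mem_maximalAtlas hp (hG.differentiable (by simp) _)]
  exact hGS _ _ ((h.mem_iff p hp v).1 hv)

theorem IsFoliatedChart.isFlatFun_clm (h : IsFoliatedChart F φ S) {L : EP →L[ℝ] ℝ}
    (hL : ∀ s ∈ S, L s = 0) : IsFlatFun F (chartDomain φ) (fun q => L (φ q)) :=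
  h.isFlatFun L.contDiff fun y s hs => by rw [L.fderiv, hL s hs]

/-- Flat functions separate vectors modulo `F`. -/
theorem IsFoliatedChart.mem_of_forall_isFlatFun (h : IsFoliatedChart F φ S) {p : P}
    (hp : p ∈ φ.source) {v : TangentSpace 𝓘(ℝ, EP) p}
    (hv : ∀ f, IsFlatFun F (chartDomain φ) f → mvfderiv 𝓘(ℝ, EP) f p v = 0) : v ∈ F p := by
  rw [h.mem_iff p hp]
  set u : EP := mfderiv 𝓘(ℝ, EP) 𝓘(ℝ, EP) φ p v with hu
  by_contra hS
  obtain ⟨pr, h0, h1⟩ := exists_proj S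
  -- A vector outside `S` has nonzero transverse part, and a linear functional of the transverse
  -- coordinates that detects it is a flat function.
  have hne : pr u ≠ 0 := fun h2 => hS (by
    have h3 := h1 u
    rwa [h2, sub_zero] at h3)
  obtain ⟨L, hL⟩ := SeparatingDual.exists_ne_zero (R := ℝ) hne
  have h3 := hv _ (h.isFlatFun_clm (L := L.comp pr) fun s hs => by simp [h0 s hs])
  rw [mvfderiv_comp_chart h.mem_maximalAtlas hp
    (L.comp pr).differentiableAt, ContinuousLinearMap.fderiv] at h3
  exact hL h3

/-- Hadamard's lemma for flat functions in a foliated chart. -/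
theorem IsFoliatedChart.exists_smooth_eq_add_apply (h : IsFoliatedChart F φ S) {p : P}
    (hp : p ∈ φ.source) {U : Opens P} (hpU : p ∈ U) {f : P → ℝ} (hf : IsFlatFun F U f)
    {pr : EP →L[ℝ] EP} (hpr : ∀ y, y - pr y ∈ S) :
    ∃ g : EP → EP →L[ℝ] ℝ, ContDiff ℝ ∞ g ∧
      (∀ v, mvfderiv 𝓘(ℝ, EP) f p v = g 0 (mfderiv 𝓘(ℝ, EP) 𝓘(ℝ, EP) φ p v)) ∧
      ∀ᶠ q in 𝓝 p, f q = f p + g (pr (φ q - φ p)) (pr (φ q - φ p)) := by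
  have hφ := mdifferentiable_of_mem_maximalAtlas h.mem_maximalAtlas
  let W : Set EP := φ.target ∩ φ.symm ⁻¹' U
  have hW : IsOpen W := φ.isOpen_inter_preimage_symm U.isOpen
  have hpW : φ p ∈ W := ⟨φ.map_source hp, by
    change φ.symm (φ p) ∈ U; rwa [φ.left_inv hp]⟩
  have hcd : ContDiffOn ℝ ∞ (fun y => f (φ.symm y)) W := fun y hy => by
    refine ContMDiffAt.contDiffAt ?_ |>.contDiffWithinAt
    exact ((hf _ hy.2).1).comp y (contMDiffAt_symm_of_mem_maximalAtlas h.mem_maximalAtlas hy.1)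
  have hfd : ∀ y ∈ W, ∀ u : EP, fderiv ℝ (fun y => f (φ.symm y)) y u =
      mvfderiv 𝓘(ℝ, EP) f (φ.symm y) (mfderiv 𝓘(ℝ, EP) 𝓘(ℝ, EP) φ.symm y u) := fun y hy u => by
    have h1 := mvfderiv_comp_vec_apply (g := f) (f := φ.symm) (p := y)
      ((hf _ hy.2).1.mdifferentiableAt (by simp)) (hφ.mdifferentiableAt_symm hy.1) u
    refine Eq.trans ?_ h1
    have : mvfderiv 𝓘(ℝ, EP) (f ∘ φ.symm) y = fderiv ℝ (f ∘ φ.symm) y := mfderiv_eq_fderiv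
    rw [this]
    rfl
  -- In the chart, being constant along `F` becomes being constant along the fixed subspace `S`.
  obtain ⟨g, hg, hg0, hgf⟩ := exists_smooth_eq_add_apply_proj hW hcd (S := S) (fun y hy s hs => by
    rw [hfd y hy]
    refine (hf _ hy.2).2 _ ((h.mem_iff _ (φ.map_target hy.1) _).2 ?_)
    have h2 := congrArg (fun L : EP →L[ℝ] EP => L s) (hφ.comp_symm_deriv hy.1)
    have h3 : mfderiv 𝓘(ℝ, EP) 𝓘(ℝ, EP) φ (φ.symm y)
      (mfderiv 𝓘(ℝ, EP) 𝓘(ℝ, EP) φ.symm y s) = s := h2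
    rw [h3]; exact hs) hpr hpW
  refine ⟨g, hg, fun v => ?_, ?_⟩
  · rw [hg0]
    have e : f =ᶠ[𝓝 p] fun q => (fun y => f (φ.symm y)) (φ q) := by
      filter_upwards [φ.open_source.mem_nhds hp] with q hq
      exact congrArg f (φ.left_inv hq).symm
    rw [mvfderiv_congr e]
    exact mvfderiv_comp_chart h.mem_maximalAtlas hp
      ((hcd.contDiffAt (hW.mem_nhds hpW)).differentiableAt (by simp)) v
  · filter_upwards [(φ.continuousAt hp).eventually hgf, φ.open_source.mem_nhds hp] with q hq hqs
    rwa [φ.left_inv hqs, φ.left_inv hp] at hq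

/-! ### Smoothness and involutivity of the tangent distribution of a foliation. -/

theorem IsFoliation.exists_isFoliatedChart (hF : IsFoliation F) (p : P) :
    ∃ φ S, IsFoliatedChart F φ S ∧ p ∈ φ.source := by
  obtain ⟨φ, hφ, hp, S, hS⟩ := hF p
  exact ⟨φ, S, ⟨hφ, hS⟩, hp⟩

theorem IsFoliatedChart.linearIndependent_chartField (h : IsFoliatedChart F φ S) {ι : Type*}
    {b : ι → EP} (hb : LinearIndependent ℝ b) {p : P} (hp : p ∈ φ.source) :
    LinearIndependent ℝ fun i => chartField φ (b i) p := by
  refine LinearIndependent.of_comp (mfderiv 𝓘(ℝ, EP) 𝓘(ℝ, EP) φ p).toLinearMap ?_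
  have e : (mfderiv 𝓘(ℝ, EP) 𝓘(ℝ, EP) φ p).toLinearMap ∘ (fun i => chartField φ (b i) p) = b :=
    funext fun i => mfderiv_chartField h.mem_maximalAtlas hp (b i)
  rw [e]
  exact hb

theorem IsFoliatedChart.span_chartField (h : IsFoliatedChart F φ S) {ι : Type*}
    {b : ι → EP} (hb : Submodule.span ℝ (range b) = S) {p : P} (hp : p ∈ φ.source) :
    Submodule.span ℝ (range fun i => chartField φ (b i) p) = F p := by
  have hinj := (mdifferentiable_of_mem_maximalAtlas h.mem_maximalAtlas).mfderiv_injective hp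
  apply Submodule.map_injective_of_injective
    (f := (mfderiv 𝓘(ℝ, EP) 𝓘(ℝ, EP) φ p).toLinearMap) hinj
  rw [Submodule.map_span, ← range_comp]
  have e : (mfderiv 𝓘(ℝ, EP) 𝓘(ℝ, EP) φ p).toLinearMap ∘ (fun i => chartField φ (b i) p) = b :=
    funext fun i => mfderiv_chartField h.mem_maximalAtlas hp (b i)
  rw [e]
  refine hb.trans ?_
  ext u
  constructor
  · intro hu
    refine ⟨chartField φ u p, (h.mem_iff p hp _).2 ?_, mfderiv_chartField h.mem_maximalAtlas hp u⟩
    rwa [mfderiv_chartField h.mem_maximalAtlas hp]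
  · rintro ⟨v, hv, rfl⟩
    exact (h.mem_iff p hp v).1 hv

theorem IsFoliation.isSmoothDistribution (hF : IsFoliation F) : IsSmoothDistribution F := by
  intro p₀
  obtain ⟨φ, S, h, hp₀⟩ := hF.exists_isFoliatedChart p₀
  let b := Module.finBasis ℝ S
  have hspan : Submodule.span ℝ (range fun i => (b i : EP)) = S := by
    have h1 := congrArg (Submodule.map S.subtype) b.span_eq
    rwa [Submodule.map_span, ← range_comp, Submodule.map_top, Submodule.range_subtype] at h1
  have hli : LinearIndependent ℝ fun i => (b i : EP) :=
    b.linearIndependent.map' S.subtype (Submodule.ker_subtype S)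
  exact ⟨chartDomain φ, hp₀, _, fun i => chartField φ (b i), fun i p hp =>
    (smoothFieldAt_chartField h.mem_maximalAtlas hp _).contMDiffWithinAt, fun p hp =>
    ⟨h.linearIndependent_chartField hli hp, h.span_chartField hspan hp⟩⟩

/-- The Lie bracket is natural under the inverse of a foliated chart. There both fields are
`S`-valued, and the bracket `DW(V) - DV(W)` is a difference of derivatives of `S`-valued maps, hence
lies in `S`. -/
theorem IsFoliation.isInvolutive (hF : IsFoliation F) : IsInvolutive F := by
  intro U V W hV hW hVF hWF p hp
  have : CompleteSpace EP := FiniteDimensional.complete ℝ EP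
  have : IsManifold 𝓘(ℝ, EP) 1 P := .of_le (n := ∞) (by simp)
  have h2 : minSmoothness ℝ 2 ≤ ∞ := by simpa using two_le_infty
  have h3 : minSmoothness ℝ 3 ≤ ∞ := by
    simpa using (WithTop.coe_le_coe.2 le_top :
      ((3 : ℕ∞) : WithTop ℕ∞) ≤ ((⊤ : ℕ∞) : WithTop ℕ∞))
  have : IsManifold 𝓘(ℝ, EP) (minSmoothness ℝ 2) P := .of_le (n := ∞) h2
  have : IsManifold 𝓘(ℝ, EP) (minSmoothness ℝ 3) P := .of_le (n := ∞) h3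
  obtain ⟨φ, S, h, hpφ⟩ := hF.exists_isFoliatedChart p
  have hφ := mdifferentiable_of_mem_maximalAtlas h.mem_maximalAtlas
  have hinv : ∀ y ∈ φ.target, (mfderiv 𝓘(ℝ, EP) 𝓘(ℝ, EP) φ.symm y).IsInvertible := fun y hy =>
    ⟨hφ.symm.mfderiv hy, rfl⟩
  have hy : φ p ∈ φ.target := φ.map_source hpφ
  have hleft : φ.symm (φ p) = p := φ.left_inv hpφ
  have hinvS : ∀ y ∈ φ.target, ∀ v : TangentSpace 𝓘(ℝ, EP) (φ.symm y), v ∈ F (φ.symm y) ↔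
      (mfderiv 𝓘(ℝ, EP) 𝓘(ℝ, EP) φ.symm y).inverse v ∈ S := fun y hy v => by
    rw [h.mem_iff _ (φ.map_target hy)]
    have h1 : mfderiv 𝓘(ℝ, EP) 𝓘(ℝ, EP) φ (φ.symm y) v =
        (mfderiv 𝓘(ℝ, EP) 𝓘(ℝ, EP) φ.symm y).inverse v := by
      have h2 := congrArg (fun L : EP →L[ℝ] EP =>
        L ((mfderiv 𝓘(ℝ, EP) 𝓘(ℝ, EP) φ.symm y).inverse v)) (hφ.comp_symm_deriv hy)
      have h3 : mfderiv 𝓘(ℝ, EP) 𝓘(ℝ, EP) φ (φ.symm y) (mfderiv 𝓘(ℝ, EP) 𝓘(ℝ, EP) φ.symm y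
        ((mfderiv 𝓘(ℝ, EP) 𝓘(ℝ, EP) φ.symm y).inverse v)) =
        (mfderiv 𝓘(ℝ, EP) 𝓘(ℝ, EP) φ.symm y).inverse v := h2
      rwa [(hinv y hy).self_apply_inverse] at h3
    rw [h1]
    rfl
  have key : ∀ Z : ∀ p : P, TangentSpace 𝓘(ℝ, EP) p,
      ContMDiffOn 𝓘(ℝ, EP) 𝓘(ℝ, EP).tangent ∞
        (fun p => (⟨p, Z p⟩ : TangentBundle 𝓘(ℝ, EP) P)) U → (∀ p ∈ U, Z p ∈ F p) →
      DifferentiableAt ℝ (VectorField.mpullback 𝓘(ℝ, EP) 𝓘(ℝ, EP) φ.symm Z : EP → EP) (φ p) ∧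
      ∀ᶠ y in 𝓝 (φ p), VectorField.mpullback 𝓘(ℝ, EP) 𝓘(ℝ, EP) φ.symm Z y ∈ S := by
    intro Z hZ hZF
    refine ⟨?_, ?_⟩
    · have h1 : ContMDiffAt 𝓘(ℝ, EP) 𝓘(ℝ, EP).tangent ∞
          (fun p => (⟨p, Z p⟩ : TangentBundle 𝓘(ℝ, EP) P)) (φ.symm (φ p)) := by
        rw [hleft]; exact hZ.contMDiffAt (U.isOpen.mem_nhds hp)
      have h2 := ContMDiffAt.mpullback_vectorField_preimage (n := ∞) (m := ∞) (V := Z)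
        (f := φ.symm) h1 (contMDiffAt_symm_of_mem_maximalAtlas h.mem_maximalAtlas hy)
        (hinv _ hy) (by simp)
      exact (contMDiffAt_vectorSpace_iff_contDiffAt.1 h2).differentiableAt (by simp)
    · have hc : ContinuousAt φ.symm (φ p) := φ.continuousAt_symm hy
      filter_upwards [φ.open_target.mem_nhds hy, hc.preimage_mem_nhds
        (U.isOpen.mem_nhds (by rw [hleft]; exact hp))] with y hyt hyU
      exact (hinvS y hyt _).1 (hZF _ hyU)
  obtain ⟨hVd, hVS⟩ := key V hV hVF
  obtain ⟨hWd, hWS⟩ := key W hW hWF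
  have hbr : VectorField.mpullback 𝓘(ℝ, EP) 𝓘(ℝ, EP) φ.symm
      (VectorField.mlieBracket 𝓘(ℝ, EP) V W) (φ p) ∈ S := by
    have hmd : ∀ Z : ∀ p : P, TangentSpace 𝓘(ℝ, EP) p, ContMDiffOn 𝓘(ℝ, EP) 𝓘(ℝ, EP).tangent ∞
        (fun p => (⟨p, Z p⟩ : TangentBundle 𝓘(ℝ, EP) P)) U →
        MDifferentiableAt 𝓘(ℝ, EP) 𝓘(ℝ, EP).tangent
        (fun p => (⟨p, Z p⟩ : TangentBundle 𝓘(ℝ, EP) P)) (φ.symm (φ p)) := fun Z hZ => by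
      rw [hleft]
      exact (hZ.contMDiffAt (U.isOpen.mem_nhds hp)).mdifferentiableAt (by simp)
    rw [VectorField.mpullback_mlieBracket (n := ∞) (hmd V hV) (hmd W hW)
      (contMDiffAt_symm_of_mem_maximalAtlas h.mem_maximalAtlas hy) h2,
      ← VectorField.mlieBracketWithin_univ, VectorField.mlieBracketWithin_eq_lieBracketWithin]
    have h4 := congrFun (VectorField.lieBracketWithin_univ (𝕜 := ℝ)
      (V := (VectorField.mpullback 𝓘(ℝ, EP) 𝓘(ℝ, EP) φ.symm V : EP → EP))
      (W := (VectorField.mpullback 𝓘(ℝ, EP) 𝓘(ℝ, EP) φ.symm W : EP → EP))) (φ p)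
    refine (congrArg (· ∈ S) h4).mpr ?_
    exact Submodule.sub_mem _ (fderiv_apply_mem hWd hWS _) (fderiv_apply_mem hVd hVS _)
  have h5 := (hinvS _ hy _).2 hbr
  rwa [hleft] at h5

end FoliatedCharts


/-! ### The symbol of a relative derivation -/

section Symbol

variable {EP EX P X : Type*}
  [NormedAddCommGroup EP] [NormedSpace ℝ EP] [FiniteDimensional ℝ EP]
  [NormedAddCommGroup EX] [NormedSpace ℝ EX] [FiniteDimensional ℝ EX]
  [TopologicalSpace P] [ChartedSpace EP P] [IsManifold 𝓘(ℝ, EP) ∞ P]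
  [TopologicalSpace X] [ChartedSpace EX X] [IsManifold 𝓘(ℝ, EX) ∞ X]
  {π : P → X} {F : ∀ p : P, Submodule ℝ (TangentSpace 𝓘(ℝ, EP) p)}
  {φ : OpenPartialHomeomorph P EP} {S : Submodule ℝ EP}

theorem IsFlatFun.add {U : Opens P} {f g : P → ℝ} (hf : IsFlatFun F U f) (hg : IsFlatFun F U g) :
    IsFlatFun F U fun q => f q + g q := by
  -- Flat `0`-forms already form a submodule; taking `π = id` gives closure under sums for functions
  -- on `P`.
  have h := isFlatFun_formFun (funForm (EX := EP) id hf + funForm (EX := EP) id hg)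
  intro p hp
  have e : formFun (funForm (EX := EP) id hf + funForm (EX := EP) id hg) =ᶠ[𝓝 p]
      fun q => f q + g q := by
    filter_upwards [U.isOpen.mem_nhds hp] with q hq
    rw [formFun, zeroExtend_of_mem _ (show q ∈ U from hq)]
    rfl
  exact ⟨(h p hp).1.congr_of_eventuallyEq e.symm, fun v hv => by
    rw [← mvfderiv_congr e]; exact (h p hp).2 v hv⟩

theorem IsFlatFun.sum {U : Opens P} {ι : Type*} {s : Finset ι} {f : ι → P → ℝ}
    (hf : ∀ i ∈ s, IsFlatFun F U (f i)) : IsFlatFun F U fun q => ∑ i ∈ s, f i q := by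
  classical
  induction s using Finset.induction_on with
  | empty => simpa using isFlatFun_const U 0
  | insert a s ha ih =>
    simp only [Finset.sum_insert ha]
    exact (hf a (Finset.mem_insert_self a s)).add
      (ih fun i hi => hf i (Finset.mem_insert_of_mem hi))

theorem RelDerivation.funForm_add (D : RelDerivation EX π F) {U : Opens P}
    {f g : P → ℝ} (hf : IsFlatFun F U f) (hg : IsFlatFun F U g) (p : U)
    (w : TangentSpace 𝓘(ℝ, EX) (π p)) :
    (D.toFun U 0 (funForm π (hf.add hg))).1 p (fun _ => w) =
      (D.toFun U 0 (funForm π hf)).1 p (fun _ => w) +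
        (D.toFun U 0 (funForm π hg)).1 p (fun _ => w) := by
  have e : funForm (EX := EX) π (hf.add hg) = funForm π hf + funForm π hg := by
    refine Subtype.ext (funext fun q => ?_)
    ext u
    rfl
  rw [e, map_add]
  rfl

theorem RelDerivation.funForm_sum (D : RelDerivation EX π F) {U : Opens P} {ι : Type*} [Fintype ι]
    {f : ι → P → ℝ} (hf : ∀ i, IsFlatFun F U (f i)) (p : U) (w : TangentSpace 𝓘(ℝ, EX) (π p)) :
    (D.toFun U 0 (funForm π (IsFlatFun.sum (s := Finset.univ) fun i _ => hf i))).1 p (fun _ => w) =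
      ∑ i, (D.toFun U 0 (funForm π (hf i))).1 p (fun _ => w) := by
  have e : funForm (EX := EX) π (IsFlatFun.sum (s := Finset.univ) fun i _ => hf i) =
      ∑ i, funForm π (hf i) := by
    refine Subtype.ext (funext fun q => ?_)
    rw [AddSubmonoidClass.coe_finsetSum, Finset.sum_apply]
    ext u
    rw [ContinuousAlternatingMap.sum_apply]
    rfl
  rw [e, map_sum, AddSubmonoidClass.coe_finsetSum, Finset.sum_apply]
  exact ContinuousAlternatingMap.sum_apply _ _

/-- A projection of the model space with kernel `S`. -/
def transProj (S : Submodule ℝ EP) : EP →L[ℝ] EP := (exists_proj S).choose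

theorem transProj_eq_zero {s : EP} (hs : s ∈ S) : transProj S s = 0 :=
  (exists_proj S).choose_spec.1 s hs

theorem sub_transProj_mem (S : Submodule ℝ EP) (y : EP) : y - transProj S y ∈ S :=
  (exists_proj S).choose_spec.2 y

/-- The `i`-th coordinate of the model space. -/
def coordCLM (EP : Type*) [NormedAddCommGroup EP] [NormedSpace ℝ EP] [FiniteDimensional ℝ EP]
    (i : Fin (Module.finrank ℝ EP)) : EP →L[ℝ] ℝ :=
  LinearMap.toContinuousLinearMap ((Module.finBasis ℝ EP).coord i)

theorem sum_coordCLM_smul (y : EP) : ∑ i, coordCLM EP i y • Module.finBasis ℝ EP i = y :=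
  (Module.finBasis ℝ EP).sum_repr y

/-- The `i`-th transverse coordinate function of a foliated chart. -/
theorem IsFoliatedChart.isFlatFun_coord (h : IsFoliatedChart F φ S)
    (i : Fin (Module.finrank ℝ EP)) :
    IsFlatFun F (chartDomain φ) (fun q => (coordCLM EP i).comp (transProj S) (φ q)) :=
  h.isFlatFun_clm fun s hs => by rw [ContinuousLinearMap.comp_apply, transProj_eq_zero hs, map_zero]

/-- The derivation applied to the `i`-th transverse coordinate function, as a family of linear
forms. -/
def symbolCoeff (D : RelDerivation EX π F) (h : IsFoliatedChart F φ S)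
    (i : Fin (Module.finrank ℝ EP)) (p : P) : TangentSpace 𝓘(ℝ, EX) (π p) →ₗ[ℝ] ℝ :=
  ((ContinuousAlternatingMap.ofSubsingleton ℝ (TangentSpace 𝓘(ℝ, EX) (π p)) ℝ (0 : Fin 1)).symm
    (zeroExtend (D.toFun (chartDomain φ) 0 (funForm π (h.isFlatFun_coord i))).1 p)).toLinearMap

theorem symbolCoeff_apply (D : RelDerivation EX π F) (h : IsFoliatedChart F φ S)
    (i : Fin (Module.finrank ℝ EP)) (p : P) (w : TangentSpace 𝓘(ℝ, EX) (π p)) :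
    symbolCoeff D h i p w =
      zeroExtend (D.toFun (chartDomain φ) 0 (funForm π (h.isFlatFun_coord i))).1 p (fun _ => w) :=
  rfl

/-- A lift to `TP` of the symbol of `D`, over the domain of a foliated chart. -/
def symbolLift (D : RelDerivation EX π F) (h : IsFoliatedChart F φ S) (p : P) :
    TangentSpace 𝓘(ℝ, EX) (π p) →ₗ[ℝ] TangentSpace 𝓘(ℝ, EP) p :=
  ∑ i, (symbolCoeff D h i p).smulRight (chartField φ (Module.finBasis ℝ EP i) p)

theorem symbolLift_apply (D : RelDerivation EX π F) (h : IsFoliatedChart F φ S) (p : P)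
    (w : TangentSpace 𝓘(ℝ, EX) (π p)) : symbolLift D h p w =
      ∑ i, symbolCoeff D h i p w • chartField φ (Module.finBasis ℝ EP i) p := by
  simp [symbolLift]

/-- Near `p`, Hadamard's lemma gives `f = f(p) + ∑ gᵢ ηᵢ` with flat `gᵢ` and transverse coordinates
`ηᵢ` vanishing at `p`. The product rule at `p` leaves only `∑ gᵢ(p) D ηᵢ`, and `gᵢ(p)` is the
derivative of `f` along the `i`-th coordinate field. So a relative derivation acts on functions as
differentiation along a vector, determined modulo `F`. -/
theorem RelDerivation.apply_eq_mvfderiv_symbolLift (D : RelDerivation EX π F)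
    (h : IsFoliatedChart F φ S) {p : P} (hp : p ∈ φ.source) {U : Opens P} (hpU : p ∈ U)
    {f : P → ℝ} (hf : IsFlatFun F U f) (w : TangentSpace 𝓘(ℝ, EX) (π p)) :
    (D.toFun U 0 (funForm π hf)).1 ⟨p, hpU⟩ (fun _ => w) =
      mvfderiv 𝓘(ℝ, EP) f p (symbolLift D h p w) := by
  have hpφ : p ∈ chartDomain φ := hp
  obtain ⟨g, hg, hgd, hgf⟩ := h.exists_smooth_eq_add_apply hp hpU hf (sub_transProj_mem S)
  let b := Module.finBasis ℝ EP
  let z : EP → EP := fun y => transProj S (y - φ p)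
  have hz : ContDiff ℝ ∞ z := by fun_prop
  have hzS : ∀ y, ∀ s ∈ S, fderiv ℝ z y s = 0 := fun y s hs => by
    have h1 : HasFDerivAt z (transProj S) y :=
      (transProj S).hasFDerivAt.comp y ((hasFDerivAt_id y).sub_const (φ p))
    rw [h1.fderiv, transProj_eq_zero hs]
  have hcomp : ∀ {G : EP → ℝ}, ContDiff ℝ ∞ G →
      IsFlatFun F (chartDomain φ) (fun q => G (z (φ q))) := fun {G} hG =>
    h.isFlatFun (G := fun y => G (z y)) (hG.comp hz) fun y s hs => by
      have h1 := ((hG.differentiable (by simp) (z y)).hasFDerivAt.comp y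
        (hz.differentiable (by simp) y).hasFDerivAt).fderiv
      refine (congrArg (fun L : EP →L[ℝ] ℝ => L s) h1).trans ?_
      rw [ContinuousLinearMap.comp_apply, hzS y s hs, map_zero]
  have hgi : ∀ i, IsFlatFun F (chartDomain φ) (fun q => g (z (φ q)) (b i)) := fun i =>
    hcomp (G := fun y => g y (b i)) (hg.clm_apply contDiff_const)
  have hηi : ∀ i, IsFlatFun F (chartDomain φ) (fun q => coordCLM EP i (z (φ q))) := fun i =>
    hcomp (coordCLM EP i).contDiff
  -- Centring a coordinate at `p` changes it by a constant, which `D` annihilates.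
  have hdη : ∀ i, (D.toFun _ 0 (funForm π (hηi i))).1 ⟨p, hpφ⟩ (fun _ => w) =
      symbolCoeff D h i p w := fun i => by
    have h1 := D.funForm_add (h.isFlatFun_coord i) (isFlatFun_const (chartDomain φ)
      (-coordCLM EP i (transProj S (φ p)))) ⟨p, hpφ⟩ w
    rw [D.funForm_const, add_zero] at h1
    rw [symbolCoeff_apply, zeroExtend_of_mem _ hpφ, ← h1]
    refine congrArg (fun a : Alt EX π 1 p => a fun _ => w) (D.funForm_congr _ _ hpφ hpφ ?_)
    refine Eventually.of_forall fun q => ?_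
    change coordCLM EP i (transProj S (φ q - φ p)) = _
    rw [map_sub, map_sub, sub_eq_add_neg]
    rfl
  have hz0 : z (φ p) = 0 := by simp [z]
  have hdecomp : f =ᶠ[𝓝 p] fun q => f p + ∑ i, g (z (φ q)) (b i) * coordCLM EP i (z (φ q)) := by
    filter_upwards [hgf] with q hq
    rw [hq]
    change _ + g (z (φ q)) (z (φ q)) = _
    congr 1
    conv_lhs => rw [← sum_coordCLM_smul (z (φ q)), map_sum]
    refine Finset.sum_congr rfl fun i _ => ?_
    rw [sum_coordCLM_smul, map_smul, smul_eq_mul, mul_comm]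
  have hsum := IsFlatFun.sum (s := Finset.univ) fun i _ => (hgi i).mul (hηi i)
  have h1 := D.funForm_congr hf ((isFlatFun_const (chartDomain φ) (f p)).add hsum) hpU hpφ hdecomp
  refine (congrArg (fun a : Alt EX π 1 p => a fun _ => w) h1).trans ?_
  refine (D.funForm_add (isFlatFun_const (chartDomain φ) (f p)) hsum ⟨p, hpφ⟩ w).trans ?_
  rw [D.funForm_const, zero_add,
    D.funForm_sum (fun i => (hgi i).mul (hηi i)) ⟨p, hpφ⟩ w, symbolLift_apply, map_sum]
  refine Finset.sum_congr rfl fun i _ => ?_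
  rw [D.funForm_mul (hgi i) (hηi i), hdη]
  change coordCLM EP i (z (φ p)) * _ + g (z (φ p)) (b i) * _ = _
  rw [hz0, map_zero, zero_mul, zero_add, map_smul, smul_eq_mul, hgd,
    mfderiv_chartField h.mem_maximalAtlas hp, mul_comm]

theorem smoothFieldAt_symbolLift (hπ : IsSmoothSubmersion EP EX π) (D : RelDerivation EX π F)
    (h : IsFoliatedChart F φ S) {p₀ p : P}
    (hp : p ∈ φ.source) (h₀ : π p ∈ (triv EX (π p₀)).baseSet) (w : EX) :
    SmoothFieldAt (fun q => symbolLift D h q ((triv EX (π p₀)).symmL ℝ (π q) w)) p := by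
  have h1 : ∀ i, ContMDiffAt 𝓘(ℝ, EP) 𝓘(ℝ, ℝ) ∞
      (fun q => symbolCoeff D h i q ((triv EX (π p₀)).symmL ℝ (π q) w)) p := fun i => by
    have h2 := contMDiffAt_inFrame hπ.contMDiff.contMDiffAt h₀ (mem_baseSet_triv (π p))
      ((D.toFun (chartDomain φ) 0 (funForm π (h.isFlatFun_coord i))).2 p hp)
    have hL : ContDiff ℝ ∞ (ContinuousAlternatingMap.apply ℝ EX ℝ (fun _ : Fin (0 + 1) => w)) :=
      ContinuousLinearMap.contDiff (𝕜 := ℝ) (E := EX [⋀^Fin (0 + 1)]→L[ℝ] ℝ) (F := ℝ) _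
    exact hL.contMDiff.contMDiffAt.comp p h2
  have h2 := ContMDiffAt.sum_section (s := Finset.univ) (fun i _ => (h1 i).smul_section
    (smoothFieldAt_chartField h.mem_maximalAtlas hp (Module.finBasis ℝ EP i)))
  unfold SmoothFieldAt
  simp only [symbolLift_apply]
  exact h2

end Symbol


/-! ### The distribution of a relative derivation -/

section Correspondence

variable {EP EX P X : Type*}
  [NormedAddCommGroup EP] [NormedSpace ℝ EP] [FiniteDimensional ℝ EP]
  [NormedAddCommGroup EX] [NormedSpace ℝ EX] [FiniteDimensional ℝ EX]
  [TopologicalSpace P] [ChartedSpace EP P] [IsManifold 𝓘(ℝ, EP) ∞ P]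
  [TopologicalSpace X] [ChartedSpace EX X] [IsManifold 𝓘(ℝ, EX) ∞ X]
  {π : P → X} {F C C' : ∀ p : P, Submodule ℝ (TangentSpace 𝓘(ℝ, EP) p)}
  {φ φ' : OpenPartialHomeomorph P EP} {S S' : Submodule ℝ EP}

theorem IsFlatFun.mvfderiv_eq {U : Opens P} {f : P → ℝ} (hf : IsFlatFun F U f) {p : P}
    (hp : p ∈ U) {v v' : TangentSpace 𝓘(ℝ, EP) p} (h : v - v' ∈ F p) :
    mvfderiv 𝓘(ℝ, EP) f p v = mvfderiv 𝓘(ℝ, EP) f p v' := by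
  have h1 := (hf p hp).2 _ h
  rwa [map_sub, sub_eq_zero] at h1

theorem IsFoliatedChart.sub_mem_of_forall_isFlatFun (h : IsFoliatedChart F φ S) {p : P}
    (hp : p ∈ φ.source) {v v' : TangentSpace 𝓘(ℝ, EP) p}
    (hv : ∀ f, IsFlatFun F (chartDomain φ) f →
      mvfderiv 𝓘(ℝ, EP) f p v = mvfderiv 𝓘(ℝ, EP) f p v') : v - v' ∈ F p :=
  h.mem_of_forall_isFlatFun hp fun f hf => by rw [map_sub, hv f hf, sub_self]

/-- A smooth function on `X`, as a `0`-form. -/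
def chartFun (x₀ : X) (L : EX →L[ℝ] ℝ) : Form EX EX (id : X → X) 0 (frameDomain EX x₀) :=
  -- With respect to the zero distribution every smooth function is flat, so the passage from
  -- functions to `0`-forms can be reused on `X`.
  have h : IsFlatFun (fun x : X => (⊥ : Submodule ℝ (TangentSpace 𝓘(ℝ, EX) x)))
      (frameDomain EX x₀) (fun x => L (extChartAt 𝓘(ℝ, EX) x₀ x)) := fun x hx =>
    ⟨L.contDiff.contMDiff.contMDiffAt.comp x (contMDiffAt_extChartAt' hx), fun v hv => by
      rw [(Submodule.mem_bot ℝ).1 hv, map_zero]⟩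
  ⟨(funForm (EX := EX) id h).1, (funForm (EX := EX) id h).2.1⟩

/-- The lift of the symbol is a section of `Tπ` if the derivation extends the de Rham
differential. -/
theorem mfderiv_symbolLift (hπ : IsSmoothSubmersion EP EX π) (hFπ : ∀ p, F p ≤ vertical EP EX π p)
    {D : RelDerivation EX π F} (hD : ExtendsDeRham hπ hFπ D) (h : IsFoliatedChart F φ S) {p : P}
    (hp : p ∈ φ.source) (w : TangentSpace 𝓘(ℝ, EX) (π p)) :
    mfderiv 𝓘(ℝ, EP) 𝓘(ℝ, EX) π p (symbolLift D h p w) = w := by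
  obtain ⟨v, rfl⟩ := hπ.surjective p w
  set u := symbolLift D h p (mfderiv 𝓘(ℝ, EP) 𝓘(ℝ, EX) π p v) with hu
  have hb := mem_baseSet_triv (EX := EX) (π p)
  have hdiff : MDifferentiableAt 𝓘(ℝ, EP) 𝓘(ℝ, EX) π p :=
    hπ.contMDiff.contMDiffAt.mdifferentiableAt (by simp)
  let ψ : P → EX := extChartAt 𝓘(ℝ, EX) (π p) ∘ π
  have hψ : MDifferentiableAt 𝓘(ℝ, EP) 𝓘(ℝ, EX) ψ p :=
    ((contMDiffAt_extChartAt' (n := ∞) (I := 𝓘(ℝ, EX)) hb).comp p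
      hπ.contMDiff.contMDiffAt).mdifferentiableAt (by simp)
  -- The derivation of the pulled-back coordinate `L ∘ ψ` is computed twice: along `v`, because `D`
  -- extends the de Rham differential, and along `u`, by the formula for the lift. As `L` varies,
  -- this determines `Tπ u`.
  have h1 : ∀ L : EX →L[ℝ] ℝ, L (mvfderiv 𝓘(ℝ, EP) ψ p u) = L (mvfderiv 𝓘(ℝ, EP) ψ p v) := by
    intro L
    let α := chartFun (π p) L
    let f := pullback hπ hFπ α
    have hpf : p ∈ Opens.comap ⟨π, hπ.contMDiff.continuous⟩ (frameDomain EX (π p)) := hb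
    have h2 : (D.toFun _ 0 f).1 ⟨p, hpf⟩ (fun _ => mfderiv 𝓘(ℝ, EP) 𝓘(ℝ, EX) π p v) =
        mvfderiv 𝓘(ℝ, EP) (formFun f) p v := by
      rw [hD _ 0 α ⟨p, hpf⟩, ← extDerivAt_toFormOnTotal_zero hπ f hpf]
      exact (extDerivAt_toFormOnTotal_pullback hπ hFπ α hb fun _ => v).symm
    have h3 := D.apply_eq_mvfderiv_symbolLift h hp hpf (isFlatFun_formFun f)
      (mfderiv 𝓘(ℝ, EP) 𝓘(ℝ, EX) π p v)
    rw [funForm_formFun, h2] at h3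
    have h4 : formFun f =ᶠ[𝓝 p] L ∘ ψ := by
      filter_upwards [(Opens.comap ⟨π, hπ.contMDiff.continuous⟩
        (frameDomain EX (π p))).isOpen.mem_nhds hpf] with q hq
      rw [formFun, zeroExtend_of_mem _ hq]
      rfl
    have h5 : ∀ z : TangentSpace 𝓘(ℝ, EP) p, mvfderiv 𝓘(ℝ, EP) (formFun f) p z =
        L (mvfderiv 𝓘(ℝ, EP) ψ p z) := fun z => by
      rw [mvfderiv_congr h4, mvfderiv_comp_vec_apply L.differentiableAt.mdifferentiableAt hψ]
      have h6 : mvfderiv 𝓘(ℝ, EX) L (ψ p) = L := mfderiv_eq_fderiv.trans L.fderiv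
      rw [h6]
      rfl
    rw [h5, h5] at h3
    exact h3.symm
  have h7 : mvfderiv 𝓘(ℝ, EP) ψ p u = mvfderiv 𝓘(ℝ, EP) ψ p v := by
    by_contra hne
    obtain ⟨L, hL⟩ := SeparatingDual.exists_ne_zero (R := ℝ) (sub_ne_zero.2 hne)
    exact hL (by rw [map_sub, h1, sub_self])
  rw [← continuousLinearMapAt_comp_mfderiv hdiff hb, ← continuousLinearMapAt_comp_mfderiv hdiff hb]
    at h7
  have h8 := congrArg ((triv EX (π p)).symmL ℝ (π p)) h7
  rwa [Bundle.Trivialization.symmL_continuousLinearMapAt _ hb,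
    Bundle.Trivialization.symmL_continuousLinearMapAt _ hb] at h8

/-- Both lifts compute the same `D f` for every flat `f`, and flat functions separate vectors modulo
`F`. The symbol is therefore independent of the foliated chart. -/
theorem symbolLift_sub_mem (D : RelDerivation EX π F) (h : IsFoliatedChart F φ S)
    (h' : IsFoliatedChart F φ' S') {p : P} (hp : p ∈ φ.source) (hp' : p ∈ φ'.source)
    (w : TangentSpace 𝓘(ℝ, EX) (π p)) : symbolLift D h p w - symbolLift D h' p w ∈ F p :=
  h.sub_mem_of_forall_isFlatFun hp fun f hf => by
    have hpφ : p ∈ chartDomain φ := hp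
    rw [← D.apply_eq_mvfderiv_symbolLift h hp hpφ hf, D.apply_eq_mvfderiv_symbolLift h' hp' hpφ hf]

/-- The symbol of a relative derivation. -/
def symbol (hF : IsFoliation F) (D : RelDerivation EX π F) (p : P) :
    TangentSpace 𝓘(ℝ, EX) (π p) →ₗ[ℝ] TangentSpace 𝓘(ℝ, EP) p ⧸ F p :=
  (F p).mkQ.comp (symbolLift D (hF.exists_isFoliatedChart p).choose_spec.choose_spec.1 p)

theorem symbol_apply (hF : IsFoliation F) (D : RelDerivation EX π F) (h : IsFoliatedChart F φ S)
    {p : P} (hp : p ∈ φ.source) (w : TangentSpace 𝓘(ℝ, EX) (π p)) :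
    symbol hF D p w = (F p).mkQ (symbolLift D h p w) :=
  (Submodule.Quotient.eq _).2 (symbolLift_sub_mem D _ h
    (hF.exists_isFoliatedChart p).choose_spec.choose_spec.2 hp w)

theorem isSymbol_symbol (hF : IsFoliation F) (D : RelDerivation EX π F) :
    IsSymbol D (symbol hF D) := by
  rintro U f ⟨p, hpU⟩ w v hv
  obtain ⟨φ, S, h, hp⟩ := hF.exists_isFoliatedChart p
  rw [symbol_apply hF D h hp] at hv
  have h1 := D.apply_eq_mvfderiv_symbolLift h hp hpU (isFlatFun_formFun f) w
  rw [funForm_formFun] at h1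
  rw [h1]
  exact ((isFlatFun_formFun f).mvfderiv_eq hpU ((Submodule.Quotient.eq _).1 hv)).symm

theorem IsSymbol.apply_eq {D : RelDerivation EX π F}
    {σ : ∀ p : P, TangentSpace 𝓘(ℝ, EX) (π p) →ₗ[ℝ] TangentSpace 𝓘(ℝ, EP) p ⧸ F p}
    (hσ : IsSymbol D σ) {U : Opens P} {f : P → ℝ} (hf : IsFlatFun F U f) {p : P} (hp : p ∈ U)
    {w : TangentSpace 𝓘(ℝ, EX) (π p)} {v : TangentSpace 𝓘(ℝ, EP) p} (hv : (F p).mkQ v = σ p w) :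
    (D.toFun U 0 (funForm π hf)).1 ⟨p, hp⟩ (fun _ => w) = mvfderiv 𝓘(ℝ, EP) f p v :=
  (hσ U (funForm π hf) ⟨p, hp⟩ w v hv).trans (mvfderiv_congr (formFun_funForm hf hp) v)

/-- The symbol is unique. -/
theorem IsSymbol.eq (hF : IsFoliation F) {D : RelDerivation EX π F}
    {σ σ' : ∀ p : P, TangentSpace 𝓘(ℝ, EX) (π p) →ₗ[ℝ] TangentSpace 𝓘(ℝ, EP) p ⧸ F p}
    (hσ : IsSymbol D σ) (hσ' : IsSymbol D σ') : σ = σ' := by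
  funext p
  ext w
  obtain ⟨v, hv⟩ := (F p).mkQ_surjective (σ p w)
  obtain ⟨v', hv'⟩ := (F p).mkQ_surjective (σ' p w)
  obtain ⟨φ, S, h, hp⟩ := hF.exists_isFoliatedChart p
  rw [← hv, ← hv']
  refine (Submodule.Quotient.eq _).2 (h.sub_mem_of_forall_isFlatFun hp fun f hf => ?_)
  have hpφ : p ∈ chartDomain φ := hp
  rw [← hσ.apply_eq hf hpφ hv, ← hσ'.apply_eq hf hpφ hv']

/-- The preimage in `TP` of the image of the symbol. -/
def distributionOf (hF : IsFoliation F) (D : RelDerivation EX π F) (p : P) :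
    Submodule ℝ (TangentSpace 𝓘(ℝ, EP) p) :=
  (LinearMap.range (symbol hF D p)).comap (F p).mkQ

theorem mem_distributionOf_iff (hF : IsFoliation F) (D : RelDerivation EX π F)
    (h : IsFoliatedChart F φ S) {p : P} (hp : p ∈ φ.source) {v : TangentSpace 𝓘(ℝ, EP) p} :
    v ∈ distributionOf hF D p ↔ ∃ w, v - symbolLift D h p w ∈ F p := by
  constructor
  · rintro ⟨w, hw⟩
    rw [symbol_apply hF D h hp] at hw
    exact ⟨w, (Submodule.Quotient.eq _).1 hw.symm⟩
  · rintro ⟨w, hw⟩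
    exact ⟨w, (symbol_apply hF D h hp w).trans ((Submodule.Quotient.eq _).2 hw).symm⟩

theorem le_distributionOf (hF : IsFoliation F) (D : RelDerivation EX π F) (p : P) :
    F p ≤ distributionOf hF D p := fun v hv => by
  obtain ⟨φ, S, h, hp⟩ := hF.exists_isFoliatedChart p
  exact (mem_distributionOf_iff hF D h hp).2 ⟨0, by rwa [map_zero, sub_zero]⟩

theorem symbolLift_mem_distributionOf (hF : IsFoliation F) (D : RelDerivation EX π F)
    (h : IsFoliatedChart F φ S) {p : P} (hp : p ∈ φ.source)
    (w : TangentSpace 𝓘(ℝ, EX) (π p)) : symbolLift D h p w ∈ distributionOf hF D p :=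
  (mem_distributionOf_iff hF D h hp).2 ⟨w, by rw [sub_self]; exact zero_mem _⟩

theorem distributionOf_eq_sup (hF : IsFoliation F) (D : RelDerivation EX π F)
    (h : IsFoliatedChart F φ S) {p : P} (hp : p ∈ φ.source) :
    distributionOf hF D p = F p ⊔ LinearMap.range (symbolLift D h p) := by
  refine le_antisymm (fun v hv => ?_) (sup_le (le_distributionOf hF D p) ?_)
  · obtain ⟨w, hw⟩ := (mem_distributionOf_iff hF D h hp).1 hv
    exact Submodule.mem_sup.2 ⟨_, hw, _, ⟨w, rfl⟩, sub_add_cancel _ _⟩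
  · rintro _ ⟨w, rfl⟩
    exact symbolLift_mem_distributionOf hF D h hp w

/-! ### The distribution of a derivation is Pfaffian, and the two constructions are mutually
inverse. -/

variable (hπ : IsSmoothSubmersion EP EX π) (hFπ : ∀ p, F p ≤ vertical EP EX π p)

theorem distributionOf_sup_vertical (hF : IsFoliation F) {D : RelDerivation EX π F}
    (hD : ExtendsDeRham hπ hFπ D) (p : P) :
    distributionOf hF D p ⊔ vertical EP EX π p = ⊤ := by
  obtain ⟨φ, S, h, hp⟩ := hF.exists_isFoliatedChart p
  refine eq_top_iff.2 fun v _ => Submodule.mem_sup.2 ⟨_, symbolLift_mem_distributionOf hF D h hp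
    (mfderiv 𝓘(ℝ, EP) 𝓘(ℝ, EX) π p v), _, ?_, add_sub_cancel _ _⟩
  change mfderiv 𝓘(ℝ, EP) 𝓘(ℝ, EX) π p (v - _) = 0
  rw [map_sub, mfderiv_symbolLift hπ hFπ hD h hp, sub_self]

/-- If `v` equals the lift of `w` modulo `F`, applying `Tπ` gives `Tπ v = w`. For vertical `v` this
forces `w = 0`, hence `v ∈ F`. -/
theorem distributionOf_inf_vertical (hF : IsFoliation F) {D : RelDerivation EX π F}
    (hD : ExtendsDeRham hπ hFπ D) (p : P) :
    distributionOf hF D p ⊓ vertical EP EX π p = F p := by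
  obtain ⟨φ, S, h, hp⟩ := hF.exists_isFoliatedChart p
  refine le_antisymm (fun v hv => ?_) (le_inf (le_distributionOf hF D p) (hFπ p))
  obtain ⟨w, hw⟩ := (mem_distributionOf_iff hF D h hp).1 hv.1
  have h1 : mfderiv 𝓘(ℝ, EP) 𝓘(ℝ, EX) π p (v - symbolLift D h p w) = 0 := hFπ p hw
  have h2 : mfderiv 𝓘(ℝ, EP) 𝓘(ℝ, EX) π p v = 0 := hv.2
  rw [map_sub, mfderiv_symbolLift hπ hFπ hD h hp, h2, zero_sub, neg_eq_zero] at h1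
  rwa [h1, map_zero, sub_zero] at hw

/-- The local frame consists of the coordinate fields spanning `F` in a foliated chart and the
symbol lifts of a frame of `TX`. The two families are jointly independent because `Tπ` kills the
first and maps the second back to that frame. -/
theorem isSmoothDistribution_distributionOf (hF : IsFoliation F) {D : RelDerivation EX π F}
    (hD : ExtendsDeRham hπ hFπ D) : IsSmoothDistribution (distributionOf hF D) := by
  intro p₀
  obtain ⟨φ, S, h, hp₀⟩ := hF.exists_isFoliatedChart p₀
  let b := Module.finBasis ℝ S
  have hbspan : Submodule.span ℝ (range fun i => (b i : EP)) = S := by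
    have h1 := congrArg (Submodule.map S.subtype) b.span_eq
    rwa [Submodule.map_span, ← range_comp, Submodule.map_top, Submodule.range_subtype] at h1
  have hbli : LinearIndependent ℝ fun i => (b i : EP) :=
    b.linearIndependent.map' S.subtype (Submodule.ker_subtype S)
  let c := Module.finBasis ℝ EX
  let t := triv EX (π p₀)
  let s : Fin (Module.finrank ℝ S) ⊕ Fin (Module.finrank ℝ EX) → ∀ p : P,
      TangentSpace 𝓘(ℝ, EP) p :=
    Sum.elim (fun i => chartField φ (b i)) fun j p => symbolLift D h p (t.symmL ℝ (π p) (c j))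
  refine ⟨chartDomain φ ⊓ Opens.comap ⟨π, hπ.contMDiff.continuous⟩ (frameDomain EX (π p₀)),
    ⟨hp₀, mem_baseSet_triv (π p₀)⟩, _, fun i => s (finSumFinEquiv.symm i), fun i p hp => ?_,
    fun p hp => ?_⟩
  · refine ContMDiffAt.contMDiffWithinAt ?_
    have hsm : ∀ j, SmoothFieldAt (s j) p := by
      rintro (j | j)
      · exact smoothFieldAt_chartField h.mem_maximalAtlas hp.1 _
      · exact smoothFieldAt_symbolLift hπ D h hp.1 hp.2 _
    exact hsm _
  have hpφ : p ∈ φ.source := hp.1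
  have hpt : π p ∈ t.baseSet := hp.2
  let e : EX ≃ₗ[ℝ] TangentSpace 𝓘(ℝ, EX) (π p) :=
    LinearEquiv.ofLinearMap (t.symmL ℝ (π p)).toLinearMap (t.continuousLinearMapAt ℝ (π p)).toLinearMap
      (LinearMap.ext fun w => t.symmL_continuousLinearMapAt hpt w)
      (LinearMap.ext fun w => t.continuousLinearMapAt_symmL hpt w)
  have hlift : ∀ w, mfderiv 𝓘(ℝ, EP) 𝓘(ℝ, EX) π p (symbolLift D h p w) = w :=
    mfderiv_symbolLift hπ hFπ hD h hpφ
  have hinj : Function.Injective (symbolLift D h p) := Function.LeftInverse.injective hlift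
  have hs : (fun i => s i p) = Sum.elim (fun i => chartField φ (b i) p)
      fun j => symbolLift D h p (e (c j)) := by
    funext i; cases i <;> rfl
  have hspan2 : Submodule.span ℝ (range fun j => symbolLift D h p (e (c j))) =
      LinearMap.range (symbolLift D h p) := by
    have h1 : (fun j => symbolLift D h p (e (c j))) =
        symbolLift D h p ∘ (c.map e) := by funext j; simp
    rw [h1, range_comp, ← Submodule.map_span, (c.map e).span_eq, Submodule.map_top]
  have hrange : range (fun i => s (finSumFinEquiv.symm i) p) = range fun i => s i p :=
    finSumFinEquiv.symm.surjective.range_comp fun i => s i p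
  refine ⟨?_, ?_⟩
  · refine LinearIndependent.comp (v := fun i => s i p) ?_ _ finSumFinEquiv.symm.injective
    rw [hs]
    refine LinearIndependent.sum_type (h.linearIndependent_chartField hbli hpφ) ?_ ?_
    · have h1 := (c.map e).linearIndependent.map' (symbolLift D h p) (LinearMap.ker_eq_bot.2 hinj)
      have h2 : symbolLift D h p ∘ (c.map e) = fun j => symbolLift D h p (e (c j)) := by
        funext j; simp
      rwa [h2] at h1
    · rw [h.span_chartField hbspan hpφ, hspan2, Submodule.disjoint_def]
      rintro _ hv ⟨w, rfl⟩
      have h1 : mfderiv 𝓘(ℝ, EP) 𝓘(ℝ, EX) π p (symbolLift D h p w) = 0 := hFπ p hv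
      rw [hlift] at h1
      rw [h1, map_zero]
  · rw [hrange, hs, Set.Sum.elim_range, Submodule.span_union, h.span_chartField hbspan hpφ, hspan2,
      distributionOf_eq_sup hF D h hpφ]

theorem isPfaffian_distributionOf (hF : IsFoliation F) {D : RelDerivation EX π F}
    (hD : ExtendsDeRham hπ hFπ D) : IsPfaffian EX π (distributionOf hF D) := by
  have h1 : (fun p => distributionOf hF D p ⊓ vertical EP EX π p) = F :=
    funext (distributionOf_inf_vertical hπ hFπ hF hD)
  exact ⟨isSmoothDistribution_distributionOf hπ hFπ hF hD,
    distributionOf_sup_vertical hπ hFπ hF hD, h1.symm ▸ hF.isSmoothDistribution,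
    h1.symm ▸ hF.isInvolutive⟩

/-- The derivation of `C` on functions, evaluated on projections of vectors of `C`. -/
theorem derivationOf_funForm (hCs : IsSmoothDistribution C)
    (hC : ∀ p, C p ⊔ vertical EP EX π p = ⊤) (hCF : ∀ p, C p ⊓ vertical EP EX π p = F p)
    {U : Opens P} {f : P → ℝ} (hf : IsFlatFun F U f) {p : P} (hp : p ∈ U)
    {v : TangentSpace 𝓘(ℝ, EP) p} (hv : v ∈ C p) :
    ((derivationOf hπ hCs hC hCF).toFun U 0 (funForm π hf)).1 ⟨p, hp⟩
      (fun _ => mfderiv 𝓘(ℝ, EP) 𝓘(ℝ, EX) π p v) = mvfderiv 𝓘(ℝ, EP) f p v := by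
  refine (derivAt_mfderiv hπ hC hCF (funForm π hf) ⟨p, hp⟩ (v := fun _ => v) fun _ => hv).trans ?_
  rw [extDerivAt_toFormOnTotal_zero hπ _ hp, mvfderiv_congr (formFun_funForm hf hp)]

/-- Both derivations extend the de Rham differential, so flat functions suffice. On these, both
differentiate along the symbol lift of `w`, which lies in the distribution and projects to `w`. -/
theorem derivationOf_distributionOf (hF : IsFoliation F) {D : RelDerivation EX π F}
    (hD : ExtendsDeRham hπ hFπ D) (hCs : IsSmoothDistribution (distributionOf hF D))
    (hC : ∀ p, distributionOf hF D p ⊔ vertical EP EX π p = ⊤)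
    (hCF : ∀ p, distributionOf hF D p ⊓ vertical EP EX π p = F p) :
    derivationOf hπ hCs hC hCF = D := by
  refine RelDerivation.ext_of_funForm hπ hFπ (derivationOf_extendsDeRham hπ hFπ hCs hC hCF) hD ?_
  rintro U f hf ⟨p, hpU⟩
  obtain ⟨φ, S, h, hp⟩ := hF.exists_isFoliatedChart p
  ext u
  have hu : u = fun _ => u 0 := funext fun i => congrArg u (Subsingleton.elim (α := Fin 1) i 0)
  rw [hu, D.apply_eq_mvfderiv_symbolLift h hp hpU hf,
    ← derivationOf_funForm hπ hCs hC hCF hf hpU (symbolLift_mem_distributionOf hF D h hp (u 0)),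
    mfderiv_symbolLift hπ hFπ hD h hp]

/-- The derivation of `C` sends a flat `f` to `v f` on `Tπ v`. A representative of `σ (Tπ v)` and
`v` thus agree on all flat functions, hence modulo `F`. -/
theorem IsSymbol.apply_mfderiv_of_mem (hF : IsFoliation F) (hCs : IsSmoothDistribution C)
    (hC : ∀ p, C p ⊔ vertical EP EX π p = ⊤) (hCF : ∀ p, C p ⊓ vertical EP EX π p = F p)
    {σ : ∀ p : P, TangentSpace 𝓘(ℝ, EX) (π p) →ₗ[ℝ] TangentSpace 𝓘(ℝ, EP) p ⧸ F p}
    (hσ : IsSymbol (derivationOf hπ hCs hC hCF) σ) {p : P} {v : TangentSpace 𝓘(ℝ, EP) p}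
    (hv : v ∈ C p) : σ p (mfderiv 𝓘(ℝ, EP) 𝓘(ℝ, EX) π p v) = (F p).mkQ v := by
  obtain ⟨v', hv'⟩ := (F p).mkQ_surjective (σ p (mfderiv 𝓘(ℝ, EP) 𝓘(ℝ, EX) π p v))
  obtain ⟨φ, S, h, hp⟩ := hF.exists_isFoliatedChart p
  rw [← hv']
  refine (Submodule.Quotient.eq _).2 (h.sub_mem_of_forall_isFlatFun hp fun f hf => ?_)
  have hpφ : p ∈ chartDomain φ := hp
  rw [← hσ.apply_eq hf hpφ hv', derivationOf_funForm hπ hCs hC hCF hf hpφ hv]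

/-- `C` is recovered from the symbol of its derivation. -/
theorem IsSymbol.eq_comap_range (hF : IsFoliation F) (hCs : IsSmoothDistribution C)
    (hC : ∀ p, C p ⊔ vertical EP EX π p = ⊤) (hCF : ∀ p, C p ⊓ vertical EP EX π p = F p)
    {σ : ∀ p : P, TangentSpace 𝓘(ℝ, EX) (π p) →ₗ[ℝ] TangentSpace 𝓘(ℝ, EP) p ⧸ F p}
    (hσ : IsSymbol (derivationOf hπ hCs hC hCF) σ) (p : P) :
    C p = (LinearMap.range (σ p)).comap (F p).mkQ := by
  ext v
  constructor
  · exact fun hv => ⟨_, hσ.apply_mfderiv_of_mem hπ hF hCs hC hCF hv⟩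
  · rintro ⟨w, hw⟩
    -- The vector `w` is lifted to `c ∈ C`, whose class is `σ w`. Then `v - c` lies in `F ⊆ C`, so
    -- `v ∈ C`.
    obtain ⟨c, hc, rfl⟩ := exists_mem_mfderiv_eq (hπ.surjective p) (hC p) w
    rw [hσ.apply_mfderiv_of_mem hπ hF hCs hC hCF hc] at hw
    have h1 : v - c ∈ F p := (Submodule.Quotient.eq _).1 hw.symm
    rw [← hCF] at h1
    exact (sub_add_cancel v c) ▸ add_mem h1.1 hc

end Correspondence

end Pfaffian

end

/-! ### The one-to-one correspondence. -/

theorem mainTheorem8 {EP EX P X : Type*}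
    [NormedAddCommGroup EP] [NormedSpace ℝ EP] [FiniteDimensional ℝ EP]
    [NormedAddCommGroup EX] [NormedSpace ℝ EX] [FiniteDimensional ℝ EX]
    [TopologicalSpace P] [T2Space P] [SecondCountableTopology P]
    [ChartedSpace EP P] [IsManifold 𝓘(ℝ, EP) ∞ P]
    [TopologicalSpace X] [T2Space X] [SecondCountableTopology X]
    [ChartedSpace EX X] [IsManifold 𝓘(ℝ, EX) ∞ X]
    (π : P → X) (hπ : IsSmoothSubmersion EP EX π)
    (F : ∀ p : P, Submodule ℝ (TangentSpace 𝓘(ℝ, EP) p))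
    (hF : IsFoliation F) (hFπ : ∀ p, F p ≤ vertical EP EX π p) :
    ∃ Φ : {C : ∀ p : P, Submodule ℝ (TangentSpace 𝓘(ℝ, EP) p) //
          IsPfaffian EX π C ∧ ∀ p, C p ⊓ vertical EP EX π p = F p} ≃
        {D : RelDerivation EX π F // ExtendsDeRham hπ hFπ D},
      -- the derivation of `C` is `α ↦ d(α ∘ Tπ)` restricted to `C`
      (∀ C, ∀ (U : Opens P) (k : ℕ) (α : FlatForm (EX := EX) π F k U) (p : U)
        (v : Fin (k + 1) → TangentSpace 𝓘(ℝ, EP) (p : P)), (∀ i, v i ∈ C.1 p) →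
        ((Φ C).1.toFun U k α).1 p (fun i => mfderiv 𝓘(ℝ, EP) 𝓘(ℝ, EX) π p (v i)) =
          extDerivAt (toFormOnTotal α.1) (p : P) v) ∧
      -- its symbol is the inverse of `C / F ≅ π^*TX`
      (∀ C, (∃! σ, IsSymbol (Φ C).1 σ) ∧ ∀ σ, IsSymbol (Φ C).1 σ →
        ∀ (p : P), ∀ v ∈ C.1 p,
          σ p (mfderiv 𝓘(ℝ, EP) 𝓘(ℝ, EX) π p v) = (F p).mkQ v) ∧
      -- conversely, the distribution of `D` is the preimage in `TP` of the image of the symbol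
      (∀ D, ∀ σ, IsSymbol D.1 σ → ∀ p : P,
        (Φ.symm D).1 p = (LinearMap.range (σ p)).comap (F p).mkQ) := by
  let Ψ : {C : ∀ p : P, Submodule ℝ (TangentSpace 𝓘(ℝ, EP) p) //
        IsPfaffian EX π C ∧ ∀ p, C p ⊓ vertical EP EX π p = F p} →
      {D : RelDerivation EX π F // ExtendsDeRham hπ hFπ D} := fun C =>
    ⟨derivationOf hπ C.2.1.smooth C.2.1.transverse C.2.2,
      derivationOf_extendsDeRham hπ hFπ C.2.1.smooth C.2.1.transverse C.2.2⟩
  have hΨ : Function.Bijective Ψ := by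
    -- Injectivity: equal derivations share a symbol, and each distribution is the preimage of its
    -- image. Surjectivity: the distribution of `D` has `D` as its derivation.
    refine ⟨fun C C' h => Subtype.ext (funext fun p => ?_), fun D => ?_⟩
    · have h1 : (Ψ C).1 = (Ψ C').1 := congrArg Subtype.val h
      have hσ : IsSymbol (Ψ C).1 (symbol hF (Ψ C).1) := isSymbol_symbol hF _
      have hσ' : IsSymbol (Ψ C').1 (symbol hF (Ψ C).1) := h1 ▸ hσ
      exact (IsSymbol.eq_comap_range hπ hF C.2.1.smooth C.2.1.transverse C.2.2 hσ p).trans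
        (IsSymbol.eq_comap_range hπ hF C'.2.1.smooth C'.2.1.transverse C'.2.2 hσ' p).symm
    · exact ⟨⟨distributionOf hF D.1, isPfaffian_distributionOf hπ hFπ hF D.2,
        distributionOf_inf_vertical hπ hFπ hF D.2⟩,
        Subtype.ext (derivationOf_distributionOf hπ hFπ hF D.2
          (isSmoothDistribution_distributionOf hπ hFπ hF D.2)
          (distributionOf_sup_vertical hπ hFπ hF D.2)
          (distributionOf_inf_vertical hπ hFπ hF D.2))⟩
  refine ⟨Equiv.ofBijective Ψ hΨ, fun C U k α p v hv => ?_, fun C => ⟨?_, fun σ hσ p v hv => ?_⟩,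
    fun D σ hσ p => ?_⟩
  · exact derivAt_mfderiv hπ C.2.1.transverse C.2.2 α p hv
  · exact ⟨symbol hF (Ψ C).1, isSymbol_symbol hF _, fun σ hσ => hσ.eq hF (isSymbol_symbol hF _)⟩
  · exact IsSymbol.apply_mfderiv_of_mem hπ hF C.2.1.smooth C.2.1.transverse C.2.2 hσ hv
  -- The inverse of `Ψ` is known only through bijectivity; writing `D` as the derivation of some `C`
  -- turns the claim into the recovery of `C` from a symbol.
  · obtain ⟨C, rfl⟩ := (Equiv.ofBijective Ψ hΨ).surjective D
    rw [Equiv.symm_apply_apply]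
    exact IsSymbol.eq_comap_range hπ hF C.2.1.smooth C.2.1.transverse C.2.2 hσ p
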